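/- **Setting.** Let $X=L^2(0,1)$ with norm $|\cdot|_2$ and inner product $(\cdot,\cdot)$, and let $H_0^1=H_0^1(0,1)$. Set $\eta_k(r)=\sqrt2\sin(\pi k r)$, $k\in\mathbb N=\{1,2,\dots\}$, $E_N=\mathrm{span}\{\eta_1,\dots,\eta_N\}\cong\mathbb R^N$, and let $P_N$ be the orthogonal projection of $X$ onto $E_N$. Let $A:X\to X$ be a nonnegative symmetric operator of trace class, $A_{ij}=(\eta_i,A\eta_j)$, $A_N=P_NAP_N$, and $a_0=\sup_{x\in H_0^1\setminus\{0\}}(x,Ax)/|x'|_2^2$. Let $F:H_0^1\to X$ be a map, $F^{(k)}=(F,\eta_k)$. For a cylinder function $u=g\circ P_N$, $g\in C^2(E_N)$, put $$Lu(x)=\tfrac12\sum_{i,j}A_{ij}\,\partial^2_{ij}u(x)+\sum_k\big((x,\eta_k'')+F^{(k)}(x)\big)\,\partial_ku(x),\qquad x\in H_0^1,$$ where $\partial_k$ is the derivative in direction $\eta_k$. **Weights.** Let $V_\kappa(x)=e^{\kappa|x|_2^2}$. Let $V_{2,\kappa}=V_\kappa$ on $X$ and $\Theta_{2,\kappa}(x)=V_\kappa(x)(1+|x'|_2^2)$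 on $H_0^1$; for $p>2$ let $$V_{p,\kappa}(x)=V_\kappa(x)(1+|x|_p^p)\ \ (x\in X),\qquad \Theta_{p,\kappa}(x)=V_{p,\kappa}(x)(1+|x'|_2^2)+V_\kappa(x)\,\big|(|x|^{p/2})'\big|_2^2\ \ (x\in H_0^1),$$ and $\Theta_{p,\kappa}=\infty$ on $X\setminus H_0^1$. Then $\{V_{p,\kappa}<\infty\}=X_p:=L^p(0,1)$ and $\{\Theta_{p,\kappa}<\infty\}=H_0^1$. For a weight $W:X\to(0,\infty]$, the space $WC_W$ consists of all $f:\{W<\infty\}\to\mathbb R$ that are weakly continuous on each $\{W\le R\}$ and satisfy $\lim_{R\to\infty}\sup_{\{W\ge R\}}|f|/W=0$; let $\|f\|_W=\sup_{\{W<\infty\}}|f|/W$ (for any $f$, with values in $[0,\infty]$). Write $WC_{p,\kappa}$, $\|\cdot\|_{p,\kappa}$ for $W=V_{p,\kappa}$ and $W_1C_{p,\kappa}$, $\|\cdot\|_{1,p,\kappa}$ for $W=\Theta_{p,\kappa}$. For $\kappa\ge0$ let $\mathcal D_\kappa$ be the set of all $u=g\circ P_N$, $N\in\mathbb N$, $g\in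 C^2(E_N)$, with $$\|u\|_{2,\kappa}+\big\||Du|_2\big\|_{2,\kappa}+\|\mathrm{Tr}(AD^2u)\|_{2,\kappa}<\infty.$$ **Assumptions.** There are bounded locally Lipschitz vector fields $F_N:E_N\to E_N$, $N\in\mathbb N$, such that, with $$L_Nv(x)=\tfrac12\mathrm{Tr}(A_ND^2v)(x)+(x''+F_N(x),Dv(x)),\qquad x\in E_N,$$ the following hold. * (F2a) There are $\kappa_0\in(0,\frac1{4a_0}]$ (any $\kappa_0\in(0,\infty)$ being allowed if $a_0=0$) and $Q_{\rm reg}\subset[2,\infty)$ with $2\in Q_{\rm reg}$, and for all $\kappa\in(0,\kappa_0)$, $q\in Q_{\rm reg}$ there are $m_{q,\kappa}>0$ and $\lambda_{q,\kappa}\in\mathbb R$ such that, for all $N\in\mathbb N$, $$L_N(V_{q,\kappa}|_{E_N})\le\lambda_{q,\kappa}V_{q,\kappa}-m_{q,\kappa}\Theta_{q,\kappa}\quad\text{on }E_N.$$ * (F2c) $\lim_{N\to\infty}|P_NF(x)-F_N(P_Nx)|_2=0$ for all $x\in H_0^1$. **Proposition 6.1.** Let $\kappa_0$, $Q_{\rm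 reg}$, $\lambda_{q,\kappa}$, $m_{q,\kappa}$ be as in (F2a). Let $q\in Q_{\rm reg}$, $\kappa\in(0,\kappa_0)$ and $\kappa_1\in[0,\kappa)$ be such that $V_{\kappa_1}F^{(k)}\in W_1C_{q,\kappa}$ for all $k\in\mathbb N$. Then for all $u\in\mathcal D_{\kappa_1}$ and all $\lambda\ge\lambda_{q,\kappa}$ one has $u|_{X_q}\in WC_{q,\kappa}$, $\lambda u-Lu\in W_1C_{q,\kappa}$ and $$\|u\|_{q,\kappa}\le\frac1{m_{q,\kappa}}\,\|\lambda u-Lu\|_{1,q,\kappa}.$$ -/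

import Mathlib

open Set Filter Topology MeasureTheory
open scoped ENNReal NNReal ContDiff

noncomputable section

namespace Kolmogorov

/-- Lebesgue measure on the interval `(0,1)`. -/
abbrev unitVol : Measure ℝ := volume.restrict (Ioo (0 : ℝ) 1)

/-- The state space `X = L²(0,1)`. -/
abbrev X : Type := Lp ℝ 2 unitVol

/-! ### Sobolev space with Dirichlet boundary conditions -/

/-- `g` is a weak (distributional) derivative of `f` on `(0,1)`. -/
def HasWeakDeriv (f g : ℝ → ℝ) : Prop :=
  LocallyIntegrableOn f (Ioo 0 1) ∧ LocallyIntegrableOn g (Ioo 0 1) ∧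
    ∀ φ : ℝ → ℝ, ContDiff ℝ ∞ φ → HasCompactSupport φ → tsupport φ ⊆ Ioo 0 1 →
      ∫ r in Ioo (0 : ℝ) 1, f r * deriv φ r = -∫ r in Ioo (0 : ℝ) 1, g r * φ r

/-- `|f'|₂ ∈ [0,∞]`, where `f'` is the weak derivative of `f` on `(0,1)`; the value is `∞` if `f`
has no weak derivative. The weak derivative is unique up to null sets, so the infimum is over
equal numbers. -/
def derivNorm (f : ℝ → ℝ) : ℝ≥0∞ :=
  ⨅ (g : ℝ → ℝ) (_ : HasWeakDeriv f g), eLpNorm g 2 unitVol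

/-- `H₀¹(0,1)` as a subset of `X`: the weak derivative exists and is square integrable, and the
continuous representative vanishes at `0` and `1`. -/
def H01 : Set X :=
  {x | (∃ g : ℝ → ℝ, MemLp g 2 unitVol ∧ HasWeakDeriv x g) ∧
    ∃ c : ℝ → ℝ, ContinuousOn c (Icc 0 1) ∧ c 0 = 0 ∧ c 1 = 0 ∧ x =ᵐ[unitVol] c}

/-! ### The eigenbasis of the Dirichlet Laplacian and finite-dimensional projections -/

/-- The function `η_{k+1}(r) = √2 sin(π (k+1) r)`. The indices of the eigenbasis are shifted
by one, so that they run through `k = 0, 1, 2, …`. -/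
def etaFun (k : ℕ) (r : ℝ) : ℝ := √2 * Real.sin (Real.pi * (k + 1) * r)

lemma memLp_etaFun (k : ℕ) : MemLp (etaFun k) 2 unitVol := by
  refine MemLp.of_bound ?_ (√2) (Eventually.of_forall fun r => ?_)
  · exact Continuous.aestronglyMeasurable (by unfold etaFun; fun_prop)
  · rw [etaFun, norm_mul, Real.norm_of_nonneg (Real.sqrt_nonneg _)]
    exact mul_le_of_le_one_right (Real.sqrt_nonneg _) (Real.abs_sin_le_one _)

/-- `η_{k+1}` as an element of `X`. -/
def eta (k : ℕ) : X := (memLp_etaFun k).toLp (etaFun k)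

/-- `η_{k+1}'' = -(π (k+1))² η_{k+1}`. -/
lemma deriv_deriv_etaFun (k : ℕ) (r : ℝ) :
    deriv (deriv (etaFun k)) r = -(Real.pi * (k + 1)) ^ 2 * etaFun k r := by
  have h1 : deriv (etaFun k) =
      fun r => √2 * (Real.cos (Real.pi * (k + 1) * r) * (Real.pi * (k + 1))) := by
    funext s
    have h := ((hasDerivAt_id s).const_mul (Real.pi * (k + 1))).sin.const_mul √2
    refine h.deriv.trans ?_
    simp only [id, mul_one]
  rw [h1]
  have h := (((hasDerivAt_id r).const_mul (Real.pi * (k + 1))).cos.mul_const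
    (Real.pi * (k + 1))).const_mul √2
  refine (h.deriv).trans ?_
  simp only [etaFun, id]
  ring

/-- `(Δx, η_{k+1}) := (x, η_{k+1}'') = -(π (k+1))² (x, η_{k+1})`. -/
def lapCoeff (x : X) (k : ℕ) : ℝ := -(Real.pi * (k + 1)) ^ 2 * inner ℝ x (eta k)

/-- `E_N = span {η_1, …, η_N}`, identified with `ℝ^N` (Euclidean norm) through the orthonormal
basis `η_1, …, η_N`. -/
abbrev E (N : ℕ) : Type := EuclideanSpace ℝ (Fin N)

/-- The inclusion `E_N ⊂ X`. -/
def incl (N : ℕ) (ξ : E N) : X := ∑ i : Fin N, ξ i • eta i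

/-- The orthogonal projection `P_N : X → E_N`, in coordinates. -/
def proj (N : ℕ) (x : X) : E N := WithLp.toLp 2 fun i : Fin N => inner ℝ x (eta i)

/-! ### Weights and weighted spaces of weakly continuous functions -/

/-- `V_κ(x) = exp (κ |x|₂²)`. -/
def expW (κ : ℝ) (x : X) : ℝ := Real.exp (κ * ‖x‖ ^ 2)

/-- `|x|_p^p ∈ [0,∞]`. -/
def lpPow (p : ℝ) (x : X) : ℝ≥0∞ := ∫⁻ r in Ioo (0 : ℝ) 1, ‖x r‖ₑ ^ p

/-- `X_p = L^p(0,1)` for `p ≥ 2`, as a subset of `X`. -/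
def Xp (p : ℝ) : Set X := {x | lpPow p x < ⊤}

/-- The Lyapunov function: `V_{2,κ} = V_κ`, and `V_{p,κ}(x) = V_κ(x) (1 + |x|_p^p)` for `p > 2`. -/
def V (p κ : ℝ) (x : X) : ℝ≥0∞ :=
  if p = 2 then ENNReal.ofReal (expW κ x) else ENNReal.ofReal (expW κ x) * (1 + lpPow p x)

open Classical in
/-- The coercivity weight, for `x ∈ H₀¹`: `Θ_{2,κ}(x) = V_κ(x) (1 + |x'|₂²)`, and
`Θ_{p,κ}(x) = V_{p,κ}(x) (1 + |x'|₂²) + V_κ(x) |(|x|^{p/2})'|₂²` for `p > 2`.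
It is `∞` outside `H₀¹`. -/
def Θ (p κ : ℝ) (x : X) : ℝ≥0∞ :=
  if x ∈ H01 then
    V p κ x * (1 + derivNorm x ^ 2) +
      if p = 2 then 0
      else ENNReal.ofReal (expW κ x) * derivNorm (fun r => |x r| ^ (p / 2)) ^ 2
  else ⊤

/-- The topology induced on a subset of `X` by the weak topology of `X`. -/
abbrev weakTop (D : Set X) : TopologicalSpace D :=
  TopologicalSpace.induced (fun x : D => toWeakSpace ℝ X x) inferInstance

/-- The weighted norm `‖f‖_W = sup_{W < ∞} |f| / W ∈ [0,∞]` of a function `f` on `D = {W < ∞}`. -/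
def wnorm {D : Set X} (W : X → ℝ≥0∞) (f : D → ℝ) : ℝ≥0∞ := ⨆ x : D, ‖f x‖ₑ / W x

/-- Membership in `WC_W` of a function `f` on `D = {W < ∞}`: it is weakly continuous on each
`{W ≤ R}`, and `sup_{W ≥ R} |f| / W → 0` as `R → ∞`. Below, `(D, W)` is `(X_p, V_{p,κ})` for
`WC_{p,κ}` and `(H₀¹, Θ_{p,κ})` for `W₁C_{p,κ}`. -/
def MemWC {D : Set X} (W : X → ℝ≥0∞) (f : D → ℝ) : Prop :=
  (∀ R : ℝ≥0, @ContinuousOn D ℝ (weakTop D) inferInstance f {x : D | W x ≤ R}) ∧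
    Tendsto (fun R : ℝ≥0 => ⨆ (x : D) (_ : (R : ℝ≥0∞) ≤ W x), ‖f x‖ₑ / W x) atTop (𝓝 0)

/-! ### The diffusion operator, the Kolmogorov operators and the test functions -/

/-- `A` is a nonnegative symmetric operator of trace class (for a nonnegative symmetric operator
this means that the diagonal series with respect to the orthonormal basis `(η_k)` converges). -/
def IsCovariance (A : X →L[ℝ] X) : Prop :=
  A.IsPositive ∧ Summable fun k : ℕ => inner ℝ (eta k) (A (eta k))

/-- `a₀ = sup_{x ∈ H₀¹ \ {0}} (x, A x) / |x'|₂²`. -/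
def a0 (A : X →L[ℝ] X) : ℝ≥0∞ :=
  ⨆ (x : X) (_ : x ∈ H01 ∧ x ≠ 0), ENNReal.ofReal (inner ℝ x (A x)) / derivNorm x ^ 2

/-- The directional derivative `∂_h u = (Du, h)`. -/
def pd {B : Type*} [NormedAddCommGroup B] [NormedSpace ℝ B] (h : B) (u : B → ℝ) (x : B) : ℝ :=
  fderiv ℝ u x h

/-- `Tr (A D²u(x)) = ∑_{i,j} A_{ij} ∂_i ∂_j u(x)` with `A_{ij} = (η_i, A η_j)`; for cylinder
functions only finitely many terms are nonzero. -/
def traceTerm (A : X →L[ℝ] X) (u : X → ℝ) (x : X) : ℝ :=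
  ∑' ij : ℕ × ℕ, inner ℝ (eta ij.1) (A (eta ij.2)) * pd (eta ij.1) (pd (eta ij.2) u) x

/-- The Kolmogorov operator
`L u(x) = ½ Tr (A D²u(x)) + ∑_k ((Δx, η_k) + (F(x), η_k)) ∂_k u(x)`, `x ∈ H₀¹`. -/
def kolm (A : X →L[ℝ] X) (F : H01 → X) (u : X → ℝ) (x : H01) : ℝ :=
  1 / 2 * traceTerm A u x +
    ∑' k : ℕ, (lapCoeff x k + inner ℝ (F x) (eta k)) * pd (eta k) u x

/-- The operator `L_N v(ξ) = ½ Tr (A_N D²v)(ξ) + (ξ'' + G(ξ), Dv(ξ))` on `E_N`, where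
`A_N = P_N A P_N` and `G` is a vector field on `E_N`. -/
def kolmFin (A : X →L[ℝ] X) (N : ℕ) (G : E N → E N) (v : E N → ℝ) (ξ : E N) : ℝ :=
  1 / 2 * ∑ i : Fin N, ∑ j : Fin N, inner ℝ (eta i) (A (eta j)) *
      pd (EuclideanSpace.single i 1) (pd (EuclideanSpace.single j 1) v) ξ +
    ∑ k : Fin N, (lapCoeff (incl N ξ) k + G ξ k) * pd (EuclideanSpace.single k 1) v ξ

/-- The test functions `𝒟_{p,κ}`: all `u = g ∘ P_N` with `g ∈ C²(ℝ^N)` and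
`‖u‖_{p,κ} + ‖|Du|₂‖_{p,κ} + ‖Tr (A D²u)‖_{p,κ} < ∞`. One writes `𝒟_κ` for `𝒟_{2,κ}`. -/
def testFun (A : X →L[ℝ] X) (p κ : ℝ) : Set (X → ℝ) :=
  {u | (∃ (N : ℕ) (g : E N → ℝ), ContDiff ℝ 2 g ∧ u = g ∘ proj N) ∧
    wnorm (V p κ) (fun x : Xp p => u x) + wnorm (V p κ) (fun x : Xp p => ‖fderiv ℝ u x‖) +
      wnorm (V p κ) (fun x : Xp p => traceTerm A u x) < ⊤}

/-! ### The conditions on the drift -/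

/-- Bounded locally Lipschitz vector fields `F_N : E_N → E_N`, `N ≥ 1`. -/
def IsApprox (FN : (N : ℕ) → E N → E N) : Prop :=
  ∀ N : ℕ, 1 ≤ N → (∃ C : ℝ, ∀ ξ, ‖FN N ξ‖ ≤ C) ∧ LocallyLipschitz (FN N)

/-- Condition (F2a) with witnesses `κ₀`, `Q_reg`, `m_{q,κ}`, `λ_{q,κ}`:
`L_N V_{q,κ} ≤ λ_{q,κ} V_{q,κ} - m_{q,κ} Θ_{q,κ}` on `E_N` for all `N`.
Both weights are finite on `E_N`. -/
def CondF2a (A : X →L[ℝ] X) (FN : (N : ℕ) → E N → E N) (κ₀ : ℝ) (Qreg : Set ℝ)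
    (m lam : ℝ → ℝ → ℝ) : Prop :=
  0 < κ₀ ∧ ENNReal.ofReal κ₀ ≤ 1 / (4 * a0 A) ∧ Qreg ⊆ Ici 2 ∧ 2 ∈ Qreg ∧
    ∀ κ ∈ Ioo 0 κ₀, ∀ q ∈ Qreg, 0 < m q κ ∧
      ∀ N : ℕ, 1 ≤ N → ∀ ξ : E N,
        kolmFin A N (FN N) (fun ζ => (V q κ (incl N ζ)).toReal) ξ ≤
          lam q κ * (V q κ (incl N ξ)).toReal - m q κ * (Θ q κ (incl N ξ)).toReal

/-- Condition (F2c): `|P_N F(x) - F_N(P_N x)|₂ → 0` for all `x ∈ H₀¹`. -/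
def CondF2c (F : H01 → X) (FN : (N : ℕ) → E N → E N) : Prop :=
  ∀ x : H01, Tendsto (fun N => ‖proj N (F x) - FN N (proj N x)‖) atTop (𝓝 0)

end Kolmogorov

end

open Kolmogorov

namespace Kolmogorov

/-! ### Trigonometric systems on `(0,1)` -/

/-! The estimate is a maximum principle for the quotient of `u` by the Lyapunov function `V`.
Suppose c = sup u⁺/V is positive. Since `u` grows at most like exp(κ₁|x|²) with κ₁ < κ, almost
maximizing points are bounded in `X`. Cylinder functions are weakly continuous and `V` is weakly
lower semicontinuous, so the supremum is attained at some x₀ (`exists_maximizer`). Thus u ≤ cV with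
equality at x₀.

The first order condition at x₀ says Du(x₀) = c DV(x₀). The left side lies in E_N, so a combination
α x₀ + β |x₀|^{q-2} x₀ with α > 0, β ≥ 0 is a sine polynomial. Inverting this scalar map pointwise
shows that x₀ is C¹ with zero boundary values, hence x₀ ∈ H₀¹ and Θ(x₀) < ∞
(`exists_regular_representative`). The second order condition says D²u(x₀) ≤ c D²V(x₀), which a
nonnegative `A` preserves under the trace (`traceTerm_le_of_max`).

Since x₀ is C¹, its sine partial sums converge uniformly and their derivatives converge in L². Hence
(F2a) at P_n x₀ passes to the limit: the drift by (F2c), and the trace because the Hessians of `V`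
converge in operator norm and `A` is of trace class (`kolm_le_of_max`). This gives Lu(x₀) ≤ c
(λ_{q,κ} V - m Θ)(x₀), and for λ ≥ λ_{q,κ} it follows that λu - Lu ≥ c m Θ at x₀. The same argument
for -u finishes the estimate.

Membership in the weighted spaces is a comparison of growth rates, except for the drift terms. There
V_{κ₁} has to be divided out of V_{κ₁}F^{(k)}, which requires the norm of `X` to be weakly
continuous on bounded subsets of H₀¹ (`continuousOn_weakTop_norm_sq`). -/

lemma continuous_etaFun (k : ℕ) : Continuous (etaFun k) := by
  unfold etaFun; fun_prop

lemma integrable_unitVol_of_continuousOn {f : ℝ → ℝ} (hf : ContinuousOn f (Icc 0 1)) :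
    Integrable f unitVol :=
  (hf.integrableOn_Icc).mono_set Ioo_subset_Icc_self

lemma integrable_unitVol_of_continuous {f : ℝ → ℝ} (hf : Continuous f) : Integrable f unitVol :=
  integrable_unitVol_of_continuousOn hf.continuousOn

lemma integral_unitVol_eq (f : ℝ → ℝ) : ∫ r, f r ∂unitVol = ∫ r in (0 : ℝ)..1, f r := by
  rw [intervalIntegral.integral_of_le zero_le_one, integral_Ioc_eq_integral_Ioo]

lemma integral_cos_pi_int (m : ℤ) :
    ∫ r, Real.cos (Real.pi * m * r) ∂unitVol = if m = 0 then 1 else 0 := by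
  rw [integral_unitVol_eq]
  split_ifs with h
  · simp [h]
  · have h0 : Real.pi * (m : ℝ) ≠ 0 := mul_ne_zero Real.pi_ne_zero (by exact_mod_cast h)
    rw [intervalIntegral.integral_comp_mul_left _ h0]
    simp [mul_comm Real.pi (m : ℝ), Real.sin_int_mul_pi]

lemma integral_cos_mul_cos (j k : ℤ) :
    ∫ r, Real.cos (Real.pi * j * r) * Real.cos (Real.pi * k * r) ∂unitVol =
      ((if j = k then 1 else 0) + (if j = -k then 1 else 0)) / 2 := by
  have h : ∀ r : ℝ, Real.cos (Real.pi * j * r) * Real.cos (Real.pi * k * r) =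
      (Real.cos (Real.pi * ((j - k : ℤ) : ℝ) * r) + Real.cos (Real.pi * ((j + k : ℤ) : ℝ) * r)) / 2 := by
    intro r
    push_cast
    rw [show Real.pi * ((j : ℝ) - k) * r = Real.pi * j * r - Real.pi * k * r by ring,
      show Real.pi * ((j : ℝ) + k) * r = Real.pi * j * r + Real.pi * k * r by ring,
      Real.cos_sub, Real.cos_add]
    ring
  simp_rw [h]
  rw [integral_div, integral_add, integral_cos_pi_int, integral_cos_pi_int]
  · simp only [sub_eq_zero, add_eq_zero_iff_eq_neg]
  all_goals exact integrable_unitVol_of_continuous (by fun_prop)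

lemma integral_sin_mul_sin (j k : ℤ) :
    ∫ r, Real.sin (Real.pi * j * r) * Real.sin (Real.pi * k * r) ∂unitVol =
      ((if j = k then 1 else 0) - (if j = -k then 1 else 0)) / 2 := by
  have h : ∀ r : ℝ, Real.sin (Real.pi * j * r) * Real.sin (Real.pi * k * r) =
      (Real.cos (Real.pi * ((j - k : ℤ) : ℝ) * r) - Real.cos (Real.pi * ((j + k : ℤ) : ℝ) * r)) / 2 := by
    intro r
    push_cast
    rw [show Real.pi * ((j : ℝ) - k) * r = Real.pi * j * r - Real.pi * k * r by ring,
      show Real.pi * ((j : ℝ) + k) * r = Real.pi * j * r + Real.pi * k * r by ring,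
      Real.cos_sub, Real.cos_add]
    ring
  simp_rw [h]
  rw [integral_div, integral_sub, integral_cos_pi_int, integral_cos_pi_int]
  · simp only [sub_eq_zero, add_eq_zero_iff_eq_neg]
  all_goals exact integrable_unitVol_of_continuous (by fun_prop)

lemma memLp_of_continuous {f : ℝ → ℝ} (hf : Continuous f) (p : ℝ≥0∞) : MemLp f p unitVol := by
  obtain ⟨C, hC⟩ := (isCompact_Icc (a := (0 : ℝ)) (b := 1)).exists_bound_of_continuousOn
    hf.continuousOn
  refine MemLp.of_bound hf.aestronglyMeasurable C ?_
  filter_upwards [ae_restrict_mem measurableSet_Ioo] with r hr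
  exact hC r (Ioo_subset_Icc_self hr)

lemma inner_X_eq (x y : X) : inner ℝ x y = ∫ r, x r * y r ∂unitVol := by
  rw [L2.inner_def]
  refine integral_congr_ae (Eventually.of_forall fun r => ?_)
  simp [mul_comm]

lemma inner_toLp_right (x : X) {f : ℝ → ℝ} (hf : MemLp f 2 unitVol) :
    inner ℝ x (hf.toLp f) = ∫ r, x r * f r ∂unitVol := by
  rw [inner_X_eq]
  refine integral_congr_ae ?_
  filter_upwards [hf.coeFn_toLp] with r hr
  rw [hr]

lemma inner_eta (x : X) (k : ℕ) : inner ℝ x (eta k) = ∫ r, x r * etaFun k r ∂unitVol :=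
  inner_toLp_right x _

lemma inner_toLp_toLp {f g : ℝ → ℝ} (hf : MemLp f 2 unitVol) (hg : MemLp g 2 unitVol) :
    inner ℝ (hf.toLp f) (hg.toLp g) = ∫ r, f r * g r ∂unitVol := by
  rw [inner_toLp_right]
  refine integral_congr_ae ?_
  filter_upwards [hf.coeFn_toLp] with r hr
  rw [hr]

lemma coeFn_eta (k : ℕ) : eta k =ᵐ[unitVol] etaFun k := (memLp_etaFun k).coeFn_toLp

lemma orthonormal_eta : Orthonormal ℝ eta := by
  rw [orthonormal_iff_ite]
  intro i j
  rw [eta, eta, inner_toLp_toLp]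
  have h : ∀ r, etaFun i r * etaFun j r = 2 * (Real.sin (Real.pi * ((i + 1 : ℤ) : ℝ) * r) *
      Real.sin (Real.pi * ((j + 1 : ℤ) : ℝ) * r)) := by
    intro r
    have := Real.mul_self_sqrt (show (0 : ℝ) ≤ 2 by norm_num)
    simp only [etaFun]
    push_cast
    linear_combination (Real.sin (Real.pi * (i + 1) * r) * Real.sin (Real.pi * (j + 1) * r)) * this
  simp_rw [h]
  rw [integral_const_mul, integral_sin_mul_sin]
  have h2 : ¬ ((i : ℤ) + 1 = -((j : ℤ) + 1)) := by omega
  have h3 : ((i : ℤ) + 1 = (j : ℤ) + 1) ↔ i = j := by omega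
  rw [if_neg h2, sub_zero, mul_div_cancel₀ _ two_ne_zero]
  simp only [h3]

/-- The cosine system `1, √2 cos(πr), √2 cos(2πr), …`. -/
noncomputable def cosFun (k : ℕ) (r : ℝ) : ℝ :=
  (if k = 0 then 1 else √2) * Real.cos (Real.pi * k * r)

lemma continuous_cosFun (k : ℕ) : Continuous (cosFun k) := by
  unfold cosFun; fun_prop

/-- The cosine system in `L²(0,1)`. -/
noncomputable def cosVec (k : ℕ) : X :=
  (memLp_of_continuous (continuous_cosFun k) 2).toLp (cosFun k)

lemma orthonormal_cosVec : Orthonormal ℝ cosVec := by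
  rw [orthonormal_iff_ite]
  intro i j
  rw [cosVec, cosVec, inner_toLp_toLp]
  have h : ∀ r, cosFun i r * cosFun j r = ((if i = 0 then 1 else √2) * (if j = 0 then 1 else √2)) *
      (Real.cos (Real.pi * ((i : ℤ) : ℝ) * r) * Real.cos (Real.pi * ((j : ℤ) : ℝ) * r)) := by
    intro r
    simp only [cosFun, Int.cast_natCast]
    ring
  simp_rw [h]
  rw [integral_const_mul, integral_cos_mul_cos]
  have h3 : ((i : ℤ) = (j : ℤ)) ↔ i = j := by omega
  have h4 : ((i : ℤ) = -(j : ℤ)) ↔ i = 0 ∧ j = 0 := by omega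
  simp only [h3, h4]
  by_cases hi : i = 0 <;> by_cases hj : j = 0
  · simp [hi, hj]
  · simp [hi, hj, Ne.symm hj]
  · simp [hi, hj]
  · have := Real.mul_self_sqrt (show (0 : ℝ) ≤ 2 by norm_num)
    simp only [hi, hj, if_false, false_and, this]
    split_ifs <;> norm_num

/-- An integrable function on `(0,1)` which is orthogonal to all `cos(πjr)` vanishes. -/
lemma ae_eq_zero_of_integral_cos {f : ℝ → ℝ} (hf : Integrable f unitVol)
    (h : ∀ j : ℤ, ∫ r, f r * Real.cos (Real.pi * j * r) ∂unitVol = 0) : f =ᵐ[unitVol] 0 := by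
  have hint : ∀ {g : ℝ → ℝ}, ContinuousOn g (Icc 0 1) → Integrable (fun r => f r * g r) unitVol := by
    intro g hg
    obtain ⟨C, hC⟩ := (isCompact_Icc (a := (0 : ℝ)) (b := 1)).exists_bound_of_continuousOn hg
    refine hf.mul_bdd (c := C) ((hg.mono Ioo_subset_Icc_self).aestronglyMeasurable
      measurableSet_Ioo) ?_
    filter_upwards [ae_restrict_mem measurableSet_Ioo] with r hr
    exact hC r (Ioo_subset_Icc_self hr)
  -- Multiplying by cos(πr) shifts the frequency j to j ± 1, so the orthogonality survives
  -- multiplication by powers of cos(πr), and hence by polynomials in it.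
  have hpow : ∀ k : ℕ, ∀ j : ℤ,
      ∫ r, f r * (Real.cos (Real.pi * r) ^ k * Real.cos (Real.pi * j * r)) ∂unitVol = 0 := by
    intro k
    induction k with
    | zero => simpa using h
    | succ k ih =>
      intro j
      have e : ∀ r : ℝ, f r * (Real.cos (Real.pi * r) ^ (k + 1) * Real.cos (Real.pi * j * r)) =
          (f r * (Real.cos (Real.pi * r) ^ k * Real.cos (Real.pi * ((j + 1 : ℤ) : ℝ) * r)) +
          f r * (Real.cos (Real.pi * r) ^ k * Real.cos (Real.pi * ((j - 1 : ℤ) : ℝ) * r))) / 2 := by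
        intro r
        push_cast
        rw [show Real.pi * ((j : ℝ) + 1) * r = Real.pi * j * r + Real.pi * r by ring,
          show Real.pi * ((j : ℝ) - 1) * r = Real.pi * j * r - Real.pi * r by ring,
          Real.cos_sub, Real.cos_add]
        ring
      simp_rw [e]
      rw [integral_div, integral_add, ih, ih]
      · simp
      all_goals exact hint (by fun_prop)
  have hpoly : ∀ P : Polynomial ℝ, ∫ r, f r * P.eval (Real.cos (Real.pi * r)) ∂unitVol = 0 := by
    intro P
    induction P using Polynomial.induction_on' with
    | add p q hp hq =>
      simp only [Polynomial.eval_add, mul_add]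
      rw [integral_add, hp, hq, add_zero]
      · exact hint (p.continuous.comp (by fun_prop)).continuousOn
      · exact hint (q.continuous.comp (by fun_prop)).continuousOn
    | monomial n a =>
      have := hpow n 0
      simp only [Int.cast_zero, mul_zero, zero_mul, Real.cos_zero, mul_one] at this
      simp only [Polynomial.eval_monomial]
      simp_rw [mul_left_comm _ a]
      rw [integral_const_mul, this, mul_zero]
  have hcont : ∀ g : ℝ → ℝ, Continuous g → ∫ r, f r * g r ∂unitVol = 0 := by
    intro g hg
    -- Since r ↦ cos(πr) is injective on (0,1), a continuous `g` is a continuous function `G` of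
    -- cos(πr); Weierstrass approximation of `G` on [-1,1] then applies.
    set G : ℝ → ℝ := fun s => g (Real.arccos s / Real.pi) with hG
    have hGc : Continuous G := hg.comp (Real.continuous_arccos.div_const _)
    have hGg : ∀ r ∈ Ioo (0 : ℝ) 1, G (Real.cos (Real.pi * r)) = g r := by
      intro r hr
      simp only [hG]
      rw [Real.arccos_cos (by have := Real.pi_pos; have := hr.1; positivity)
        (by have := Real.pi_pos; nlinarith [hr.2]), mul_div_cancel_left₀ _ Real.pi_ne_zero]
    have key : ∀ ε > 0, |∫ r, f r * g r ∂unitVol| ≤ ε * ∫ r, |f r| ∂unitVol := by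
      intro ε hε
      obtain ⟨P, hP⟩ := exists_polynomial_near_of_continuousOn (-1) 1 G hGc.continuousOn ε hε
      have e1 : ∫ r, f r * g r ∂unitVol =
          ∫ r, f r * (g r - P.eval (Real.cos (Real.pi * r))) ∂unitVol := by
        simp_rw [mul_sub]
        rw [integral_sub (hint hg.continuousOn), hpoly, sub_zero]
        exact hint (P.continuous.comp (by fun_prop)).continuousOn
      rw [e1, ← integral_const_mul]
      refine (abs_integral_le_integral_abs).trans ?_
      refine integral_mono_ae (hint ?_).abs (hf.abs.const_mul _) ?_
      · exact (hg.sub (P.continuous.comp (by fun_prop))).continuousOn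
      · filter_upwards [ae_restrict_mem measurableSet_Ioo] with r hr
        rw [abs_mul, mul_comm]
        refine mul_le_mul_of_nonneg_right ?_ (abs_nonneg _)
        rw [← hGg r hr, abs_sub_comm]
        exact (hP _ ⟨Real.neg_one_le_cos _, Real.cos_le_one _⟩).le
    have h0 : |∫ r, f r * g r ∂unitVol| ≤ 0 := by
      have hlim : Tendsto (fun ε : ℝ => ε * ∫ r, |f r| ∂unitVol) (𝓝[>] 0)
          (𝓝 (0 * ∫ r, |f r| ∂unitVol)) :=
        ((tendsto_id.mul_const _).mono_left nhdsWithin_le_nhds)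
      rw [zero_mul] at hlim
      exact ge_of_tendsto hlim (eventually_mem_nhdsWithin.mono fun ε hε => key ε hε)
    exact abs_nonpos_iff.mp h0
  refine ae_eq_zero_of_integral_contDiff_smul_eq_zero hf.locallyIntegrable fun g hg _ => ?_
  simpa [smul_eq_mul, mul_comm] using hcont g hg.continuous

lemma integrable_coeFn_X (x : X) : Integrable x unitVol :=
  (Lp.memLp x).integrable one_le_two

/-- Completeness of the sine system. -/
lemma eq_zero_of_inner_eta {x : X} (h : ∀ k, inner ℝ x (eta k) = 0) : x = 0 := by
  have hs : ∀ j : ℤ, ∫ r, x r * Real.sin (Real.pi * j * r) ∂unitVol = 0 := by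
    have hpos : ∀ k : ℕ, ∫ r, x r * Real.sin (Real.pi * ((k + 1 : ℕ) : ℝ) * r) ∂unitVol = 0 := by
      intro k
      have := h k
      rw [inner_eta] at this
      simp only [etaFun, mul_left_comm _ √2] at this
      rw [integral_const_mul] at this
      have h2 : √(2 : ℝ) ≠ 0 := by positivity
      simpa [h2] using this
    intro j
    rcases lt_trichotomy j 0 with hj | hj | hj
    · obtain ⟨k, hk⟩ : ∃ k : ℕ, j = -((k + 1 : ℕ) : ℤ) := ⟨(-j - 1).toNat, by push_cast; omega⟩
      have := hpos k
      rw [hk]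
      simp only [Int.cast_neg, Int.cast_natCast, mul_neg, neg_mul, Real.sin_neg, integral_neg, this,
        neg_zero]
    · simp [hj]
    · obtain ⟨k, hk⟩ : ∃ k : ℕ, j = ((k + 1 : ℕ) : ℤ) := ⟨(j - 1).toNat, by push_cast; omega⟩
      have := hpos k
      rw [hk]
      simpa only [Int.cast_natCast] using this
  have hint : ∀ {g : ℝ → ℝ}, Continuous g → Integrable (fun r => x r * g r) unitVol := by
    intro g hg
    exact (Lp.memLp x).integrable_mul (memLp_of_continuous hg 2)
  -- The product x(r) sin(πr) is orthogonal to every cosine by the product formula, so completeness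
  -- of the cosines applies to it. The factor sin(πr) is positive on (0,1) and can be cancelled.
  have h0 : (fun r => x r * Real.sin (Real.pi * r)) =ᵐ[unitVol] 0 := by
    refine ae_eq_zero_of_integral_cos (hint (by fun_prop)) fun j => ?_
    have e : ∀ r : ℝ, x r * Real.sin (Real.pi * r) * Real.cos (Real.pi * j * r) =
        (x r * Real.sin (Real.pi * ((j + 1 : ℤ) : ℝ) * r) -
          x r * Real.sin (Real.pi * ((j - 1 : ℤ) : ℝ) * r)) / 2 := by
      intro r
      push_cast
      rw [show Real.pi * ((j : ℝ) + 1) * r = Real.pi * j * r + Real.pi * r by ring,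
        show Real.pi * ((j : ℝ) - 1) * r = Real.pi * j * r - Real.pi * r by ring,
        Real.sin_sub, Real.sin_add]
      ring
    simp_rw [e]
    rw [integral_div, integral_sub, hs, hs]
    · simp
    all_goals exact hint (by fun_prop)
  rw [Lp.eq_zero_iff_ae_eq_zero]
  filter_upwards [h0, ae_restrict_mem measurableSet_Ioo] with r hr hr'
  have : Real.sin (Real.pi * r) ≠ 0 := by
    refine (Real.sin_pos_of_pos_of_lt_pi ?_ ?_).ne'
    · exact mul_pos Real.pi_pos hr'.1
    · nlinarith [Real.pi_pos, hr'.2]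
  simpa [this] using hr

/-- Completeness of the cosine system. -/
lemma eq_zero_of_inner_cosVec {x : X} (h : ∀ k, inner ℝ x (cosVec k) = 0) : x = 0 := by
  have hc : ∀ k : ℕ, ∫ r, x r * Real.cos (Real.pi * k * r) ∂unitVol = 0 := by
    intro k
    have := h k
    rw [cosVec, inner_toLp_right] at this
    simp only [cosFun, mul_left_comm _ (ite _ _ _)] at this
    rw [integral_const_mul] at this
    have h2 : (if k = 0 then (1 : ℝ) else √2) ≠ 0 := by split_ifs <;> positivity
    exact (mul_eq_zero.mp this).resolve_left h2
  rw [Lp.eq_zero_iff_ae_eq_zero]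
  refine ae_eq_zero_of_integral_cos (integrable_coeFn_X x) fun j => ?_
  obtain ⟨k, rfl | rfl⟩ := j.eq_nat_or_neg
  · exact_mod_cast hc k
  · have := hc k
    simpa only [Int.cast_neg, Int.cast_natCast, mul_neg, neg_mul, Real.cos_neg] using this

/-- The Hilbert basis `η_1, η_2, …` of `X`. -/
noncomputable def etaBasis : HilbertBasis ℕ ℝ X :=
  HilbertBasis.mkOfOrthogonalEqBot orthonormal_eta (by
    rw [Submodule.eq_bot_iff]
    intro x hx
    refine eq_zero_of_inner_eta fun k => ?_
    rw [real_inner_comm]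
    exact hx _ (Submodule.subset_span ⟨k, rfl⟩))

/-- The Hilbert basis of cosines. -/
noncomputable def cosBasis : HilbertBasis ℕ ℝ X :=
  HilbertBasis.mkOfOrthogonalEqBot orthonormal_cosVec (by
    rw [Submodule.eq_bot_iff]
    intro x hx
    refine eq_zero_of_inner_cosVec fun k => ?_
    rw [real_inner_comm]
    exact hx _ (Submodule.subset_span ⟨k, rfl⟩))

lemma etaBasis_apply (k : ℕ) : etaBasis k = eta k := by
  simp [etaBasis]

lemma cosBasis_apply (k : ℕ) : cosBasis k = cosVec k := by
  simp [cosBasis]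

lemma hasSum_inner_eta_sq (x : X) : HasSum (fun k => inner ℝ x (eta k) ^ 2) (‖x‖ ^ 2) := by
  have := etaBasis.hasSum_inner_mul_inner x x
  rw [real_inner_self_eq_norm_sq] at this
  have e : (fun k => inner ℝ x (eta k) ^ 2) =
      fun k => inner ℝ x (etaBasis k) * inner ℝ (etaBasis k) x := by
    funext k
    rw [etaBasis_apply, real_inner_comm x (eta k), sq]
  rw [e]
  exact this

lemma hasSum_cosVec (x : X) : HasSum (fun k => inner ℝ x (cosVec k) • cosVec k) x := by
  have := cosBasis.hasSum_repr x
  simp only [cosBasis.repr_apply_apply, cosBasis_apply] at this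
  simpa only [real_inner_comm] using this

lemma norm_eta (k : ℕ) : ‖eta k‖ = 1 := orthonormal_eta.1 k

/-! ### Weak derivatives -/

lemma exists_deriv_smoothTransition_bound :
    ∃ M : ℝ, 0 ≤ M ∧ ∀ s, |deriv Real.smoothTransition s| ≤ M := by
  have hc : Continuous (deriv Real.smoothTransition) :=
    (Real.smoothTransition.contDiff (n := 1)).continuous_deriv le_rfl
  obtain ⟨M, hM⟩ := (isCompact_Icc (a := (0 : ℝ)) (b := 1)).exists_bound_of_continuousOn
    hc.continuousOn
  refine ⟨M, (norm_nonneg _).trans (hM 0 (by simp)), fun s => ?_⟩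
  by_cases hs : s ∈ Icc (0 : ℝ) 1
  · exact hM s hs
  · have hM0 := (norm_nonneg _).trans (hM 0 (by simp))
    rw [mem_Icc, not_and_or, not_le, not_le] at hs
    have : deriv Real.smoothTransition s = 0 := by
      rcases hs with hs | hs
      · have : Real.smoothTransition =ᶠ[𝓝 s] fun _ => 0 := by
          filter_upwards [Iio_mem_nhds hs] with t ht
          exact Real.smoothTransition.zero_of_nonpos (le_of_lt ht)
        rw [this.deriv_eq, deriv_const]
      · have : Real.smoothTransition =ᶠ[𝓝 s] fun _ => 1 := by
          filter_upwards [Ioi_mem_nhds hs] with t ht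
          exact Real.smoothTransition.one_of_one_le (le_of_lt ht)
        rw [this.deriv_eq, deriv_const]
    rw [this, abs_zero]
    exact hM0

/-- A smooth cutoff function on `(0,1)`, equal to one away from a layer of width `2/(n+1)`. -/
noncomputable def cutoff (n : ℕ) (r : ℝ) : ℝ :=
  Real.smoothTransition ((n + 1) * r - 1) * Real.smoothTransition ((n + 1) * (1 - r) - 1)

lemma contDiff_cutoff (n : ℕ) : ContDiff ℝ ∞ (cutoff n) := by
  unfold cutoff
  exact (Real.smoothTransition.contDiff.comp (by fun_prop)).mul
    (Real.smoothTransition.contDiff.comp (by fun_prop))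

lemma cutoff_nonneg (n : ℕ) (r : ℝ) : 0 ≤ cutoff n r :=
  mul_nonneg (Real.smoothTransition.nonneg _) (Real.smoothTransition.nonneg _)

lemma cutoff_le_one (n : ℕ) (r : ℝ) : cutoff n r ≤ 1 :=
  mul_le_one₀ (Real.smoothTransition.le_one _) (Real.smoothTransition.nonneg _)
    (Real.smoothTransition.le_one _)

lemma cutoff_eq_one {n : ℕ} {r : ℝ} (h1 : 2 ≤ (n + 1) * r) (h2 : 2 ≤ (n + 1) * (1 - r)) :
    cutoff n r = 1 := by
  rw [cutoff, Real.smoothTransition.one_of_one_le (by linarith),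
    Real.smoothTransition.one_of_one_le (by linarith), one_mul]

lemma support_cutoff_subset (n : ℕ) :
    tsupport (cutoff n) ⊆ Icc (1 / ((n : ℝ) + 1)) (1 - 1 / ((n : ℝ) + 1)) := by
  refine closure_minimal (fun r hr => ?_) isClosed_Icc
  have hn : (0 : ℝ) < n + 1 := by positivity
  have hr' : cutoff n r ≠ 0 := hr
  rw [cutoff, mul_ne_zero_iff, Ne, Ne, Real.smoothTransition.zero_iff_nonpos,
    Real.smoothTransition.zero_iff_nonpos, not_le, not_le] at hr'
  constructor
  · rw [div_le_iff₀ hn]; linarith [hr'.1]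
  · rw [le_sub_comm, div_le_iff₀ hn]; linarith [hr'.2]

lemma tsupport_cutoff_subset (n : ℕ) : tsupport (cutoff n) ⊆ Ioo 0 1 := by
  refine (support_cutoff_subset n).trans fun r hr => ?_
  have hn : (0 : ℝ) < 1 / (n + 1) := by positivity
  exact ⟨hn.trans_le hr.1, by linarith [hr.2]⟩

lemma hasCompactSupport_cutoff (n : ℕ) : HasCompactSupport (cutoff n) :=
  isCompact_Icc.of_isClosed_subset (isClosed_tsupport _) (support_cutoff_subset n)

/-- The linear growth in n matches the width of order 1/n of the layer carrying the derivative, so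
the L¹ norm of the derivative stays bounded. -/
lemma abs_deriv_cutoff_le {M : ℝ} (hM : ∀ s, |deriv Real.smoothTransition s| ≤ M) (n : ℕ) (r : ℝ) :
    |deriv (cutoff n) r| ≤ 2 * M * (n + 1) := by
  have hS : ∀ s, HasDerivAt Real.smoothTransition (deriv Real.smoothTransition s) s := fun s =>
    ((Real.smoothTransition.contDiff (n := 1)).differentiable one_ne_zero s).hasDerivAt
  have h1 : HasDerivAt (fun r : ℝ => Real.smoothTransition ((n + 1) * r - 1))
      (deriv Real.smoothTransition ((n + 1) * r - 1) * ((n + 1) * 1)) r :=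
    (hS _).comp r (((hasDerivAt_id r).const_mul _).sub_const _)
  have h2 : HasDerivAt (fun r : ℝ => Real.smoothTransition ((n + 1) * (1 - r) - 1))
      (deriv Real.smoothTransition ((n + 1) * (1 - r) - 1) * ((n + 1) * (-1))) r :=
    (hS _).comp r ((((hasDerivAt_id r).const_sub 1).const_mul _).sub_const _)
  have h := (h1.mul h2).deriv
  have e : deriv (cutoff n) r = _ := h
  rw [e]
  have hn : (0 : ℝ) ≤ n + 1 := by positivity
  have b : ∀ s t a : ℝ, |a| = n + 1 →
      |deriv Real.smoothTransition s * a * Real.smoothTransition t| ≤ M * (n + 1) := by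
    intro s t a ha
    rw [abs_mul, abs_mul, ha, abs_of_nonneg (Real.smoothTransition.nonneg t)]
    have := Real.smoothTransition.le_one t
    have h0 : 0 ≤ |deriv Real.smoothTransition s| * (n + 1) := by positivity
    calc _ ≤ |deriv Real.smoothTransition s| * (n + 1) := mul_le_of_le_one_right h0 this
      _ ≤ _ := by gcongr; exact hM s
  refine (abs_add_le _ _).trans ?_
  rw [mul_comm (Real.smoothTransition _)]
  have := b ((n + 1) * r - 1) ((n + 1) * (1 - r) - 1) ((n + 1) * 1)
    (by rw [mul_one, abs_of_nonneg hn])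
  have := b ((n + 1) * (1 - r) - 1) ((n + 1) * r - 1) ((n + 1) * (-1))
    (by rw [mul_neg_one, abs_neg, abs_of_nonneg hn])
  linarith

lemma deriv_cutoff_eq_zero {n : ℕ} {r : ℝ} (h1 : 2 < (n + 1) * r) (h2 : 2 < (n + 1) * (1 - r)) :
    deriv (cutoff n) r = 0 := by
  have h : cutoff n =ᶠ[𝓝 r] fun _ => 1 := by
    have e1 : ∀ᶠ t : ℝ in 𝓝 r, 2 < (n + 1) * t :=
      (continuous_const.mul continuous_id).continuousAt.eventually_const_lt h1
    have e2 : ∀ᶠ t : ℝ in 𝓝 r, 2 < (n + 1) * (1 - t) :=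
      (continuous_const.mul (continuous_const.sub continuous_id)).continuousAt.eventually_const_lt h2
    filter_upwards [e1, e2] with t ht1 ht2
    exact cutoff_eq_one ht1.le ht2.le
  rw [h.deriv_eq, deriv_const]

lemma tendsto_cutoff {r : ℝ} (hr : r ∈ Ioo (0 : ℝ) 1) :
    Tendsto (fun n => cutoff n r) atTop (𝓝 1) := by
  have h : ∀ s : ℝ, 0 < s → ∀ᶠ n : ℕ in atTop, 2 ≤ ((n : ℝ) + 1) * s := by
    intro s hs
    have : Tendsto (fun n : ℕ => ((n : ℝ) + 1) * s) atTop atTop :=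
      (tendsto_atTop_add_const_right _ _ tendsto_natCast_atTop_atTop).atTop_mul_const hs
    exact this.eventually_ge_atTop 2
  refine tendsto_const_nhds.congr' ?_
  filter_upwards [h r hr.1, h (1 - r) (by linarith [hr.2])] with n h1 h2
  rw [cutoff_eq_one h1 h2]

/-- Integration by parts for a continuous function that vanishes at the boundary, against smooth
functions that need not vanish there. -/
lemma HasWeakDeriv.integral_mul_deriv {x g c w : ℝ → ℝ} (h : HasWeakDeriv x g)
    (hg : Integrable g unitVol) (hc : ContinuousOn c (Icc 0 1)) (hc0 : c 0 = 0) (hc1 : c 1 = 0)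
    (hxc : x =ᵐ[unitVol] c) (hw : ContDiff ℝ ∞ w) :
    ∫ r, x r * deriv w r ∂unitVol = -∫ r, g r * w r ∂unitVol := by
  have hwc : Continuous w := hw.continuous
  have hw'c : Continuous (deriv w) := hw.continuous_deriv (by simp)
  obtain ⟨M, hM0, hM⟩ := exists_deriv_smoothTransition_bound
  obtain ⟨B, hB⟩ := (isCompact_Icc (a := (0 : ℝ)) (b := 1)).exists_bound_of_continuousOn
    hwc.continuousOn
  have hB0 : 0 ≤ B := (norm_nonneg _).trans (hB 0 (by simp))
  have hχc : ∀ n, Continuous (cutoff n) := fun n => (contDiff_cutoff n).continuous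
  have hχ'c : ∀ n, Continuous (deriv (cutoff n)) := fun n =>
    (contDiff_cutoff n).continuous_deriv (by simp)
  have hxint : Integrable x unitVol := (integrable_unitVol_of_continuousOn hc).congr hxc.symm
  -- the identity for the cut-off functions
  have hid : ∀ n, ∫ r, x r * deriv w r * cutoff n r ∂unitVol +
      ∫ r, c r * w r * deriv (cutoff n) r ∂unitVol = -∫ r, g r * w r * cutoff n r ∂unitVol := by
    intro n
    have h1 := h.2.2 (fun r => w r * cutoff n r) (hw.mul (contDiff_cutoff n))
      ((hasCompactSupport_cutoff n).mul_left)
      ((closure_mono (Function.support_mul_subset_right _ _)).trans (tsupport_cutoff_subset n))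
    have hd : ∀ r, deriv (fun r => w r * cutoff n r) r =
        deriv w r * cutoff n r + w r * deriv (cutoff n) r := fun r =>
      deriv_fun_mul (hw.differentiable (by simp) r) ((contDiff_cutoff n).differentiable (by simp) r)
    simp only [hd] at h1
    have e2 : ∫ r, g r * (w r * cutoff n r) ∂unitVol = ∫ r, g r * w r * cutoff n r ∂unitVol := by
      simp only [mul_assoc]
    rw [e2] at h1
    rw [← h1, ← integral_add]
    · refine integral_congr_ae ?_
      filter_upwards [hxc] with r hr
      rw [← hr]
      ring
    · have : ContinuousOn (fun r => c r * deriv w r * cutoff n r) (Icc 0 1) :=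
        (hc.mul hw'c.continuousOn).mul (hχc n).continuousOn
      refine (integrable_unitVol_of_continuousOn this).congr ?_
      filter_upwards [hxc] with r hr
      rw [hr]
    · exact integrable_unitVol_of_continuousOn
        ((hc.mul hwc.continuousOn).mul (hχ'c n).continuousOn)
  have hlim1 : Tendsto (fun n => ∫ r, x r * deriv w r * cutoff n r ∂unitVol) atTop
      (𝓝 (∫ r, x r * deriv w r ∂unitVol)) := by
    have hint : Integrable (fun r => x r * deriv w r) unitVol := by
      refine (integrable_unitVol_of_continuousOn (hc.mul hw'c.continuousOn)).congr ?_
      filter_upwards [hxc] with r hr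
      rw [hr, Pi.mul_apply]
    refine tendsto_integral_of_dominated_convergence (fun r => |x r * deriv w r|)
      (fun n => hint.aestronglyMeasurable.mul (hχc n).aestronglyMeasurable) hint.abs
      (fun n => Eventually.of_forall fun r => ?_) ?_
    · rw [Real.norm_eq_abs, abs_mul, abs_of_nonneg (cutoff_nonneg n r)]
      exact mul_le_of_le_one_right (abs_nonneg _) (cutoff_le_one n r)
    · filter_upwards [ae_restrict_mem measurableSet_Ioo] with r hr
      simpa using (tendsto_cutoff hr).const_mul (x r * deriv w r)
  have hlim2 : Tendsto (fun n => ∫ r, g r * w r * cutoff n r ∂unitVol) atTop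
      (𝓝 (∫ r, g r * w r ∂unitVol)) := by
    have hint : Integrable (fun r => g r * w r) unitVol := by
      refine hg.mul_bdd (c := B) hwc.aestronglyMeasurable ?_
      filter_upwards [ae_restrict_mem measurableSet_Ioo] with r hr
      exact hB r (Ioo_subset_Icc_self hr)
    refine tendsto_integral_of_dominated_convergence (fun r => |g r * w r|)
      (fun n => hint.aestronglyMeasurable.mul (hχc n).aestronglyMeasurable) hint.abs
      (fun n => Eventually.of_forall fun r => ?_) ?_
    · rw [Real.norm_eq_abs, abs_mul, abs_of_nonneg (cutoff_nonneg n r)]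
      exact mul_le_of_le_one_right (abs_nonneg _) (cutoff_le_one n r)
    · filter_upwards [ae_restrict_mem measurableSet_Ioo] with r hr
      simpa using (tendsto_cutoff hr).const_mul (g r * w r)
  -- The boundary term vanishes because the derivative of the cutoff is bounded in L¹ and
  -- concentrates at the endpoints, where `c` is zero.
  have hlim3 : Tendsto (fun n => ∫ r, c r * w r * deriv (cutoff n) r ∂unitVol) atTop (𝓝 0) := by
    rw [Metric.tendsto_atTop]
    intro ε hε
    -- The derivative is at most 2M(n+1) on a set of measure at most 4/(n+1), and `w` is at most
    -- `B`; this gives 8MB, and the 1 keeps the denominator positive.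
    set ε' : ℝ := ε / (8 * M * B + 1) with hε'
    have hε'0 : 0 < ε' := by positivity
    have hcz : ∀ᶠ r in 𝓝[Icc 0 1] (0 : ℝ), |c r| < ε' := by
      have := (hc 0 (by simp)).abs
      rw [ContinuousWithinAt, hc0, abs_zero] at this
      exact this.eventually_lt_const hε'0
    have hco : ∀ᶠ r in 𝓝[Icc 0 1] (1 : ℝ), |c r| < ε' := by
      have := (hc 1 (by simp)).abs
      rw [ContinuousWithinAt, hc1, abs_zero] at this
      exact this.eventually_lt_const hε'0
    rw [eventually_nhdsWithin_iff, Metric.eventually_nhds_iff] at hcz hco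
    obtain ⟨δ₁, hδ₁, h₁⟩ := hcz
    obtain ⟨δ₂, hδ₂, h₂⟩ := hco
    obtain ⟨N, hN⟩ := exists_nat_gt (2 / min δ₁ δ₂)
    refine ⟨N, fun n hn => ?_⟩
    have hδ : 0 < min δ₁ δ₂ := lt_min hδ₁ hδ₂
    have hn1 : (0 : ℝ) < n + 1 := by positivity
    set a : ℝ := 2 / (n + 1) with ha
    have ha0 : 0 < a := by positivity
    have haδ : a < min δ₁ δ₂ := by
      rw [ha, div_lt_iff₀ hn1]
      rw [div_lt_iff₀ hδ] at hN
      have : (N : ℝ) ≤ n := by exact_mod_cast hn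
      nlinarith
    set T : Set ℝ := Ioo 0 1 ∩ (Ioc 0 a ∪ Ico (1 - a) 1) with hT
    have hTm : MeasurableSet T :=
      measurableSet_Ioo.inter (measurableSet_Ioc.union measurableSet_Ico)
    have hvol : volume.real T ≤ 2 * a := by
      have h3 : volume.real T ≤ volume.real (Ioc 0 a ∪ Ico (1 - a) 1) :=
        measureReal_mono inter_subset_right (by
          refine ((measure_union_le _ _).trans_lt ?_).ne
          simp [Real.volume_Ioc, Real.volume_Ico])
      refine h3.trans ((measureReal_union_le _ _).trans ?_)
      rw [Real.volume_real_Ioc_of_le ha0.le, Real.volume_real_Ico_of_le (by linarith)]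
      linarith
    have hbd : ∀ r ∈ T, ‖c r * w r * deriv (cutoff n) r‖ ≤ ε' * B * (2 * M * (n + 1)) := by
      intro r hr
      have hrI : r ∈ Icc (0 : ℝ) 1 := Ioo_subset_Icc_self hr.1
      have hcr : |c r| ≤ ε' := by
        rcases hr.2 with h | h
        · refine (h₁ ?_ hrI).le
          rw [Real.dist_eq, sub_zero, abs_of_pos h.1]
          exact h.2.trans_lt (haδ.trans_le (min_le_left _ _))
        · refine (h₂ ?_ hrI).le
          rw [Real.dist_eq, abs_sub_comm, abs_of_pos (by linarith [h.2])]
          have := haδ.trans_le (min_le_right _ _)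
          linarith [h.1]
      rw [norm_mul, norm_mul, Real.norm_eq_abs (c r), Real.norm_eq_abs (deriv _ _)]
      have := hB r hrI
      have := abs_deriv_cutoff_le hM n r
      gcongr
    have hTint : ∫ r, c r * w r * deriv (cutoff n) r ∂unitVol =
        ∫ r in T, c r * w r * deriv (cutoff n) r := by
      refine (setIntegral_eq_of_subset_of_forall_sdiff_eq_zero measurableSet_Ioo
        inter_subset_left fun r hr => ?_)
      have hr1 : a < r := by
        by_contra hcon
        exact hr.2 ⟨hr.1, Or.inl ⟨hr.1.1, not_lt.mp hcon⟩⟩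
      have hr2 : r < 1 - a := by
        by_contra hcon
        exact hr.2 ⟨hr.1, Or.inr ⟨not_lt.mp hcon, hr.1.2⟩⟩
      rw [deriv_cutoff_eq_zero, mul_zero]
      · rw [ha, div_lt_iff₀ hn1] at hr1; linarith
      · have : a < 1 - r := by linarith
        rw [ha, div_lt_iff₀ hn1] at this; linarith
    rw [dist_zero_right, hTint]
    have hfin : volume T < ⊤ := (measure_mono inter_subset_left).trans_lt
      (by simp [Real.volume_Ioo])
    refine (norm_setIntegral_le_of_norm_le_const hfin hbd).trans_lt ?_
    have h5 : ε' * B * (2 * M * (n + 1)) * volume.real T ≤ ε' * B * (2 * M * (n + 1)) * (2 * a) := by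
      gcongr
    refine h5.trans_lt ?_
    have h6 : ε' * B * (2 * M * (n + 1)) * (2 * a) = ε' * (8 * M * B) := by
      rw [ha]; field_simp; ring
    rw [h6]
    have h7 : ε' * (8 * M * B + 1) = ε := by rw [hε']; field_simp
    linarith
  have hsum := hlim1.add hlim3
  rw [add_zero] at hsum
  exact tendsto_nhds_unique (hsum.congr hid) hlim2.neg

/-! ### Uniqueness of the weak derivative and its cosine coefficients. -/

lemma HasWeakDeriv.aestronglyMeasurable {f g : ℝ → ℝ} (h : HasWeakDeriv f g) :
    AEStronglyMeasurable g unitVol :=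
  h.2.1.aestronglyMeasurable

/-- The weak derivative is unique. -/
lemma HasWeakDeriv.unique {f g₁ g₂ : ℝ → ℝ} (h₁ : HasWeakDeriv f g₁) (h₂ : HasWeakDeriv f g₂) :
    g₁ =ᵐ[unitVol] g₂ := by
  have hloc : LocallyIntegrableOn (fun r => g₁ r - g₂ r) (Ioo 0 1) := h₁.2.1.sub h₂.2.1
  have := isOpen_Ioo.ae_eq_zero_of_integral_contDiff_smul_eq_zero (μ := volume) hloc (by
    intro φ hφ hφc hφs
    have hi : ∀ {g : ℝ → ℝ}, LocallyIntegrableOn g (Ioo 0 1) →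
        Integrable (fun r => g r * φ r) := by
      intro g hg
      have h1 : IntegrableOn g (tsupport φ) := hg.integrableOn_compact_subset hφs hφc
      obtain ⟨C, hC⟩ := hφ.continuous.bounded_above_of_compact_support hφc
      have h2 : IntegrableOn (fun r => g r * φ r) (tsupport φ) :=
        h1.mul_bdd (c := C) hφ.continuous.aestronglyMeasurable (Eventually.of_forall hC)
      refine (integrableOn_iff_integrable_of_support_subset fun r hr => ?_).mp h2
      exact subset_tsupport _ (right_ne_zero_of_mul hr)
    have e1 := h₁.2.2 φ hφ hφc hφs
    have e2 := h₂.2.2 φ hφ hφc hφs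
    have hset : ∀ g : ℝ → ℝ, ∫ r in Ioo (0 : ℝ) 1, g r * φ r = ∫ r, g r * φ r := by
      intro g
      refine setIntegral_eq_integral_of_forall_compl_eq_zero fun r hr => ?_
      rw [image_eq_zero_of_notMem_tsupport (fun h => hr (hφs h)), mul_zero]
    rw [hset] at e1 e2
    simp only [smul_eq_mul, mul_comm (φ _), sub_mul]
    rw [integral_sub (hi h₁.2.1) (hi h₂.2.1)]
    linarith)
  rw [Filter.EventuallyEq, ae_restrict_iff' measurableSet_Ioo]
  filter_upwards [this] with r hr hr'
  have := hr hr'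
  linarith

lemma derivNorm_eq {f g : ℝ → ℝ} (h : HasWeakDeriv f g) : derivNorm f = eLpNorm g 2 unitVol := by
  refine le_antisymm (iInf₂_le g h) (le_iInf₂ fun g' hg' => ?_)
  rw [eLpNorm_congr_ae (h.unique hg')]

/-- Integration by parts against a cosine, whose derivative is a multiple of the sine. The cosine
does not vanish at the endpoints, so the boundary values of `x` are what makes this work. -/
lemma inner_eta_mul_eq {x : X} (hx : x ∈ H01) {g : ℝ → ℝ} (hg : HasWeakDeriv x g)
    (hg2 : MemLp g 2 unitVol) (k : ℕ) :
    Real.pi * (k + 1) * inner ℝ x (eta k) = inner ℝ (hg2.toLp g) (cosVec (k + 1)) := by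
  obtain ⟨c, hc, hc0, hc1, hxc⟩ := hx.2
  have hw : ContDiff ℝ ∞ (cosFun (k + 1)) := by unfold cosFun; fun_prop
  have key := hg.integral_mul_deriv (hg2.integrable one_le_two) hc hc0 hc1 hxc hw
  have hd : ∀ r, deriv (cosFun (k + 1)) r = -(Real.pi * (k + 1)) * etaFun k r := by
    intro r
    have h := (((hasDerivAt_id r).const_mul (Real.pi * ((k + 1 : ℕ) : ℝ))).cos.const_mul
      (if k + 1 = 0 then (1 : ℝ) else √2))
    refine (h.deriv).trans ?_
    simp only [etaFun, id, Nat.cast_add, Nat.cast_one, Nat.add_eq_zero_iff, one_ne_zero, and_false,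
      if_false]
    ring
  rw [cosVec, inner_toLp_toLp, inner_eta]
  simp only [hd, mul_left_comm _ (-(Real.pi * ((k : ℝ) + 1)))] at key
  rw [integral_const_mul] at key
  linarith

/-- Bessel's inequality for the derivative. -/
lemma sum_sq_le_derivNorm_sq {x : X} (hx : x ∈ H01) (s : Finset ℕ) :
    ENNReal.ofReal (∑ k ∈ s, (Real.pi * (k + 1) * inner ℝ x (eta k)) ^ 2) ≤ derivNorm x ^ 2 := by
  -- Writing the sum as the square of its root lets the comparison be made between norms, below the
  -- infimum in `derivNorm`.
  have hS : 0 ≤ ∑ k ∈ s, (Real.pi * (k + 1) * inner ℝ x (eta k)) ^ 2 :=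
    Finset.sum_nonneg fun _ _ => sq_nonneg _
  rw [← Real.sq_sqrt hS, ENNReal.ofReal_pow (Real.sqrt_nonneg _)]
  gcongr
  refine le_iInf₂ fun g hg => ?_
  by_cases hfin : eLpNorm g 2 unitVol = ⊤
  · rw [hfin]; exact le_top
  have hg2 : MemLp g 2 unitVol := ⟨hg.aestronglyMeasurable, lt_top_iff_ne_top.mpr hfin⟩
  have hnorm : ENNReal.ofReal ‖hg2.toLp g‖ = eLpNorm g 2 unitVol := by
    rw [Lp.norm_toLp, ENNReal.ofReal_toReal hfin]
  rw [← hnorm]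
  refine ENNReal.ofReal_le_ofReal (Real.sqrt_le_iff.mpr ⟨norm_nonneg _, ?_⟩)
  have hb := (orthonormal_cosVec.comp (fun k : ℕ => k + 1)
    (add_left_injective 1)).sum_inner_products_le (x := hg2.toLp g) (s := s)
  refine le_trans (le_of_eq (Finset.sum_congr rfl fun k _ => ?_)) hb
  rw [inner_eta_mul_eq hx hg hg2, Function.comp, Real.norm_eq_abs, sq_abs, real_inner_comm]

/-! ### Weak continuity of the norm on bounded subsets of `H₀¹` -/

lemma continuous_weakTop_inner {D : Set X} (h : X) :
    @Continuous D ℝ (weakTop D) inferInstance fun x => inner ℝ (x : X) h := by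
  let _ := weakTop D
  have h1 : Continuous fun x : D => toWeakSpace ℝ X (x : X) := continuous_induced_dom
  have h2 : Continuous fun z : WeakSpace ℝ X => (innerSL ℝ h) ((toWeakSpace ℝ X).symm z) :=
    WeakBilin.eval_continuous _ (innerSL ℝ h)
  have h3 := h2.comp h1
  refine h3.congr fun x => ?_
  simp [real_inner_comm]

/-- The tail of Parseval's identity: for k ≥ n the factor (π(k+1))² in the energy is at least n + 1.
The rate depends on `x` only through `R`. -/
lemma norm_sq_sub_sum_le {x : X} (hx : x ∈ H01) {R : ℝ≥0} (hR : derivNorm x ^ 2 ≤ R) (n : ℕ) :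
    |‖x‖ ^ 2 - ∑ k ∈ Finset.range n, inner ℝ x (eta k) ^ 2| ≤ R / ((n : ℝ) + 1) := by
  have hs := hasSum_inner_eta_sq x
  have hn : (0 : ℝ) < n + 1 := by positivity
  have hle : ∑ k ∈ Finset.range n, inner ℝ x (eta k) ^ 2 ≤ ‖x‖ ^ 2 :=
    sum_le_hasSum _ (fun _ _ => sq_nonneg _) hs
  rw [abs_of_nonneg (sub_nonneg.mpr hle)]
  have ht := hs.tendsto_sum_nat
  refine le_of_tendsto (ht.sub_const _) ?_
  filter_upwards [eventually_ge_atTop n] with m hm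
  rw [← Finset.sum_Ico_eq_sub _ hm]
  have hb := sum_sq_le_derivNorm_sq hx (Finset.Ico n m)
  have hb' : ∑ k ∈ Finset.Ico n m, (Real.pi * (k + 1) * inner ℝ x (eta k)) ^ 2 ≤ (R : ℝ) := by
    have := hb.trans hR
    rw [← ENNReal.ofReal_coe_nnreal] at this
    exact (ENNReal.ofReal_le_ofReal_iff R.2).mp this
  rw [le_div_iff₀ hn]
  refine le_trans ?_ hb'
  rw [Finset.sum_mul]
  refine Finset.sum_le_sum fun k hk => ?_
  have hkn : (n : ℝ) ≤ k := by exact_mod_cast (Finset.mem_Ico.mp hk).1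
  have hn0 : (0 : ℝ) ≤ n := by positivity
  have h1 : (n : ℝ) + 1 ≤ (Real.pi * (k + 1)) ^ 2 := by
    have : (n : ℝ) + 1 ≤ Real.pi * (k + 1) := by nlinarith [Real.pi_gt_three]
    nlinarith
  rw [mul_pow, mul_comm]
  exact mul_le_mul_of_nonneg_right h1 (sq_nonneg _)

/-- A uniform limit of the Parseval partial sums, which are weakly continuous. It is the compactness
of the embedding of H₀¹ in L², in the form needed to divide V_{κ₁} out of the drift. -/
lemma continuousOn_weakTop_norm_sq (R : ℝ≥0) :
    @ContinuousOn H01 ℝ (weakTop H01) inferInstance (fun x => ‖(x : X)‖ ^ 2)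
      {x : H01 | derivNorm (x : X) ^ 2 ≤ R} := by
  let _ := weakTop H01
  have hu : TendstoUniformlyOn
      (fun (n : ℕ) (x : H01) => ∑ k ∈ Finset.range n, inner ℝ (x : X) (eta k) ^ 2)
      (fun x => ‖(x : X)‖ ^ 2) atTop {x : H01 | derivNorm (x : X) ^ 2 ≤ R} := by
    rw [Metric.tendstoUniformlyOn_iff]
    intro ε hε
    have hlim : Tendsto (fun n : ℕ => (R : ℝ) / ((n : ℝ) + 1)) atTop (𝓝 0) :=
      tendsto_const_nhds.div_atTop
        (tendsto_atTop_add_const_right _ _ tendsto_natCast_atTop_atTop)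
    filter_upwards [hlim.eventually_lt_const hε] with n hn x hx
    rw [Real.dist_eq]
    exact (norm_sq_sub_sum_le x.2 hx n).trans_lt hn
  refine hu.continuousOn (Eventually.of_forall fun n => Continuous.continuousOn ?_).frequently
  exact continuous_finsetSum _ fun k _ => (continuous_weakTop_inner (eta k)).pow 2

/-! ### Cylinder functions -/

/-- The projection `P_N` as a continuous linear map. -/
noncomputable def projL (N : ℕ) : X →L[ℝ] E N :=
  ((PiLp.continuousLinearEquiv 2 ℝ fun _ : Fin N => ℝ).symm : (Fin N → ℝ) →L[ℝ] E N).comp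
    (ContinuousLinearMap.pi fun i : Fin N => innerSL ℝ (eta i))

lemma projL_apply (N : ℕ) (x : X) : projL N x = proj N x := by
  ext i
  simp [projL, proj, real_inner_comm]

lemma proj_apply (N : ℕ) (x : X) (i : Fin N) : proj N x i = inner ℝ x (eta i) := rfl

lemma proj_eta_of_lt {N k : ℕ} (hk : k < N) :
    proj N (eta k) = EuclideanSpace.single (⟨k, hk⟩ : Fin N) (1 : ℝ) := by
  ext i
  rw [proj_apply, orthonormal_iff_ite.mp orthonormal_eta]
  simp [Fin.ext_iff, eq_comm]

lemma proj_eta_of_le {N k : ℕ} (hk : N ≤ k) : proj N (eta k) = 0 := by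
  ext i
  rw [proj_apply, orthonormal_iff_ite.mp orthonormal_eta, if_neg (by have := i.2; omega)]
  simp

lemma inner_incl_eta (N : ℕ) (ξ : E N) (i : Fin N) : inner ℝ (incl N ξ) (eta i) = ξ i := by
  rw [incl, sum_inner]
  simp [real_inner_smul_left, orthonormal_iff_ite.mp orthonormal_eta, Fin.val_inj]

lemma norm_incl_sq (N : ℕ) (ξ : E N) : ‖incl N ξ‖ ^ 2 = ‖ξ‖ ^ 2 := by
  rw [← real_inner_self_eq_norm_sq]
  nth_rw 2 [incl]
  rw [inner_sum, EuclideanSpace.norm_sq_eq]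
  refine Finset.sum_congr rfl fun i _ => ?_
  rw [real_inner_smul_right, inner_incl_eta, Real.norm_eq_abs, sq_abs, sq]

section Cylinder

variable {N : ℕ} {g : E N → ℝ}

lemma fderiv_cylinder (hg : Differentiable ℝ g) (x h : X) :
    fderiv ℝ (g ∘ proj N) x h = fderiv ℝ g (proj N x) (proj N h) := by
  have h1 : HasFDerivAt (g ∘ projL N) ((fderiv ℝ g (projL N x)).comp (projL N)) x :=
    (hg _).hasFDerivAt.comp x (projL N).hasFDerivAt
  have e : g ∘ proj N = g ∘ projL N := by funext z; simp [projL_apply]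
  rw [e, h1.fderiv]
  simp [projL_apply]

lemma pd_cylinder (hg : Differentiable ℝ g) (h : X) :
    pd h (g ∘ proj N) = (fun ξ => fderiv ℝ g ξ (proj N h)) ∘ proj N := by
  funext x
  exact fderiv_cylinder hg x h

lemma contDiff_fderiv_apply (hg : ContDiff ℝ 2 g) (v : E N) :
    ContDiff ℝ 1 fun ξ => fderiv ℝ g ξ v :=
  (hg.fderiv_right (m := 1) (by norm_num)).clm_apply contDiff_const

lemma pd_pd_cylinder (hg : ContDiff ℝ 2 g) (h k x : X) :
    pd h (pd k (g ∘ proj N)) x =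
      fderiv ℝ (fun ξ => fderiv ℝ g ξ (proj N k)) (proj N x) (proj N h) := by
  rw [pd_cylinder (hg.differentiable (by norm_num)), pd,
    fderiv_cylinder ((contDiff_fderiv_apply hg _).differentiable (by norm_num))]

/-- The second order part of the generator on cylinder functions is a finite sum. -/
lemma traceTerm_cylinder (A : X →L[ℝ] X) (hg : ContDiff ℝ 2 g) {n : ℕ} (hn : N ≤ n) (x : X) :
    traceTerm A (g ∘ proj N) x = ∑ i : Fin n, ∑ j : Fin n, inner ℝ (eta i) (A (eta j)) *
      pd (eta i) (pd (eta j) (g ∘ proj N)) x := by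
  rw [traceTerm, tsum_eq_sum (s := Finset.range n ×ˢ Finset.range n), Finset.sum_product,
    Finset.sum_range]
  · exact Finset.sum_congr rfl fun i _ => by rw [Finset.sum_range]
  · rintro ⟨i, j⟩ hij
    rw [Finset.mem_product, Finset.mem_range, Finset.mem_range, not_and_or, not_lt, not_lt] at hij
    simp only [pd_pd_cylinder hg]
    rcases hij with h | h
    · rw [proj_eta_of_le (hn.trans h), map_zero, mul_zero]
    · rw [proj_eta_of_le (hn.trans h)]
      simp

lemma kolm_cylinder (A : X →L[ℝ] X) (F : H01 → X) (hg : ContDiff ℝ 2 g) (x : H01) :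
    kolm A F (g ∘ proj N) x = 1 / 2 * traceTerm A (g ∘ proj N) x +
      ∑ k ∈ Finset.range N, (lapCoeff x k + inner ℝ (F x) (eta k)) * pd (eta k) (g ∘ proj N) x := by
  rw [kolm, tsum_eq_sum (s := Finset.range N)]
  intro k hk
  rw [Finset.mem_range, not_lt] at hk
  rw [pd_cylinder (hg.differentiable (by norm_num)), Function.comp, proj_eta_of_le hk, map_zero,
    mul_zero]

lemma continuous_weakTop_cylinder {D : Set X} (hg : Continuous g) :
    @Continuous D ℝ (weakTop D) inferInstance fun x => g (proj N x) := by
  let _ := weakTop D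
  refine hg.comp ?_
  refine (PiLp.continuous_toLp 2 _).comp (continuous_pi fun i => ?_)
  exact continuous_weakTop_inner (eta i)

lemma continuous_weakTop_pd {D : Set X} (hg : ContDiff ℝ 2 g) (h : X) :
    @Continuous D ℝ (weakTop D) inferInstance fun x => pd h (g ∘ proj N) x := by
  rw [pd_cylinder (hg.differentiable (by norm_num))]
  exact continuous_weakTop_cylinder (contDiff_fderiv_apply hg _).continuous

lemma continuous_weakTop_traceTerm {D : Set X} (A : X →L[ℝ] X) (hg : ContDiff ℝ 2 g) :
    @Continuous D ℝ (weakTop D) inferInstance fun x => traceTerm A (g ∘ proj N) x := by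
  let _ := weakTop D
  simp only [traceTerm_cylinder A hg le_rfl, pd_pd_cylinder hg]
  refine continuous_finsetSum _ fun i _ => continuous_finsetSum _ fun j _ =>
    continuous_const.mul ?_
  exact continuous_weakTop_cylinder
    (((contDiff_fderiv_apply hg _).continuous_fderiv (by norm_num)).clm_apply continuous_const)

end Cylinder

/-! ### Weights -/

lemma one_le_expW {κ : ℝ} (hκ : 0 ≤ κ) (x : X) : 1 ≤ expW κ x :=
  Real.one_le_exp (by positivity)

lemma expW_pos (κ : ℝ) (x : X) : 0 < expW κ x := Real.exp_pos _

lemma ofReal_expW_le_V (p κ : ℝ) (x : X) : ENNReal.ofReal (expW κ x) ≤ V p κ x := by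
  rw [V]
  split_ifs
  · exact le_rfl
  · exact le_mul_of_one_le_right' le_self_add

lemma one_le_V {κ : ℝ} (hκ : 0 ≤ κ) (p : ℝ) (x : X) : 1 ≤ V p κ x := by
  refine le_trans ?_ (ofReal_expW_le_V p κ x)
  rw [ENNReal.one_le_ofReal]
  exact one_le_expW hκ x

lemma V_mul_le_Theta (p κ : ℝ) {x : X} (hx : x ∈ H01) :
    V p κ x * (1 + derivNorm x ^ 2) ≤ Θ p κ x := by
  rw [Θ, if_pos hx]
  exact le_self_add

lemma V_le_Theta (p κ : ℝ) {x : X} (hx : x ∈ H01) : V p κ x ≤ Θ p κ x :=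
  (le_mul_of_one_le_right' le_self_add).trans (V_mul_le_Theta p κ hx)

lemma derivNorm_sq_le_Theta {κ : ℝ} (hκ : 0 ≤ κ) (p : ℝ) {x : X} (hx : x ∈ H01) :
    derivNorm x ^ 2 ≤ Θ p κ x := by
  refine le_trans ?_ (V_mul_le_Theta p κ hx)
  calc derivNorm x ^ 2 ≤ 1 + derivNorm x ^ 2 := le_add_self
    _ ≤ _ := le_mul_of_one_le_left' (one_le_V hκ p x)

lemma mem_Xp_two (x : X) : x ∈ Xp 2 := by
  have h := lintegral_rpow_enorm_lt_top_of_eLpNorm_lt_top (p := 2) (by norm_num) (by norm_num)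
    (Lp.memLp x).2
  simpa [Xp, lpPow] using h

lemma V_two (κ : ℝ) (x : X) : V 2 κ x = ENNReal.ofReal (expW κ x) := by simp [V]

/-- For p = 2 the set `Xp 2` is all of `X`, so the bound carries no membership condition. -/
lemma exists_bound_of_wnorm_lt_top {κ : ℝ} {f : X → ℝ}
    (h : wnorm (V 2 κ) (fun x : Xp 2 => f x) < ⊤) : ∃ C : ℝ, 0 ≤ C ∧ ∀ x, |f x| ≤ C * expW κ x := by
  refine ⟨(wnorm (V 2 κ) (fun x : Xp 2 => f x)).toReal, ENNReal.toReal_nonneg, fun x => ?_⟩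
  have h1 : ‖f x‖ₑ / V 2 κ x ≤ wnorm (V 2 κ) (fun x : Xp 2 => f x) :=
    le_iSup (fun x : Xp 2 => ‖f x‖ₑ / V 2 κ x) ⟨x, mem_Xp_two x⟩
  rw [V_two, ENNReal.div_le_iff (by simp [expW_pos]) ENNReal.ofReal_ne_top] at h1
  have h2 := ENNReal.toReal_mono (ENNReal.mul_ne_top h.ne ENNReal.ofReal_ne_top) h1
  rw [ENNReal.toReal_mul, ENNReal.toReal_ofReal (expW_pos κ x).le, toReal_enorm,
    Real.norm_eq_abs] at h2
  exact h2

/-! ### Membership in weighted spaces -/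

section MemWC

variable {D : Set X} {W : X → ℝ≥0∞}

lemma MemWC.add {f g : D → ℝ} (hf : MemWC W f) (hg : MemWC W g) :
    MemWC W fun x => f x + g x := by
  refine ⟨fun R => ?_, ?_⟩
  · let _ := weakTop D
    exact (hf.1 R).add (hg.1 R)
  · have h := hf.2.add hg.2
    rw [add_zero] at h
    refine tendsto_of_tendsto_of_tendsto_of_le_of_le tendsto_const_nhds h (fun _ => zero_le)
      fun R => iSup₂_le fun x hx => ?_
    calc ‖f x + g x‖ₑ / W x ≤ (‖f x‖ₑ + ‖g x‖ₑ) / W x := by gcongr; exact enorm_add_le _ _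
      _ = ‖f x‖ₑ / W x + ‖g x‖ₑ / W x := ENNReal.add_div
      _ ≤ _ := add_le_add (le_iSup₂ (f := fun (x : D) (_ : (R : ℝ≥0∞) ≤ W x) => ‖f x‖ₑ / W x) x hx)
        (le_iSup₂ (f := fun (x : D) (_ : (R : ℝ≥0∞) ≤ W x) => ‖g x‖ₑ / W x) x hx)

/-- Meant for the drift: `f` will be V_{κ₁}F^{(k)} and `b` the bounded function V_{κ₁}⁻¹ ∂_k u up to
sign. Continuity of `b` is asked only on sublevel sets because V_{κ₁} is not weakly continuous on
the whole domain. -/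
lemma MemWC.mul_bounded {f b : D → ℝ} (hf : MemWC W f) {C : ℝ≥0}
    (hb : ∀ R : ℝ≥0, @ContinuousOn D ℝ (weakTop D) inferInstance b {x : D | W x ≤ R})
    (hC : ∀ x, ‖b x‖ₑ ≤ C) : MemWC W fun x => b x * f x := by
  refine ⟨fun R => ?_, ?_⟩
  · let _ := weakTop D
    exact (hb R).mul (hf.1 R)
  · have h := ENNReal.Tendsto.const_mul (a := (C : ℝ≥0∞)) hf.2 (Or.inr ENNReal.coe_ne_top)
    rw [mul_zero] at h
    refine tendsto_of_tendsto_of_tendsto_of_le_of_le tendsto_const_nhds h (fun _ => zero_le)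
      fun R => iSup₂_le fun x hx => ?_
    calc ‖b x * f x‖ₑ / W x = ‖b x‖ₑ * (‖f x‖ₑ / W x) := by rw [enorm_mul, mul_div_assoc]
      _ ≤ _ := mul_le_mul' (hC x)
        (le_iSup₂ (f := fun (x : D) (_ : (R : ℝ≥0∞) ≤ W x) => ‖f x‖ₑ / W x) x hx)

lemma memWC_zero : MemWC W fun _ : D => (0 : ℝ) := by
  refine ⟨fun R => ?_, ?_⟩
  · let _ := weakTop D
    exact continuousOn_const
  · simp

lemma MemWC.sum {ι : Type*} (s : Finset ι) {f : ι → D → ℝ} (hf : ∀ i ∈ s, MemWC W (f i)) :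
    MemWC W fun x => ∑ i ∈ s, f i x := by
  classical
  induction s using Finset.induction_on with
  | empty => simpa using memWC_zero
  | insert a s ha ih =>
    simp only [Finset.sum_insert ha]
    exact (hf a (by simp)).add (ih fun i hi => hf i (by simp [hi]))

/-- Functions of exponential growth of lower order belong to the weighted space. -/
lemma memWC_of_le_expW {κ κ' : ℝ} (hκ' : 0 ≤ κ') (hκ : κ' < κ)
    (hW : ∀ x ∈ D, ENNReal.ofReal (expW κ x) ≤ W x) {f : D → ℝ}
    (hf : ∀ R : ℝ≥0, @ContinuousOn D ℝ (weakTop D) inferInstance f {x : D | W x ≤ R})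
    {C : ℝ} (hC : 0 ≤ C) (hfC : ∀ x : D, |f x| ≤ C * expW κ' x) : MemWC W f := by
  have hκ0 : 0 < κ := hκ'.trans_lt hκ
  refine ⟨hf, ?_⟩
  -- With this exponent V_{κ'} = V_κ^θ ≤ W^θ, so |f|/W ≤ C W^{θ-1}, which decays since θ < 1.
  set θ := κ' / κ with hθ
  have hθ1 : θ < 1 := by rw [hθ, div_lt_one hκ0]; exact hκ
  have hθ0 : 0 ≤ θ := by positivity
  have hlim : Tendsto (fun R : ℝ≥0 => ENNReal.ofReal (C * (R : ℝ) ^ (-(1 - θ)))) atTop (𝓝 0) := by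
    have h1 : Tendsto (fun R : ℝ => C * R ^ (-(1 - θ))) atTop (𝓝 (C * 0)) :=
      (tendsto_rpow_neg_atTop (by linarith)).const_mul C
    have h2 := (ENNReal.tendsto_ofReal h1).comp (NNReal.tendsto_coe_atTop.2 tendsto_id)
    rw [mul_zero, ENNReal.ofReal_zero] at h2
    exact h2
  refine tendsto_of_tendsto_of_tendsto_of_le_of_le' tendsto_const_nhds hlim
    (Eventually.of_forall fun _ => zero_le) ?_
  filter_upwards [eventually_gt_atTop 0] with R hR
  refine iSup₂_le fun x hx => ?_
  by_cases htop : W x = ⊤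
  · simp [htop]
  obtain ⟨w, hw⟩ : ∃ w : ℝ≥0, W x = w := ⟨(W x).toNNReal, (ENNReal.coe_toNNReal htop).symm⟩
  have hWx := hW x x.2
  rw [hw] at hx hWx ⊢
  have hRw : (R : ℝ) ≤ w := by exact_mod_cast hx
  have hR0 : (0 : ℝ) < R := by exact_mod_cast hR
  have hw0 : (0 : ℝ) < w := hR0.trans_le hRw
  have hexp : expW κ x ≤ w := by
    rw [← ENNReal.ofReal_coe_nnreal] at hWx
    exact (ENNReal.ofReal_le_ofReal_iff w.2).mp hWx
  have hexp' : expW κ' x ≤ (w : ℝ) ^ θ := by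
    have : expW κ' x = expW κ x ^ θ := by
      rw [expW, expW, ← Real.exp_mul, hθ]
      congr 1
      field_simp
    rw [this]
    exact Real.rpow_le_rpow (expW_pos _ _).le hexp hθ0
  have hmain : |f x| / w ≤ C * (R : ℝ) ^ (-(1 - θ)) := by
    calc |f x| / w ≤ C * (w : ℝ) ^ θ / w := by
          gcongr
          exact (hfC x).trans (by gcongr)
      _ = C * (w : ℝ) ^ (-(1 - θ)) := by
          rw [mul_div_assoc, neg_sub, Real.rpow_sub hw0, Real.rpow_one]
      _ ≤ _ := mul_le_mul_of_nonneg_left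
          (Real.rpow_le_rpow_of_nonpos hR0 hRw (by linarith)) hC
  rw [Real.enorm_eq_ofReal_abs, ← ENNReal.ofReal_coe_nnreal, ← ENNReal.ofReal_div_of_pos hw0]
  exact ENNReal.ofReal_le_ofReal hmain

end MemWC

lemma abs_pd_eta_le (u : X → ℝ) (k : ℕ) (x : X) : |pd (eta k) u x| ≤ ‖fderiv ℝ u x‖ := by
  have := (fderiv ℝ u x).le_opNorm (eta k)
  rwa [norm_eta, mul_one] at this

/-- Membership of `λ u - L u` in the weighted space. -/
lemma memWC_resolvent {A : X →L[ℝ] X} {F : H01 → X} {q κ κ₁ : ℝ} (hκ₁ : κ₁ ∈ Ico 0 κ)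
    (hF : ∀ k : ℕ, MemWC (Θ q κ) fun x : H01 => expW κ₁ x * inner ℝ (F x) (eta k))
    {u : X → ℝ} (hu : u ∈ testFun A 2 κ₁) (l : ℝ) :
    MemWC (Θ q κ) (fun x : H01 => l * u x - kolm A F u x) := by
  obtain ⟨⟨N, g, hg, rfl⟩, hfin⟩ := hu
  rw [ENNReal.add_lt_top, ENNReal.add_lt_top] at hfin
  obtain ⟨C₀, hC₀, h₀⟩ := exists_bound_of_wnorm_lt_top hfin.1.1
  obtain ⟨C₁, hC₁, h₁⟩ := exists_bound_of_wnorm_lt_top (f := fun x => ‖fderiv ℝ (g ∘ proj N) x‖)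
    hfin.1.2
  obtain ⟨C₂, hC₂, h₂⟩ := exists_bound_of_wnorm_lt_top hfin.2
  simp only [abs_norm] at h₁
  have hκ0 : 0 < κ := hκ₁.1.trans_lt hκ₁.2
  have hW : ∀ x ∈ H01, ENNReal.ofReal (expW κ x) ≤ Θ q κ x := fun x hx =>
    (ofReal_expW_le_V q κ x).trans (V_le_Theta q κ hx)
  have hpd : ∀ k (x : X), |pd (eta k) (g ∘ proj N) x| ≤ C₁ * expW κ₁ x := fun k x =>
    (abs_pd_eta_le _ k x).trans (h₁ x)
  have m1 : MemWC (Θ q κ) fun x : H01 => l * (g ∘ proj N) x := by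
    refine memWC_of_le_expW (C := |l| * C₀) hκ₁.1 hκ₁.2 hW (fun R => ?_) (by positivity)
      fun x => ?_
    · let _ := weakTop H01
      exact (continuous_const.mul (continuous_weakTop_cylinder hg.continuous)).continuousOn
    · rw [abs_mul, mul_assoc]
      gcongr
      exact h₀ x
  have m2 : MemWC (Θ q κ) fun x : H01 => -(1 / 2) * traceTerm A (g ∘ proj N) x := by
    refine memWC_of_le_expW (C := C₂) hκ₁.1 hκ₁.2 hW (fun R => ?_) hC₂ fun x => ?_
    · let _ := weakTop H01
      exact (continuous_const.mul (continuous_weakTop_traceTerm A hg)).continuousOn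
    · rw [abs_mul, abs_neg, abs_of_pos (by norm_num : (0 : ℝ) < 1 / 2)]
      have := h₂ x
      have := abs_nonneg (traceTerm A (g ∘ proj N) x)
      linarith
  have m3 : ∀ k, MemWC (Θ q κ) fun x : H01 => lapCoeff x k * -pd (eta k) (g ∘ proj N) x := by
    intro k
    -- The linear growth of (x, η_k) is absorbed by a slightly larger exponent that still lies below
    -- κ.
    obtain ⟨κ', hκ'1, hκ'2⟩ := exists_between hκ₁.2
    have hgap : 0 < κ' - κ₁ := by linarith
    refine memWC_of_le_expW (κ' := κ') (C := (Real.pi * (k + 1)) ^ 2 * (1 / (κ' - κ₁) + 1) * C₁)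
      (hκ₁.1.trans hκ'1.le) hκ'2 hW (fun R => ?_) (by positivity) fun x => ?_
    · let _ := weakTop H01
      have h1 : Continuous fun x : H01 => lapCoeff x k :=
        continuous_const.mul (continuous_weakTop_inner (eta k))
      exact (h1.mul (continuous_weakTop_pd hg (eta k)).neg).continuousOn
    · have hin : |inner ℝ (x : X) (eta k)| ≤ (1 / (κ' - κ₁) + 1) * Real.exp ((κ' - κ₁) * ‖(x : X)‖ ^ 2) := by
        have h1 := abs_real_inner_le_norm (x : X) (eta k)
        rw [norm_eta, mul_one] at h1
        refine h1.trans ?_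
        have h2 := Real.add_one_le_exp ((κ' - κ₁) * ‖(x : X)‖ ^ 2)
        have h3 : ‖(x : X)‖ ≤ 1 + ‖(x : X)‖ ^ 2 := by nlinarith [sq_nonneg (‖(x : X)‖ - 1)]
        have h4 : ‖(x : X)‖ ^ 2 = 1 / (κ' - κ₁) * ((κ' - κ₁) * ‖(x : X)‖ ^ 2) := by field_simp
        have h5 : 0 ≤ (κ' - κ₁) * ‖(x : X)‖ ^ 2 := by positivity
        have h6 : 0 < 1 / (κ' - κ₁) := by positivity
        nlinarith
      have he : expW κ' (x : X) = Real.exp ((κ' - κ₁) * ‖(x : X)‖ ^ 2) * expW κ₁ x := by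
        rw [expW, expW, ← Real.exp_add]
        ring_nf
      rw [abs_mul, abs_neg, lapCoeff, abs_mul, abs_neg, abs_of_nonneg (sq_nonneg _), he]
      have := hpd k x
      calc (Real.pi * (k + 1)) ^ 2 * |inner ℝ (x : X) (eta k)| * |pd (eta k) (g ∘ proj N) x|
          ≤ (Real.pi * (k + 1)) ^ 2 * ((1 / (κ' - κ₁) + 1) * Real.exp ((κ' - κ₁) * ‖(x : X)‖ ^ 2)) *
            (C₁ * expW κ₁ x) := by gcongr
        _ = _ := by ring
  -- The drift term is split as (V_{κ₁}⁻¹ ∂_k u)(V_{κ₁} F^{(k)}): the first factor is bounded since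
  -- u ∈ 𝒟_{κ₁}, the second is in the space by hypothesis.
  have m4 : ∀ k, MemWC (Θ q κ) fun x : H01 =>
      -(pd (eta k) (g ∘ proj N) x * Real.exp (-(κ₁ * ‖(x : X)‖ ^ 2))) *
        (expW κ₁ x * inner ℝ (F x) (eta k)) := by
    intro k
    refine (hF k).mul_bounded (C := C₁.toNNReal) (fun R => ?_) fun x => ?_
    · let _ := weakTop H01
      refine ((continuous_weakTop_pd hg (eta k)).continuousOn.mul ?_).neg
      refine Real.continuous_exp.comp_continuousOn (continuousOn_const.mul ?_).neg
      exact (continuousOn_weakTop_norm_sq R).mono fun x hx =>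
        (derivNorm_sq_le_Theta hκ0.le q x.2).trans hx
    · rw [enorm_neg, Real.enorm_eq_ofReal_abs, abs_mul, Real.abs_exp]
      refine ENNReal.ofReal_le_ofReal ?_
      rw [Real.exp_neg, ← div_eq_mul_inv, div_le_iff₀ (Real.exp_pos _)]
      exact hpd k x
  have key := (m1.add m2).add ((MemWC.sum (Finset.range N) fun k _ => m3 k).add
    (MemWC.sum (Finset.range N) fun k _ => m4 k))
  convert key using 1
  funext x
  rw [kolm_cylinder A F hg x, ← Finset.sum_add_distrib]
  have : ∀ k, lapCoeff x k * -pd (eta k) (g ∘ proj N) x +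
      -(pd (eta k) (g ∘ proj N) x * Real.exp (-(κ₁ * ‖(x : X)‖ ^ 2))) *
        (expW κ₁ x * inner ℝ (F x) (eta k)) =
      -((lapCoeff x k + inner ℝ (F x) (eta k)) * pd (eta k) (g ∘ proj N) x) := by
    intro k
    have he : Real.exp (-(κ₁ * ‖(x : X)‖ ^ 2)) * expW κ₁ x = 1 := by
      rw [expW, ← Real.exp_add]; simp
    linear_combination (-pd (eta k) (g ∘ proj N) x * inner ℝ (F x) (eta k)) * he
  simp only [this, Finset.sum_neg_distrib]
  ring

lemma memWC_testFun {A : X →L[ℝ] X} {q κ κ₁ : ℝ} (hκ₁ : κ₁ ∈ Ico 0 κ) {u : X → ℝ}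
    (hu : u ∈ testFun A 2 κ₁) : MemWC (V q κ) (fun x : Xp q => u x) := by
  obtain ⟨⟨N, g, hg, rfl⟩, hfin⟩ := hu
  rw [ENNReal.add_lt_top, ENNReal.add_lt_top] at hfin
  obtain ⟨C₀, hC₀, h₀⟩ := exists_bound_of_wnorm_lt_top hfin.1.1
  refine memWC_of_le_expW hκ₁.1 hκ₁.2 (fun x _ => ofReal_expW_le_V q κ x) (fun R => ?_) hC₀
    fun x => h₀ x
  let _ := weakTop (Xp q)
  exact (continuous_weakTop_cylinder hg.continuous).continuousOn

/-! ### Weak compactness and lower semicontinuity -/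

/-- Banach–Alaoglu in the dual, carried back to `X` by the Riesz isomorphism. Working with an
ultrafilter makes the norm and the L^q integral converge along the same filter, without extracting
subsequences. -/
lemma exists_weak_limit {𝒰 : Ultrafilter X} {B : ℝ} (hB : ∀ᶠ x in (𝒰 : Filter X), ‖x‖ ≤ B) :
    ∃ x₀ : X, ∀ h : X, Tendsto (fun x => inner ℝ x h) 𝒰 (𝓝 (inner ℝ x₀ h)) := by
  have hc := WeakDual.isCompact_closedBall (𝕜 := ℝ) (E := X) 0 B
  let T : X → WeakDual ℝ X := fun x => StrongDual.toWeakDual (innerSL ℝ x)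
  have hmem : WeakDual.toStrongDual ⁻¹' Metric.closedBall 0 B ∈ 𝒰.map T := by
    rw [Ultrafilter.mem_map]
    filter_upwards [hB] with x hx
    simpa [T] using hx
  obtain ⟨ℓ, -, hℓ⟩ := isCompact_iff_ultrafilter_le_nhds.mp hc (𝒰.map T) (le_principal_iff.mpr hmem)
  refine ⟨(InnerProductSpace.toDual ℝ X).symm (WeakDual.toStrongDual ℓ), fun h => ?_⟩
  rw [InnerProductSpace.toDual_symm_apply]
  have h1 : Tendsto T 𝒰 (𝓝 ℓ) := hℓ
  have h2 := ((WeakBilin.eval_continuous (topDualPairing ℝ X) h).tendsto ℓ).comp h1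
  exact h2

/-- The odd power `|s|^{p-2} s`. -/
noncomputable def oddPow (p s : ℝ) : ℝ := |s| ^ (p - 2) * s

lemma abs_oddPow {p : ℝ} (hp : 1 < p) (s : ℝ) : |oddPow p s| = |s| ^ (p - 1) := by
  rw [oddPow, abs_mul, Real.abs_rpow_of_nonneg (abs_nonneg _), abs_abs]
  rcases eq_or_ne s 0 with rfl | hs
  · rw [abs_zero, mul_zero, Real.zero_rpow (by linarith)]
  · rw [← Real.rpow_add_one (abs_ne_zero.mpr hs)]
    congr 1
    ring

lemma oddPow_mul_self {p : ℝ} (hp : 1 < p) (s : ℝ) : oddPow p s * s = |s| ^ p := by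
  rw [oddPow, mul_assoc, ← sq, ← sq_abs]
  rcases eq_or_ne s 0 with rfl | hs
  · simp [Real.zero_rpow (by linarith : p ≠ 0)]
  · rw [← Real.rpow_two, ← Real.rpow_add (abs_pos.mpr hs)]
    congr 1
    ring

/-- The tangent line inequality for the convex function `|·|^p`. -/
lemma abs_rpow_tangent_le {p : ℝ} (hp : 1 < p) (a b : ℝ) :
    |b| ^ p + p * (oddPow p b * (a - b)) ≤ |a| ^ p := by
  -- Young's inequality for |a| and |b|^{p-1} is the tangent line inequality once |b|^p is moved
  -- across.
  have hc : p.HolderConjugate p.conjExponent := Real.HolderConjugate.conjExponent hp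
  have hy := Real.young_inequality_of_nonneg (abs_nonneg a)
    (Real.rpow_nonneg (abs_nonneg b) (p - 1)) hc
  have hpos : 0 < p := by linarith
  have e : (|b| ^ (p - 1)) ^ p.conjExponent = |b| ^ p := by
    rw [← Real.rpow_mul (abs_nonneg b), Real.conjExponent]
    congr 1
    field_simp [sub_ne_zero.mpr hp.ne']
  rw [e] at hy
  have h1 : oddPow p b * a ≤ |a| * |b| ^ (p - 1) := by
    rw [← abs_oddPow hp, ← abs_mul, mul_comm a]
    exact le_abs_self _
  have h2 := oddPow_mul_self hp b
  have h3 : p.conjExponent⁻¹ = 1 - p⁻¹ := by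
    have := hc.inv_add_inv_eq_one
    linarith
  rw [div_eq_mul_inv, div_eq_mul_inv, h3] at hy
  have h4 : p * (|a| * |b| ^ (p - 1)) ≤ |a| ^ p + (p - 1) * |b| ^ p := by
    calc p * (|a| * |b| ^ (p - 1)) ≤ p * (|a| ^ p * p⁻¹ + |b| ^ p * (1 - p⁻¹)) := by gcongr
      _ = _ := by field_simp
  have h5 := mul_le_mul_of_nonneg_left h1 hpos.le
  rw [mul_sub, h2, mul_sub]
  linarith

lemma continuous_oddPow {p : ℝ} (hp : 2 ≤ p) : Continuous (oddPow p) := by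
  unfold oddPow
  exact (continuous_abs.rpow_const fun _ => Or.inr (by linarith)).mul continuous_id

lemma lpPow_eq_lintegral_ofReal {p : ℝ} (hp : 0 ≤ p) (x : X) :
    lpPow p x = ∫⁻ r, ENNReal.ofReal (|x r| ^ p) ∂unitVol := by
  rw [lpPow]
  refine lintegral_congr fun r => ?_
  rw [Real.enorm_eq_ofReal_abs, ENNReal.ofReal_rpow_of_nonneg (abs_nonneg _) hp]

lemma ofReal_integral_le_lintegral {f : ℝ → ℝ} (hf : Integrable f unitVol) :
    ENNReal.ofReal (∫ r, f r ∂unitVol) ≤ ∫⁻ r, ENNReal.ofReal (f r) ∂unitVol := by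
  rw [integral_eq_lintegral_pos_part_sub_lintegral_neg_part hf]
  exact (ENNReal.ofReal_le_ofReal (sub_le_self _ ENNReal.toReal_nonneg)).trans
    ENNReal.ofReal_toReal_le

/-- Weak lower semicontinuity of `|·|_p^p`. -/
lemma lpPow_le_of_weak_limit {p : ℝ} (hp : 2 ≤ p) {𝒰 : Filter X} [𝒰.NeBot] {x₀ : X}
    (hx₀ : ∀ h : X, Tendsto (fun x => inner ℝ x h) 𝒰 (𝓝 (inner ℝ x₀ h))) {B : ℝ≥0∞}
    (hB : ∀ᶠ x in 𝒰, lpPow p x ≤ B) : lpPow p x₀ ≤ B := by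
  have hp1 : 1 < p := by linarith
  have hmx : AEStronglyMeasurable x₀ unitVol := (Lp.memLp x₀).1
  -- The truncation makes the slope |b|^{p-2} b bounded, hence an element of L² that can be tested
  -- against weak convergence.
  set b : ℕ → ℝ → ℝ := fun M r => if |x₀ r| ≤ M then x₀ r else 0 with hb
  have hbm : ∀ M, Measurable (b M) := fun M =>
    Measurable.ite (measurableSet_le (Lp.stronglyMeasurable x₀).measurable.abs measurable_const)
      (Lp.stronglyMeasurable x₀).measurable measurable_const
  have hbM : ∀ M r, |b M r| ≤ M := by
    intro M r
    simp only [hb]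
    split_ifs with h
    · exact h
    · simp
  have hbp : ∀ M, Integrable (fun r => |b M r| ^ p) unitVol := by
    intro M
    refine Integrable.of_bound (C := (M : ℝ) ^ p)
      ((hbm M).abs.pow_const p).aestronglyMeasurable (Eventually.of_forall fun r => ?_)
    rw [Real.norm_of_nonneg (by positivity)]
    exact Real.rpow_le_rpow (abs_nonneg _) (hbM M r) (by linarith)
  have hh : ∀ M, MemLp (fun r => oddPow p (b M r)) 2 unitVol := by
    intro M
    refine MemLp.of_bound ((continuous_oddPow hp).measurable.comp (hbm M)).aestronglyMeasurable
      ((M : ℝ) ^ (p - 1)) (Eventually.of_forall fun r => ?_)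
    rw [Real.norm_eq_abs, abs_oddPow hp1]
    exact Real.rpow_le_rpow (abs_nonneg _) (hbM M r) (by linarith)
  have key : ∀ M : ℕ, ∫⁻ r, ENNReal.ofReal (|b M r| ^ p) ∂unitVol ≤ B := by
    intro M
    rw [← ofReal_integral_eq_lintegral_ofReal (hbp M)
      (Eventually.of_forall fun r => by positivity)]
    set h : X := (hh M).toLp _ with hhdef
    have hlow : ∀ᶠ x in 𝒰, ENNReal.ofReal (∫ r, |b M r| ^ p ∂unitVol +
        p * (inner ℝ x h - inner ℝ x₀ h)) ≤ B := by
      filter_upwards [hB] with x hx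
      refine le_trans ?_ hx
      rw [lpPow_eq_lintegral_ofReal (by linarith)]
      have hix : ∀ x : X, Integrable (fun r => x r * oddPow p (b M r)) unitVol := fun x =>
        (Lp.memLp x).integrable_mul (hh M)
      have hdiff : Integrable (fun r => p * (x r * oddPow p (b M r) - x₀ r * oddPow p (b M r)))
        unitVol := ((hix x).sub (hix x₀)).const_mul p
      have e : ∫ r, |b M r| ^ p ∂unitVol + p * (inner ℝ x h - inner ℝ x₀ h) =
          ∫ r, (|b M r| ^ p + p * (x r * oddPow p (b M r) - x₀ r * oddPow p (b M r))) ∂unitVol := by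
        rw [integral_add (hbp M) hdiff, integral_const_mul, integral_sub (hix x) (hix x₀), hhdef,
          inner_toLp_right, inner_toLp_right]
      rw [e]
      refine (ofReal_integral_le_lintegral ((hbp M).add hdiff)).trans ?_
      refine lintegral_mono fun r => ENNReal.ofReal_le_ofReal ?_
      refine le_trans (le_of_eq ?_) (abs_rpow_tangent_le hp1 (x r) (b M r))
      -- The truncation sets large values to zero instead of clipping them. So b is x₀ or 0 at each
      -- point, and the tangent at b can be paired with x - x₀ in place of x - b.
      have : x₀ r * oddPow p (b M r) = b M r * oddPow p (b M r) := by
        simp only [hb]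
        split_ifs
        · rfl
        · simp [oddPow]
      simp only [Pi.add_apply, this]
      ring
    have hlim : Tendsto (fun x => ENNReal.ofReal (∫ r, |b M r| ^ p ∂unitVol +
        p * (inner ℝ x h - inner ℝ x₀ h))) 𝒰
        (𝓝 (ENNReal.ofReal (∫ r, |b M r| ^ p ∂unitVol + p * (inner ℝ x₀ h - inner ℝ x₀ h)))) :=
      ENNReal.tendsto_ofReal ((((hx₀ h).sub_const _).const_mul p).const_add _)
    rw [sub_self, mul_zero, add_zero] at hlim
    exact le_of_tendsto hlim hlow
  -- Fatou's lemma removes the truncation: at each r the integrands are eventually constant in M.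
  rw [lpPow_eq_lintegral_ofReal (by linarith)]
  calc ∫⁻ r, ENNReal.ofReal (|x₀ r| ^ p) ∂unitVol
      = ∫⁻ r, liminf (fun M : ℕ => ENNReal.ofReal (|b M r| ^ p)) atTop ∂unitVol := by
        refine lintegral_congr fun r => ?_
        symm
        refine Tendsto.liminf_eq (tendsto_const_nhds.congr' ?_)
        obtain ⟨M₀, hM₀⟩ := exists_nat_ge |x₀ r|
        filter_upwards [eventually_ge_atTop M₀] with M hM
        have : |x₀ r| ≤ M := hM₀.trans (by exact_mod_cast hM)
        simp only [hb, if_pos this]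
    _ ≤ liminf (fun M : ℕ => ∫⁻ r, ENNReal.ofReal (|b M r| ^ p) ∂unitVol) atTop :=
        lintegral_liminf_le fun M => ((hbm M).abs.pow_const p).ennreal_ofReal
    _ ≤ B := (liminf_le_liminf (Eventually.of_forall key)).trans (by simp)

/-- Testing the weak convergence against x₀ itself gives |x₀|² ≤ ρ|x₀|. -/
lemma norm_le_of_weak_limit {𝒰 : Filter X} [𝒰.NeBot] {x₀ : X}
    (hx₀ : ∀ h : X, Tendsto (fun x => inner ℝ x h) 𝒰 (𝓝 (inner ℝ x₀ h))) {ρ : ℝ}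
    (hρ : Tendsto (fun x : X => ‖x‖) 𝒰 (𝓝 ρ)) : ‖x₀‖ ≤ ρ := by
  have h1 : inner ℝ x₀ x₀ ≤ ρ * ‖x₀‖ :=
    le_of_tendsto_of_tendsto' (hx₀ x₀) (hρ.mul_const ‖x₀‖) fun x => real_inner_le_norm x x₀
  have hρ0 : 0 ≤ ρ := ge_of_tendsto' hρ fun x => norm_nonneg x
  rw [real_inner_self_eq_norm_sq] at h1
  rcases (norm_nonneg x₀).eq_or_lt with h | h
  · rw [← h]; exact hρ0
  · nlinarith

lemma tendsto_ultrafilter_of_bounded {𝒰 : Ultrafilter X} {B : ℝ}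
    (hB : ∀ᶠ x in (𝒰 : Filter X), ‖x‖ ≤ B) : ∃ ρ, Tendsto (fun x : X => ‖x‖) 𝒰 (𝓝 ρ) := by
  have hmem : Icc 0 B ∈ 𝒰.map fun x : X => ‖x‖ := by
    rw [Ultrafilter.mem_map]
    filter_upwards [hB] with x hx
    exact ⟨norm_nonneg x, hx⟩
  obtain ⟨ρ, -, hρ⟩ := isCompact_iff_ultrafilter_le_nhds.mp (isCompact_Icc (a := 0) (b := B))
    (𝒰.map fun x : X => ‖x‖) (le_principal_iff.mpr hmem)
  exact ⟨ρ, hρ⟩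

/-- Along a bounded weakly convergent ultrafilter the Lyapunov function converges, and the limit
is at least its value at the weak limit. -/
lemma exists_V_limit {q κ : ℝ} (hq : 2 ≤ q) (hκ : 0 ≤ κ) {𝒰 : Ultrafilter X} {B : ℝ}
    (hB : ∀ᶠ x in (𝒰 : Filter X), ‖x‖ ≤ B) {x₀ : X}
    (hx₀ : ∀ h : X, Tendsto (fun x => inner ℝ x h) 𝒰 (𝓝 (inner ℝ x₀ h))) :
    ∃ v, Tendsto (V q κ) 𝒰 (𝓝 v) ∧ V q κ x₀ ≤ v := by
  obtain ⟨ρ, hρ⟩ := tendsto_ultrafilter_of_bounded hB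
  have hle := norm_le_of_weak_limit hx₀ hρ
  have he : Tendsto (fun x => ENNReal.ofReal (expW κ x)) 𝒰
      (𝓝 (ENNReal.ofReal (Real.exp (κ * ρ ^ 2)))) :=
    ENNReal.tendsto_ofReal ((Real.continuous_exp.tendsto _).comp ((hρ.pow 2).const_mul κ))
  have hexp : ENNReal.ofReal (expW κ x₀) ≤ ENNReal.ofReal (Real.exp (κ * ρ ^ 2)) := by
    refine ENNReal.ofReal_le_ofReal (Real.exp_le_exp.mpr ?_)
    gcongr
  by_cases h2 : q = 2
  · subst h2
    refine ⟨ENNReal.ofReal (Real.exp (κ * ρ ^ 2)), ?_, ?_⟩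
    · exact he.congr fun x => (V_two κ x).symm
    · simpa [V] using hexp
  -- Compactness of [0,∞] gives a limit of |x|_q^q that may be infinite; finiteness is recovered
  -- only for maximizing ultrafilters.
  · obtain ⟨ℓ, -, hℓ⟩ := isCompact_iff_ultrafilter_le_nhds.mp (isCompact_univ (X := ℝ≥0∞))
      (𝒰.map (lpPow q)) (by simp)
    have hℓ' : Tendsto (lpPow q) 𝒰 (𝓝 ℓ) := hℓ
    have hlp : lpPow q x₀ ≤ ℓ := by
      refine le_of_forall_gt_imp_ge_of_dense fun B' hB' => ?_
      exact lpPow_le_of_weak_limit hq hx₀ ((hℓ'.eventually_lt_const hB').mono fun x hx => hx.le)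
    refine ⟨ENNReal.ofReal (Real.exp (κ * ρ ^ 2)) * (1 + ℓ), ?_, ?_⟩
    · have hV : V q κ = fun x => ENNReal.ofReal (expW κ x) * (1 + lpPow q x) := by
        funext x; simp [V, h2]
      rw [hV]
      exact ENNReal.Tendsto.mul he (Or.inl (by simp [Real.exp_pos])) (hℓ'.const_add 1)
        (Or.inr ENNReal.ofReal_ne_top)
    · rw [V, if_neg h2]
      gcongr

lemma V_ne_top_iff {q κ : ℝ} (hq : 2 ≤ q) (x : X) : V q κ x ≠ ⊤ ↔ x ∈ Xp q := by
  by_cases h2 : q = 2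
  · subst h2
    simp [V, mem_Xp_two]
  · rw [V, if_neg h2, Xp, mem_ofPred_eq]
    simp [ENNReal.mul_eq_top, expW_pos, lt_top_iff_ne_top]

/-- A cylinder function of lower growth whose quotient by the Lyapunov function is somewhere
positive attains the supremum of this quotient. -/
lemma exists_maximizer {q κ κ₁ : ℝ} (hq : 2 ≤ q) (hκ₁ : κ₁ ∈ Ico 0 κ) {N : ℕ} {g : E N → ℝ}
    (hg : Continuous g) {C : ℝ} (hC : ∀ x, |g (proj N x)| ≤ C * expW κ₁ x) {M : ℝ≥0∞}
    (hM : M = ⨆ x : Xp q, ENNReal.ofReal (g (proj N x)) / V q κ x) (hM0 : M ≠ 0) :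
    ∃ c : ℝ, 0 < c ∧ M = ENNReal.ofReal c ∧ ∃ x₀ ∈ Xp q, g (proj N x₀) = c * (V q κ x₀).toReal ∧
      ∀ x ∈ Xp q, g (proj N x) ≤ c * (V q κ x).toReal := by
  have hκ0 : 0 < κ := hκ₁.1.trans_lt hκ₁.2
  have hC0 : 0 ≤ C := by
    have := (abs_nonneg _).trans (hC 0)
    exact nonneg_of_mul_nonneg_left this (expW_pos _ _)
  set rat : X → ℝ≥0∞ := fun x => ENNReal.ofReal (g (proj N x)) / V q κ x with hrat
  have hVpos : ∀ x, V q κ x ≠ 0 := fun x => (zero_lt_one.trans_le (one_le_V hκ0.le q x)).ne'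
  -- This Gaussian bound makes the supremum finite and forces almost maximizing points to stay
  -- bounded.
  have hrle : ∀ x, rat x ≤ ENNReal.ofReal (C * Real.exp ((κ₁ - κ) * ‖x‖ ^ 2)) := by
    intro x
    refine ENNReal.div_le_of_le_mul' ?_
    refine le_trans ?_ (mul_le_mul_left (ofReal_expW_le_V q κ x) _)
    rw [← ENNReal.ofReal_mul (expW_pos _ _).le]
    refine ENNReal.ofReal_le_ofReal ((le_abs_self _).trans ((hC x).trans (le_of_eq ?_)))
    rw [expW, expW, mul_left_comm, ← Real.exp_add]
    ring_nf
  have hMtop : M ≠ ⊤ := by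
    have : M ≤ ENNReal.ofReal C := by
      rw [hM]
      refine iSup_le fun x => (hrle x).trans (ENNReal.ofReal_le_ofReal ?_)
      refine mul_le_of_le_one_right hC0 (Real.exp_le_one_iff.mpr ?_)
      exact mul_nonpos_of_nonpos_of_nonneg (by linarith [hκ₁.2]) (sq_nonneg _)
    exact (this.trans_lt ENNReal.ofReal_lt_top).ne
  -- Any ultrafilter below this filter plays the role of a maximizing sequence in X_q.
  set 𝓕 : Filter X := comap rat (𝓝 M) ⊓ 𝓟 (Xp q) with h𝓕
  have hne : 𝓕.NeBot := by
    rw [h𝓕, inf_principal_neBot_iff]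
    intro U hU
    obtain ⟨W, hW, hWU⟩ := mem_comap.mp hU
    obtain ⟨a, ha, haW⟩ := exists_Ioc_subset_of_mem_nhds hW ⟨0, pos_iff_ne_zero.mpr hM0⟩
    rw [hM] at ha
    obtain ⟨x, hx⟩ := lt_iSup_iff.mp ha
    refine ⟨x, hWU (haW ⟨hx, ?_⟩), x.2⟩
    rw [hM]
    exact le_iSup (fun x : Xp q => ENNReal.ofReal (g (proj N x)) / V q κ x) x
  set 𝒰 : Ultrafilter X := Ultrafilter.of 𝓕
  have h𝒰 : (𝒰 : Filter X) ≤ 𝓕 := Ultrafilter.of_le 𝓕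
  have hrlim : Tendsto rat 𝒰 (𝓝 M) := tendsto_comap.mono_left (h𝒰.trans inf_le_left)
  have hXp : ∀ᶠ x in (𝒰 : Filter X), x ∈ Xp q :=
    (h𝒰.trans inf_le_right) (mem_principal_self _)
  obtain ⟨c, hc0, hMc⟩ : ∃ c : ℝ, 0 < c ∧ M = ENNReal.ofReal c :=
    ⟨M.toReal, ENNReal.toReal_pos hM0 hMtop, (ENNReal.ofReal_toReal hMtop).symm⟩
  have hbd : ∃ B : ℝ, ∀ᶠ x in (𝒰 : Filter X), ‖x‖ ≤ B := by
    have hlim : Tendsto (fun t : ℝ => C * Real.exp ((κ₁ - κ) * t ^ 2)) atTop (𝓝 (C * 0)) := by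
      refine (Real.tendsto_exp_atBot.comp ?_).const_mul C
      exact (tendsto_pow_atTop two_ne_zero).const_mul_atTop_of_neg (by linarith [hκ₁.2])
    rw [mul_zero] at hlim
    obtain ⟨B, hB⟩ := eventually_atTop.mp (hlim.eventually_lt_const (half_pos hc0))
    refine ⟨B, ?_⟩
    have hhalf : ENNReal.ofReal (c / 2) < M := by
      rw [hMc]
      exact (ENNReal.ofReal_lt_ofReal_iff hc0).mpr (by linarith)
    filter_upwards [hrlim.eventually_const_lt hhalf] with x hx
    by_contra hcon
    have h1 := hB ‖x‖ (not_le.mp hcon).le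
    have h2 := hx.trans_le (hrle x)
    exact absurd h2 (not_lt.mpr (ENNReal.ofReal_le_ofReal h1.le))
  obtain ⟨B, hB⟩ := hbd
  obtain ⟨x₀, hx₀⟩ := exists_weak_limit hB
  obtain ⟨v, hv, hVv⟩ := exists_V_limit hq hκ0.le hB hx₀
  have hproj : Tendsto (fun x => g (proj N x)) 𝒰 (𝓝 (g (proj N x₀))) := by
    refine (hg.tendsto _).comp ?_
    refine ((PiLp.continuous_toLp 2 _).tendsto _).comp (tendsto_pi_nhds.mpr fun i => ?_)
    exact hx₀ (eta i)
  have hmul : Tendsto (fun x => rat x * V q κ x) 𝒰 (𝓝 (M * v)) :=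
    ENNReal.Tendsto.mul hrlim (Or.inl hM0) hv (Or.inr hMtop)
  -- Along the ultrafilter u⁺ is the quotient times `V`, so u⁺(x₀) = M v by weak continuity of `u`.
  -- In particular v is finite, and V(x₀) ≤ v shows that the quotient at x₀ is at least M.
  have heq : ENNReal.ofReal (g (proj N x₀)) = M * v := by
    refine tendsto_nhds_unique (ENNReal.tendsto_ofReal hproj) (hmul.congr' ?_)
    filter_upwards [hXp] with x hx
    exact ENNReal.div_mul_cancel (hVpos x) ((V_ne_top_iff hq x).mpr hx)
  have hvtop : v ≠ ⊤ := by
    rintro rfl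
    rw [ENNReal.mul_top hM0] at heq
    exact ENNReal.ofReal_ne_top heq
  have hVtop : V q κ x₀ ≠ ⊤ := (hVv.trans_lt (lt_top_iff_ne_top.mpr hvtop)).ne
  have hx₀mem : x₀ ∈ Xp q := (V_ne_top_iff hq x₀).mp hVtop
  have hall : ∀ x ∈ Xp q, g (proj N x) ≤ c * (V q κ x).toReal := by
    intro x hx
    have h1 : rat x ≤ M := by
      rw [hM]
      exact le_iSup (fun x : Xp q => ENNReal.ofReal (g (proj N x)) / V q κ x) ⟨x, hx⟩
    have hVx := (V_ne_top_iff (κ := κ) hq x).mpr hx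
    rw [hrat, ENNReal.div_le_iff (hVpos x) hVx, hMc] at h1
    have h2 := ENNReal.toReal_mono (ENNReal.mul_ne_top ENNReal.ofReal_ne_top hVx) h1
    rw [ENNReal.toReal_mul, ENNReal.toReal_ofReal hc0.le] at h2
    exact (le_max_left _ 0).trans (by simpa [ENNReal.toReal_ofReal'] using h2)
  refine ⟨c, hc0, hMc, x₀, hx₀mem, le_antisymm (hall x₀ hx₀mem) ?_, hall⟩
  have h3 : M * V q κ x₀ ≤ ENNReal.ofReal (g (proj N x₀)) := by
    rw [heq]
    gcongr
  have hpos : 0 < g (proj N x₀) := by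
    rw [← ENNReal.ofReal_pos]
    refine lt_of_lt_of_le ?_ h3
    exact ENNReal.mul_pos hM0 (hVpos x₀)
  have h4 := ENNReal.toReal_mono ENNReal.ofReal_ne_top h3
  rwa [ENNReal.toReal_mul, ENNReal.toReal_ofReal hpos.le, hMc, ENNReal.toReal_ofReal hc0.le] at h4

/-! ### Derivatives of the Lyapunov function -/

lemma hasDerivAt_abs_rpow_oddPow {q : ℝ} (hq : 1 < q) (s : ℝ) :
    HasDerivAt (fun s => |s| ^ q) (q * oddPow q s) s := by
  have := hasDerivAt_abs_rpow s hq
  rwa [mul_assoc] at this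

lemma hasDerivAt_oddPow {q : ℝ} (hq : 2 ≤ q) (s : ℝ) :
    HasDerivAt (oddPow q) ((q - 1) * |s| ^ (q - 2)) s := by
  -- For q = 2 the convention 0⁰ = 1 makes the stated derivative equal to 1 at the origin as well.
  -- For q > 2 the origin needs a separate difference quotient.
  rcases eq_or_lt_of_le hq with rfl | hq2
  · have : oddPow 2 = fun s => s := by funext t; simp [oddPow]
    rw [this]
    refine (hasDerivAt_id' s).congr_deriv ?_
    norm_num
  rcases eq_or_ne s 0 with rfl | hs
  · rw [abs_zero, Real.zero_rpow (by linarith), mul_zero, hasDerivAt_iff_tendsto_slope]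
    have hc : Tendsto (fun t : ℝ => |t| ^ (q - 2)) (𝓝[≠] 0) (𝓝 0) := by
      have h : Continuous fun t : ℝ => |t| ^ (q - 2) :=
        continuous_abs.rpow_const fun _ => Or.inr (by linarith)
      have := h.tendsto 0
      rw [abs_zero, Real.zero_rpow (by linarith)] at this
      exact this.mono_left nhdsWithin_le_nhds
    refine hc.congr' ?_
    filter_upwards [self_mem_nhdsWithin] with t ht
    have ht : t ≠ 0 := ht
    rw [slope_def_field, oddPow, oddPow, mul_zero, sub_zero, sub_zero, mul_div_assoc, div_self ht,
      mul_one]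
  · have habs : HasDerivAt (fun t : ℝ => |t|) (SignType.sign s : ℝ) s := hasDerivAt_abs hs
    have h1 := (habs.rpow_const (p := q - 2) (Or.inl (abs_ne_zero.mpr hs))).mul (hasDerivAt_id' s)
    refine h1.congr_deriv ?_
    have e1 : |s| ^ (q - 2) = |s| ^ (q - 2 - 1) * |s| := by
      rw [← Real.rpow_add_one (abs_ne_zero.mpr hs)]
      congr 1
      ring
    have e2 : (SignType.sign s : ℝ) * s = |s| := by
      rw [mul_comm]; exact self_mul_sign s
    rw [e1]
    linear_combination (q - 2) * |s| ^ (q - 2 - 1) * e2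

/-- A single majorant (1+|s|)^q serves for every integrand occurring in `V` and its first two
derivatives. -/
lemma abs_rpow_le_one_add {a q : ℝ} (ha : 0 ≤ a) (haq : a ≤ q) (s : ℝ) :
    |s| ^ a ≤ (1 + |s|) ^ q :=
  (Real.rpow_le_rpow (abs_nonneg s) (by linarith) ha).trans
    (Real.rpow_le_rpow_of_exponent_le (by linarith [abs_nonneg s]) haq)

section Parametric

variable {B : Type*} [NormedAddCommGroup B] [NormedSpace ℝ B] {q : ℝ} {y : ℝ → ℝ}
  {ℓ : ℝ → B →L[ℝ] ℝ} {K : ℝ}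

/-- In this setting the argument y(r) + ℓ(r)ξ covers both uses below: lines x₀ + t h with parameter
space ℝ, and sine polynomials with y = 0 and parameter space E_n. `D` stands for a bound on |ℓ(r)ξ|.
-/
lemma integrable_one_add_rpow (hq : 2 ≤ q) (hy : MemLp y (ENNReal.ofReal q) unitVol) (D : ℝ)
    (hD : 0 ≤ D) : Integrable (fun r => (1 + (|y r| + D)) ^ q) unitVol := by
  have h1 : MemLp (fun r => 1 + (|y r| + D)) (ENNReal.ofReal q) unitVol :=
    MemLp.add (f := fun _ => (1 : ℝ)) (g := fun r => |y r| + D) (memLp_const 1)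
      (MemLp.add (f := fun r => |y r|) (g := fun _ => D) hy.abs (memLp_const D))
  have h2 := h1.integrable_norm_rpow (by simp; linarith) ENNReal.ofReal_ne_top
  rw [ENNReal.toReal_ofReal (by linarith)] at h2
  refine h2.congr (Eventually.of_forall fun r => ?_)
  simp only
  rw [Real.norm_of_nonneg (by positivity)]

lemma integrable_comp_of_growth (hq : 2 ≤ q) (hy : MemLp y (ENNReal.ofReal q) unitVol)
    (hℓm : AEStronglyMeasurable ℓ unitVol) (hℓ : ∀ r, ‖ℓ r‖ ≤ K) {ρ : ℝ → ℝ} (hρ : Continuous ρ)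
    {C : ℝ} (hC : ∀ s, |ρ s| ≤ C * (1 + |s|) ^ q) {z : ℝ → ℝ}
    (hz : AEStronglyMeasurable z unitVol) {K' : ℝ} (hzK : ∀ r, |z r| ≤ K') (ξ : B) :
    Integrable (fun r => ρ (y r + ℓ r ξ) * z r) unitVol := by
  have hK : 0 ≤ K := (norm_nonneg _).trans (hℓ 0)
  have hC0 : 0 ≤ C := by
    have := (abs_nonneg _).trans (hC 0)
    simpa using this
  have hm : AEStronglyMeasurable (fun r => ρ (y r + ℓ r ξ) * z r) unitVol :=
    (hρ.comp_aestronglyMeasurable (hy.1.add (hℓm.apply_continuousLinearMap ξ))).mul hz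
  refine ((integrable_one_add_rpow hq hy (K * ‖ξ‖) (by positivity)).const_mul (C * K')).mono' hm
    (Eventually.of_forall fun r => ?_)
  rw [norm_mul, Real.norm_eq_abs, Real.norm_eq_abs]
  have h1 : |ℓ r ξ| ≤ K * ‖ξ‖ := ((ℓ r).le_opNorm ξ).trans (by gcongr; exact hℓ r)
  have h2 : |y r + ℓ r ξ| ≤ |y r| + K * ‖ξ‖ := (abs_add_le _ _).trans (by gcongr)
  calc |ρ (y r + ℓ r ξ)| * |z r| ≤ C * (1 + |y r + ℓ r ξ|) ^ q * K' := by
        gcongr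
        · exact hC _
        · exact hzK r
    _ ≤ C * (1 + (|y r| + K * ‖ξ‖)) ^ q * K' := by
        have : 0 ≤ K' := (abs_nonneg _).trans (hzK 0)
        gcongr
    _ = _ := by ring

/-- Differentiation under the integral sign for Nemytskii functionals of polynomial growth. -/
lemma hasFDerivAt_integral_comp (hq : 2 ≤ q) (hy : MemLp y (ENNReal.ofReal q) unitVol)
    (hℓm : AEStronglyMeasurable ℓ unitVol) (hℓ : ∀ r, ‖ℓ r‖ ≤ K) {ρ ρ' : ℝ → ℝ}
    (hρ : ∀ s, HasDerivAt ρ (ρ' s) s) (hρ' : Continuous ρ')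
    {C : ℝ} (hC : ∀ s, |ρ s| ≤ C * (1 + |s|) ^ q) (hC' : ∀ s, |ρ' s| ≤ C * (1 + |s|) ^ q)
    {z : ℝ → ℝ} (hz : AEStronglyMeasurable z unitVol) {K' : ℝ} (hzK : ∀ r, |z r| ≤ K') (ξ : B) :
    ∃ T : B →L[ℝ] ℝ, HasFDerivAt (fun ξ => ∫ r, ρ (y r + ℓ r ξ) * z r ∂unitVol) T ξ ∧
      ∀ a, T a = ∫ r, ρ' (y r + ℓ r ξ) * (z r * ℓ r a) ∂unitVol := by
  have hρc : Continuous ρ := continuous_iff_continuousAt.mpr fun s => (hρ s).continuousAt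
  have hK : 0 ≤ K := (norm_nonneg _).trans (hℓ 0)
  have hK' : 0 ≤ K' := (abs_nonneg _).trans (hzK 0)
  have hC0 : 0 ≤ C := by
    have := (abs_nonneg _).trans (hC 0)
    simpa using this
  set F' : B → ℝ → B →L[ℝ] ℝ := fun ξ r => (ρ' (y r + ℓ r ξ) * z r) • ℓ r with hF'
  have hm' : AEStronglyMeasurable (F' ξ) unitVol :=
    ((hρ'.comp_aestronglyMeasurable (hy.1.add (hℓm.apply_continuousLinearMap ξ))).mul hz).smul hℓm
  -- On the unit ball around ξ the perturbation is at most K(‖ξ‖+1), which gives a dominating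
  -- function independent of ζ.
  have hbound : ∀ r, ∀ ζ ∈ Metric.ball ξ 1, ‖F' ζ r‖ ≤
      C * K' * K * (1 + (|y r| + K * (‖ξ‖ + 1))) ^ q := by
    intro r ζ hζ
    have hζ' : ‖ζ‖ ≤ ‖ξ‖ + 1 := by
      have := norm_sub_norm_le ζ ξ
      rw [Metric.mem_ball, dist_eq_norm] at hζ
      linarith
    have h1 : |ℓ r ζ| ≤ K * (‖ξ‖ + 1) := ((ℓ r).le_opNorm ζ).trans (by gcongr; exact hℓ r)
    have h2 : |y r + ℓ r ζ| ≤ |y r| + K * (‖ξ‖ + 1) := (abs_add_le _ _).trans (by gcongr)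
    rw [hF', norm_smul, norm_mul, Real.norm_eq_abs, Real.norm_eq_abs]
    calc |ρ' (y r + ℓ r ζ)| * |z r| * ‖ℓ r‖ ≤ C * (1 + |y r + ℓ r ζ|) ^ q * K' * K := by
          gcongr
          · exact hC' _
          · exact hzK r
          · exact hℓ r
      _ ≤ C * (1 + (|y r| + K * (‖ξ‖ + 1))) ^ q * K' * K := by gcongr
      _ = _ := by ring
  have hbint : Integrable (fun r => C * K' * K * (1 + (|y r| + K * (‖ξ‖ + 1))) ^ q) unitVol :=
    (integrable_one_add_rpow hq hy _ (by positivity)).const_mul _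
  have key := hasFDerivAt_integral_of_dominated_of_fderiv_le (μ := unitVol)
    (F := fun ξ r => ρ (y r + ℓ r ξ) * z r) (F' := F') (x₀ := ξ)
    (Metric.ball_mem_nhds ξ one_pos)
    (Eventually.of_forall fun ζ =>
      (integrable_comp_of_growth hq hy hℓm hℓ hρc hC hz hzK ζ).aestronglyMeasurable)
    (integrable_comp_of_growth hq hy hℓm hℓ hρc hC hz hzK ξ) hm'
    (Eventually.of_forall hbound) hbint
    (Eventually.of_forall fun r ζ _ => by
      have h1 : HasFDerivAt (fun ζ => y r + ℓ r ζ) (ℓ r) ζ := (ℓ r).hasFDerivAt.const_add _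
      have h2 := ((hρ _).comp_hasFDerivAt ζ h1).mul_const (z r)
      refine h2.congr_fderiv ?_
      rw [hF', smul_smul, mul_comm])
  refine ⟨_, key, fun a => ?_⟩
  have hint : Integrable (F' ξ) unitVol :=
    hbint.mono' hm' (Eventually.of_forall fun r => hbound r ξ (Metric.mem_ball_self one_pos))
  rw [ContinuousLinearMap.integral_apply hint]
  refine integral_congr_ae (Eventually.of_forall fun r => ?_)
  simp only [hF', smul_apply, smul_eq_mul]
  ring

end Parametric

/-! ### Closed formulas for the Lyapunov function and its first two derivatives. -/

/-- The coefficient of the `L^q` part of the Lyapunov function. -/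
noncomputable def lqCoeff (q : ℝ) : ℝ := if q = 2 then 0 else 1

lemma lqCoeff_nonneg (q : ℝ) : 0 ≤ lqCoeff q := by
  rw [lqCoeff]; split_ifs <;> norm_num

/-- The Lyapunov function of a representative. -/
noncomputable def lyap (q κ : ℝ) (f : ℝ → ℝ) : ℝ :=
  Real.exp (κ * ∫ r, f r ^ 2 ∂unitVol) * (1 + lqCoeff q * ∫ r, |f r| ^ q ∂unitVol)

/-- The first derivative of the Lyapunov function. -/
noncomputable def dlyap (q κ : ℝ) (f a : ℝ → ℝ) : ℝ :=
  Real.exp (κ * ∫ r, f r ^ 2 ∂unitVol) *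
    (2 * κ * (∫ r, f r * a r ∂unitVol) * (1 + lqCoeff q * ∫ r, |f r| ^ q ∂unitVol) +
      lqCoeff q * q * ∫ r, oddPow q (f r) * a r ∂unitVol)

/-- The second derivative of the Lyapunov function. -/
noncomputable def ddlyap (q κ : ℝ) (f a b : ℝ → ℝ) : ℝ :=
  Real.exp (κ * ∫ r, f r ^ 2 ∂unitVol) *
    (2 * κ * (∫ r, f r * b r ∂unitVol) *
      (2 * κ * (∫ r, f r * a r ∂unitVol) * (1 + lqCoeff q * ∫ r, |f r| ^ q ∂unitVol) +
        lqCoeff q * q * ∫ r, oddPow q (f r) * a r ∂unitVol) +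
    2 * κ * (∫ r, a r * b r ∂unitVol) * (1 + lqCoeff q * ∫ r, |f r| ^ q ∂unitVol) +
    2 * κ * (∫ r, f r * a r ∂unitVol) * (lqCoeff q * q * ∫ r, oddPow q (f r) * b r ∂unitVol) +
    lqCoeff q * q * (q - 1) * ∫ r, |f r| ^ (q - 2) * (a r * b r) ∂unitVol)

section LyapDeriv

variable {B : Type*} [NormedAddCommGroup B] [NormedSpace ℝ B] {q : ℝ} {y : ℝ → ℝ}
  {ℓ : ℝ → B →L[ℝ] ℝ} {K : ℝ}

lemma hasFDerivAt_integral_sq (hq : 2 ≤ q) (hy : MemLp y (ENNReal.ofReal q) unitVol)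
    (hℓm : AEStronglyMeasurable ℓ unitVol) (hℓ : ∀ r, ‖ℓ r‖ ≤ K) (ξ : B) :
    ∃ T : B →L[ℝ] ℝ, HasFDerivAt (fun ξ => ∫ r, (y r + ℓ r ξ) ^ 2 ∂unitVol) T ξ ∧
      ∀ a, T a = 2 * ∫ r, (y r + ℓ r ξ) * ℓ r a ∂unitVol := by
  have h2 : ∀ s : ℝ, |s| ^ (2 : ℝ) ≤ (1 + |s|) ^ q := fun s =>
    abs_rpow_le_one_add (by norm_num) hq s
  have h1 : ∀ s : ℝ, |s| ^ (1 : ℝ) ≤ (1 + |s|) ^ q := fun s =>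
    abs_rpow_le_one_add (by norm_num) (by linarith) s
  obtain ⟨T, hT, hTa⟩ := hasFDerivAt_integral_comp (ρ := fun s => s ^ 2) (ρ' := fun s => 2 * s)
    (C := 2) (z := fun _ => 1) (K' := 1) hq hy hℓm hℓ
    (fun s => by simpa using hasDerivAt_pow 2 s) (by fun_prop)
    (fun s => by
      have := h2 s
      rw [Real.rpow_two] at this
      rw [abs_pow]
      have : 0 ≤ |s| ^ 2 := by positivity
      linarith)
    (fun s => by
      have := h1 s
      rw [Real.rpow_one] at this
      rw [abs_mul, abs_two]
      linarith) aestronglyMeasurable_const (by simp) ξ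
  refine ⟨T, by simpa using hT, fun a => ?_⟩
  rw [hTa, ← integral_const_mul]
  simp only [one_mul, mul_assoc]

lemma hasFDerivAt_integral_mul (hq : 2 ≤ q) (hy : MemLp y (ENNReal.ofReal q) unitVol)
    (hℓm : AEStronglyMeasurable ℓ unitVol) (hℓ : ∀ r, ‖ℓ r‖ ≤ K) (a ξ : B) :
    ∃ T : B →L[ℝ] ℝ, HasFDerivAt (fun ξ => ∫ r, (y r + ℓ r ξ) * ℓ r a ∂unitVol) T ξ ∧
      ∀ b, T b = ∫ r, ℓ r a * ℓ r b ∂unitVol := by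
  have h0 : ∀ s : ℝ, |s| ^ (0 : ℝ) ≤ (1 + |s|) ^ q := fun s =>
    abs_rpow_le_one_add le_rfl (by linarith) s
  have h1 : ∀ s : ℝ, |s| ^ (1 : ℝ) ≤ (1 + |s|) ^ q := fun s =>
    abs_rpow_le_one_add (by norm_num) (by linarith) s
  obtain ⟨T, hT, hTa⟩ := hasFDerivAt_integral_comp (ρ := fun s => s) (ρ' := fun _ => 1)
    (C := 1) (z := fun r => ℓ r a) (K' := K * ‖a‖) hq hy hℓm hℓ
    (fun s => hasDerivAt_id' s) continuous_const
    (fun s => by simpa using h1 s) (fun s => by simpa using h0 s)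
    (hℓm.apply_continuousLinearMap a)
    (fun r => ((ℓ r).le_opNorm a).trans (by gcongr; exact hℓ r)) ξ
  refine ⟨T, hT, fun b => ?_⟩
  rw [hTa]
  simp only [one_mul]

lemma hasFDerivAt_integral_abs_rpow (hq : 2 ≤ q) (hy : MemLp y (ENNReal.ofReal q) unitVol)
    (hℓm : AEStronglyMeasurable ℓ unitVol) (hℓ : ∀ r, ‖ℓ r‖ ≤ K) (ξ : B) :
    ∃ T : B →L[ℝ] ℝ, HasFDerivAt (fun ξ => ∫ r, |y r + ℓ r ξ| ^ q ∂unitVol) T ξ ∧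
      ∀ a, T a = q * ∫ r, oddPow q (y r + ℓ r ξ) * ℓ r a ∂unitVol := by
  obtain ⟨T, hT, hTa⟩ := hasFDerivAt_integral_comp (ρ := fun s => |s| ^ q)
    (ρ' := fun s => q * oddPow q s)
    (C := q) (z := fun _ => 1) (K' := 1) hq hy hℓm hℓ
    (fun s => hasDerivAt_abs_rpow_oddPow (by linarith) s)
    (continuous_const.mul (continuous_oddPow hq))
    (fun s => by
      have h1 := abs_rpow_le_one_add (a := q) (by linarith) le_rfl s
      rw [Real.abs_rpow_of_nonneg (abs_nonneg s), abs_abs]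
      have h2 : 0 ≤ |s| ^ q := by positivity
      nlinarith)
    (fun s => by
      have h1 := abs_rpow_le_one_add (a := q - 1) (q := q) (by linarith) (by linarith) s
      rw [abs_mul, abs_of_nonneg (by linarith : (0 : ℝ) ≤ q), abs_oddPow (by linarith)]
      gcongr) aestronglyMeasurable_const (by simp) ξ
  refine ⟨T, by simpa using hT, fun a => ?_⟩
  rw [hTa, ← integral_const_mul]
  simp only [one_mul, mul_assoc]

lemma hasFDerivAt_integral_oddPow (hq : 2 ≤ q) (hy : MemLp y (ENNReal.ofReal q) unitVol)
    (hℓm : AEStronglyMeasurable ℓ unitVol) (hℓ : ∀ r, ‖ℓ r‖ ≤ K) (a ξ : B) :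
    ∃ T : B →L[ℝ] ℝ, HasFDerivAt (fun ξ => ∫ r, oddPow q (y r + ℓ r ξ) * ℓ r a ∂unitVol) T ξ ∧
      ∀ b, T b = (q - 1) * ∫ r, |y r + ℓ r ξ| ^ (q - 2) * (ℓ r a * ℓ r b) ∂unitVol := by
  obtain ⟨T, hT, hTa⟩ := hasFDerivAt_integral_comp (ρ := oddPow q)
    (ρ' := fun s => (q - 1) * |s| ^ (q - 2))
    (C := q - 1) (z := fun r => ℓ r a) (K' := K * ‖a‖) hq hy hℓm hℓ
    (fun s => hasDerivAt_oddPow hq s)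
    (continuous_const.mul (continuous_abs.rpow_const fun _ => Or.inr (by linarith)))
    (fun s => by
      have h1 := abs_rpow_le_one_add (a := q - 1) (q := q) (by linarith) (by linarith) s
      rw [abs_oddPow (by linarith)]
      have h2 : 0 ≤ |s| ^ (q - 1) := by positivity
      nlinarith)
    (fun s => by
      have h1 := abs_rpow_le_one_add (a := q - 2) (q := q) (by linarith) (by linarith) s
      rw [abs_mul, abs_of_nonneg (by linarith : (0 : ℝ) ≤ q - 1),
        Real.abs_rpow_of_nonneg (abs_nonneg s), abs_abs]
      gcongr
      linarith)
    (hℓm.apply_continuousLinearMap a)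
    (fun r => ((ℓ r).le_opNorm a).trans (by gcongr; exact hℓ r)) ξ
  refine ⟨T, hT, fun b => ?_⟩
  rw [hTa, ← integral_const_mul]
  simp only [mul_assoc]

lemma hasFDerivAt_lyap (hq : 2 ≤ q) (κ : ℝ) (hy : MemLp y (ENNReal.ofReal q) unitVol)
    (hℓm : AEStronglyMeasurable ℓ unitVol) (hℓ : ∀ r, ‖ℓ r‖ ≤ K) (ξ : B) :
    ∃ T : B →L[ℝ] ℝ, HasFDerivAt (fun ξ => lyap q κ fun r => y r + ℓ r ξ) T ξ ∧
      ∀ a, T a = dlyap q κ (fun r => y r + ℓ r ξ) fun r => ℓ r a := by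
  obtain ⟨T₁, hT₁, h₁⟩ := hasFDerivAt_integral_sq hq hy hℓm hℓ ξ
  obtain ⟨T₂, hT₂, h₂⟩ := hasFDerivAt_integral_abs_rpow hq hy hℓm hℓ ξ
  have h := (hT₁.const_mul κ).exp.mul ((hT₂.const_mul (lqCoeff q)).const_add 1)
  refine ⟨_, h, fun a => ?_⟩
  simp only [add_apply, smul_apply, smul_eq_mul, h₁, h₂,
    dlyap]
  ring

lemma hasFDerivAt_dlyap (hq : 2 ≤ q) (κ : ℝ) (hy : MemLp y (ENNReal.ofReal q) unitVol)
    (hℓm : AEStronglyMeasurable ℓ unitVol) (hℓ : ∀ r, ‖ℓ r‖ ≤ K) (a ξ : B) :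
    ∃ T : B →L[ℝ] ℝ, HasFDerivAt
      (fun ξ => dlyap q κ (fun r => y r + ℓ r ξ) fun r => ℓ r a) T ξ ∧
      ∀ b, T b = ddlyap q κ (fun r => y r + ℓ r ξ) (fun r => ℓ r a) fun r => ℓ r b := by
  obtain ⟨T₁, hT₁, h₁⟩ := hasFDerivAt_integral_sq hq hy hℓm hℓ ξ
  obtain ⟨T₂, hT₂, h₂⟩ := hasFDerivAt_integral_abs_rpow hq hy hℓm hℓ ξ
  obtain ⟨T₃, hT₃, h₃⟩ := hasFDerivAt_integral_mul hq hy hℓm hℓ a ξ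
  obtain ⟨T₄, hT₄, h₄⟩ := hasFDerivAt_integral_oddPow hq hy hℓm hℓ a ξ
  have h := (hT₁.const_mul κ).exp.mul
    (((hT₃.const_mul (2 * κ)).mul ((hT₂.const_mul (lqCoeff q)).const_add 1)).add
      (hT₄.const_mul (lqCoeff q * q)))
  refine ⟨_, h, fun b => ?_⟩
  simp only [add_apply, smul_apply, smul_eq_mul, h₁, h₂,
    h₃, h₄, ddlyap, Pi.add_apply, Pi.mul_apply]
  ring

end LyapDeriv

/-! ### The Lyapunov function evaluated on representatives. -/

lemma memLp_of_mem_Xp {q : ℝ} (hq : 2 ≤ q) {x : X} (hx : x ∈ Xp q) :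
    MemLp x (ENNReal.ofReal q) unitVol := by
  refine ⟨(Lp.memLp x).1, ?_⟩
  rw [eLpNorm_lt_top_iff_lintegral_rpow_enorm_lt_top (by simp; linarith) ENNReal.ofReal_ne_top,
    ENNReal.toReal_ofReal (by linarith)]
  exact hx

lemma mem_Xp_of_memLp {q : ℝ} (hq : 2 ≤ q) {x : X} {f : ℝ → ℝ} (hxf : x =ᵐ[unitVol] f)
    (hf : MemLp f (ENNReal.ofReal q) unitVol) : x ∈ Xp q := by
  have h := ((memLp_congr_ae hxf).mpr hf).2
  rw [eLpNorm_lt_top_iff_lintegral_rpow_enorm_lt_top (by simp; linarith) ENNReal.ofReal_ne_top,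
    ENNReal.toReal_ofReal (by linarith)] at h
  exact h

lemma norm_sq_eq_integral (x : X) : ‖x‖ ^ 2 = ∫ r, x r ^ 2 ∂unitVol := by
  rw [← real_inner_self_eq_norm_sq, inner_X_eq]
  simp only [sq]

lemma expW_eq {x : X} {f : ℝ → ℝ} (hxf : x =ᵐ[unitVol] f) (κ : ℝ) :
    expW κ x = Real.exp (κ * ∫ r, f r ^ 2 ∂unitVol) := by
  rw [expW, norm_sq_eq_integral]
  congr 2
  exact integral_congr_ae (hxf.mono fun r hr => by simp only [hr])

/-- `lqCoeff` unifies the cases q = 2 and q > 2 in one real formula, so that differentiation and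
limits need no case distinction. -/
lemma toReal_V {q : ℝ} (hq : 2 ≤ q) (κ : ℝ) {x : X} {f : ℝ → ℝ} (hxf : x =ᵐ[unitVol] f)
    (hf : MemLp f (ENNReal.ofReal q) unitVol) : (V q κ x).toReal = lyap q κ f := by
  rw [V, lyap, ← expW_eq hxf, lqCoeff]
  split_ifs with h
  · rw [ENNReal.toReal_ofReal (expW_pos κ x).le]; ring
  · have hx : lpPow q x ≠ ⊤ := (mem_Xp_of_memLp hq hxf hf).ne
    rw [ENNReal.toReal_mul, ENNReal.toReal_ofReal (expW_pos κ x).le,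
      ENNReal.toReal_add ENNReal.one_ne_top hx, ENNReal.toReal_one, one_mul,
      lpPow_eq_lintegral_ofReal (by linarith)]
    congr 2
    rw [← integral_eq_lintegral_of_nonneg_ae (Eventually.of_forall fun r => by positivity)]
    · exact integral_congr_ae (hxf.mono fun r hr => by simp only [hr])
    · exact ((Lp.memLp x).1.aemeasurable.abs.pow_const q).aestronglyMeasurable

/-! ### Continuously differentiable functions with Dirichlet boundary values -/

/-- `y` is continuously differentiable with derivative `y'` and vanishes at `0` and `1`. -/
structure IsDirichlet (y y' : ℝ → ℝ) : Prop where
  hasDerivAt : ∀ r, HasDerivAt y (y' r) r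
  continuous_deriv : Continuous y'
  zero : y 0 = 0
  one : y 1 = 0

lemma IsDirichlet.continuous {y y' : ℝ → ℝ} (h : IsDirichlet y y') : Continuous y :=
  continuous_iff_continuousAt.mpr fun r => (h.hasDerivAt r).continuousAt

/-- Only one factor has to vanish at the endpoints; the other may be a cosine polynomial. -/
lemma integral_mul_deriv_eq_neg {y y' w w' : ℝ → ℝ} (h : IsDirichlet y y')
    (hw : ∀ r, HasDerivAt w (w' r) r) (hw' : Continuous w') :
    ∫ r, y r * w' r ∂unitVol = -∫ r, y' r * w r ∂unitVol := by
  rw [integral_unitVol_eq, integral_unitVol_eq,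
    intervalIntegral.integral_mul_deriv_eq_deriv_mul (fun r _ => h.hasDerivAt r) (fun r _ => hw r)
      (h.continuous_deriv.intervalIntegrable _ _) (hw'.intervalIntegrable _ _), h.zero, h.one]
  ring

lemma hasWeakDeriv_of_hasDerivAt {y y' : ℝ → ℝ} (h : ∀ r, HasDerivAt y (y' r) r)
    (h' : Continuous y') : HasWeakDeriv y y' := by
  have hc : Continuous y := continuous_iff_continuousAt.mpr fun r => (h r).continuousAt
  refine ⟨hc.locallyIntegrable.locallyIntegrableOn _, h'.locallyIntegrable.locallyIntegrableOn _,
    fun φ hφ hφc hφs => ?_⟩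
  have hφ0 : φ 0 = 0 := image_eq_zero_of_notMem_tsupport fun h => absurd (hφs h).1 (lt_irrefl _)
  have hφ1 : φ 1 = 0 := image_eq_zero_of_notMem_tsupport fun h => absurd (hφs h).2 (lt_irrefl _)
  have hd : IsDirichlet φ (deriv φ) :=
    ⟨fun r => (hφ.differentiable (by simp) r).hasDerivAt, hφ.continuous_deriv (by simp), hφ0, hφ1⟩
  have key := integral_mul_deriv_eq_neg hd h h'
  simp only [mul_comm (y _), mul_comm (y' _)]
  linarith

lemma HasWeakDeriv.congr {f₁ f₂ g : ℝ → ℝ} (h : f₁ =ᵐ[unitVol] f₂) (hf : HasWeakDeriv f₂ g) :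
    HasWeakDeriv f₁ g := by
  refine ⟨hf.1.congr h.symm, hf.2.1, fun φ hφ hφc hφs => ?_⟩
  rw [← hf.2.2 φ hφ hφc hφs]
  exact integral_congr_ae (h.mono fun r hr => by simp only [hr])

lemma mem_H01_of_isDirichlet {x : X} {y y' : ℝ → ℝ} (h : IsDirichlet y y')
    (hx : x =ᵐ[unitVol] y) : x ∈ H01 :=
  ⟨⟨y', memLp_of_continuous h.continuous_deriv 2,
    (hasWeakDeriv_of_hasDerivAt h.hasDerivAt h.continuous_deriv).congr hx⟩,
    y, h.continuous.continuousOn, h.zero, h.one, hx⟩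

lemma eLpNorm_two_sq {f : ℝ → ℝ} (hf : Continuous f) :
    eLpNorm f 2 unitVol ^ 2 = ENNReal.ofReal (∫ r, f r ^ 2 ∂unitVol) := by
  have hm := memLp_of_continuous hf 2
  have h1 : ‖hm.toLp f‖ ^ 2 = ∫ r, f r ^ 2 ∂unitVol := by
    rw [← real_inner_self_eq_norm_sq, inner_toLp_toLp]
    simp only [sq]
  rw [← h1, ENNReal.ofReal_pow (norm_nonneg _), Lp.norm_toLp, ENNReal.ofReal_toReal hm.2.ne]

lemma derivNorm_sq_of_hasDerivAt {f y y' : ℝ → ℝ} (h : ∀ r, HasDerivAt y (y' r) r)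
    (h' : Continuous y') (hf : f =ᵐ[unitVol] y) :
    derivNorm f ^ 2 = ENNReal.ofReal (∫ r, y' r ^ 2 ∂unitVol) := by
  rw [derivNorm_eq ((hasWeakDeriv_of_hasDerivAt h h').congr hf), eLpNorm_two_sq h']

/-- Needed at the exponent q/2, which can lie in (1,2), where |s|^{p-2} is singular at 0. Continuity
is therefore read off from the fact that |s|^p is C¹. -/
lemma continuous_oddPow_of_one_lt {p : ℝ} (hp : 1 < p) : Continuous (oddPow p) := by
  have h1 : ContDiff ℝ 1 fun s : ℝ => ‖s‖ ^ p := contDiff_norm_rpow hp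
  have h2 : Continuous (deriv fun s : ℝ => ‖s‖ ^ p) := h1.continuous_deriv le_rfl
  have h3 : deriv (fun s : ℝ => ‖s‖ ^ p) = fun s => p * oddPow p s := by
    funext s
    exact (hasDerivAt_abs_rpow_oddPow hp s).deriv
  rw [h3] at h2
  have h4 : oddPow p = fun s => p⁻¹ * (p * oddPow p s) := by
    funext s
    field_simp
  rw [h4]
  exact continuous_const.mul h2

/-- The coercivity weight of a representative. -/
noncomputable def coercive (q κ : ℝ) (f f' : ℝ → ℝ) : ℝ :=
  lyap q κ f * (1 + ∫ r, f' r ^ 2 ∂unitVol) +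
    lqCoeff q * (Real.exp (κ * ∫ r, f r ^ 2 ∂unitVol) *
      ((q / 2) ^ 2 * ∫ r, |f r| ^ (q - 2) * (f' r * f' r) ∂unitVol))

lemma lyap_nonneg (q κ : ℝ) (f : ℝ → ℝ) : 0 ≤ lyap q κ f := by
  have h1 : 0 ≤ ∫ r, |f r| ^ q ∂unitVol := integral_nonneg fun r => by positivity
  have := lqCoeff_nonneg q
  rw [lyap]
  positivity

/-- For q > 2 the exponent q/2 exceeds 1, so |y|^{q/2} is C¹ and the square of its derivative is
(q/2)² |y|^{q-2} y'². -/
lemma Theta_eq_ofReal {q : ℝ} (hq : 2 ≤ q) (κ : ℝ) {x : X} {y y' : ℝ → ℝ} (h : IsDirichlet y y')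
    (hx : x =ᵐ[unitVol] y) : Θ q κ x = ENNReal.ofReal (coercive q κ y y') := by
  have hmem := mem_H01_of_isDirichlet h hx
  have hLq := memLp_of_continuous h.continuous (ENNReal.ofReal q)
  have hV : V q κ x = ENNReal.ofReal (lyap q κ y) := by
    rw [← toReal_V hq κ hx hLq, ENNReal.ofReal_toReal]
    exact (V_ne_top_iff hq x).mpr (mem_Xp_of_memLp hq hx hLq)
  have h0 : 0 ≤ ∫ r, y' r ^ 2 ∂unitVol := integral_nonneg fun r => sq_nonneg _
  have hfirst : V q κ x * (1 + derivNorm x ^ 2) =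
      ENNReal.ofReal (lyap q κ y * (1 + ∫ r, y' r ^ 2 ∂unitVol)) := by
    rw [hV, derivNorm_sq_of_hasDerivAt h.hasDerivAt h.continuous_deriv hx, ← ENNReal.ofReal_one,
      ← ENNReal.ofReal_add zero_le_one h0, ← ENNReal.ofReal_mul (lyap_nonneg _ _ _)]
  rw [Θ, if_pos hmem, hfirst, coercive, lqCoeff]
  split_ifs with h2
  · simp
  · have hq2 : 1 < q / 2 := by
      have : 2 < q := lt_of_le_of_ne hq (Ne.symm h2)
      linarith
    have hd : ∀ r, HasDerivAt (fun r => |y r| ^ (q / 2)) (q / 2 * oddPow (q / 2) (y r) * y' r) r :=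
      fun r => (hasDerivAt_abs_rpow_oddPow hq2 (y r)).comp r (h.hasDerivAt r)
    have hdc : Continuous fun r => q / 2 * oddPow (q / 2) (y r) * y' r :=
      (continuous_const.mul ((continuous_oddPow_of_one_lt hq2).comp h.continuous)).mul
        h.continuous_deriv
    have hae : (fun r => |x r| ^ (q / 2)) =ᵐ[unitVol] fun r => |y r| ^ (q / 2) :=
      hx.mono fun r hr => by simp only [hr]
    have hsq : ∀ r, (q / 2 * oddPow (q / 2) (y r) * y' r) ^ 2 =
        (q / 2) ^ 2 * (|y r| ^ (q - 2) * (y' r * y' r)) := by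
      intro r
      have e : oddPow (q / 2) (y r) ^ 2 = |y r| ^ (q - 2) := by
        rw [← sq_abs, abs_oddPow hq2, ← Real.rpow_natCast, ← Real.rpow_mul (abs_nonneg _)]
        congr 1
        push_cast
        ring
      rw [mul_pow, mul_pow, e]
      ring
    rw [derivNorm_sq_of_hasDerivAt hd hdc hae, expW_eq hx, ← ENNReal.ofReal_mul (Real.exp_pos _).le,
      ← ENNReal.ofReal_add]
    · simp only [hsq]
      rw [integral_const_mul, one_mul]
    · exact mul_nonneg (lyap_nonneg _ _ _) (by positivity)
    · exact mul_nonneg (Real.exp_pos _).le (integral_nonneg fun r => sq_nonneg _)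

lemma coercive_nonneg (q κ : ℝ) (f f' : ℝ → ℝ) : 0 ≤ coercive q κ f f' := by
  have h1 : 0 ≤ ∫ r, f' r ^ 2 ∂unitVol := integral_nonneg fun r => sq_nonneg _
  have h2 : 0 ≤ ∫ r, |f r| ^ (q - 2) * (f' r * f' r) ∂unitVol :=
    integral_nonneg fun r => mul_nonneg (by positivity) (mul_self_nonneg _)
  have := lqCoeff_nonneg q
  have := lyap_nonneg q κ f
  rw [coercive]
  positivity

/-! ### Regularity of solutions of the Euler-Lagrange equation -/

/-- The scalar map s ↦ αs + β|s|^{q-2}s has derivative at least α > 0 and is unbounded in both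
directions, so it is a bijection of ℝ with C¹ inverse. -/
lemma exists_inverse_add_oddPow {q α β : ℝ} (hq : 2 ≤ q) (hα : 0 < α) (hβ : 0 ≤ β) :
    ∃ ψ ψ' : ℝ → ℝ, (∀ s, HasDerivAt ψ (ψ' s) s) ∧ Continuous ψ' ∧
      (∀ s, α * ψ s + β * oddPow q (ψ s) = s) ∧ ∀ s, ψ (α * s + β * oddPow q s) = s := by
  set φ : ℝ → ℝ := fun s => α * s + β * oddPow q s with hφ
  set φ' : ℝ → ℝ := fun s => α + β * ((q - 1) * |s| ^ (q - 2)) with hφ'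
  have hd : ∀ s, HasDerivAt φ (φ' s) s := fun s =>
    (((hasDerivAt_id' s).const_mul α).add ((hasDerivAt_oddPow hq s).const_mul β)).congr_deriv
      (by simp [hφ'])
  have hpos : ∀ s, α ≤ φ' s := by
    intro s
    have : 0 ≤ β * ((q - 1) * |s| ^ (q - 2)) :=
      mul_nonneg hβ (mul_nonneg (by linarith) (by positivity))
    simp only [hφ']
    linarith
  have hφ'c : Continuous φ' := continuous_const.add (continuous_const.mul
    (continuous_const.mul (continuous_abs.rpow_const fun _ => Or.inr (by linarith))))
  have hφc : Continuous φ := continuous_iff_continuousAt.mpr fun s => (hd s).continuousAt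
  have hmono : StrictMono φ := strictMono_of_deriv_pos fun s => by
    rw [(hd s).deriv]; exact hα.trans_le (hpos s)
  have hsgn : ∀ s, 0 ≤ s → α * s ≤ φ s := by
    intro s hs
    have : 0 ≤ β * oddPow q s := mul_nonneg hβ (mul_nonneg (by positivity) hs)
    simp only [hφ]; linarith
  have hsgn' : ∀ s, s ≤ 0 → φ s ≤ α * s := by
    intro s hs
    have : β * oddPow q s ≤ 0 :=
      mul_nonpos_of_nonneg_of_nonpos hβ (mul_nonpos_of_nonneg_of_nonpos (by positivity) hs)
    simp only [hφ]; linarith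
  have htop : Tendsto φ atTop atTop :=
    tendsto_atTop_mono' _ ((eventually_ge_atTop 0).mono hsgn) (tendsto_id.const_mul_atTop hα)
  have hbot : Tendsto φ atBot atBot :=
    tendsto_atBot_mono' _ ((eventually_le_atBot 0).mono hsgn') (tendsto_id.const_mul_atBot hα)
  have hsurj : Function.Surjective φ := hφc.surjective htop hbot
  set e : ℝ ≃o ℝ := hmono.orderIsoOfSurjective φ hsurj with he
  have hright : ∀ s, φ (e.symm s) = s := fun s => e.apply_symm_apply s
  have hleft : ∀ s, e.symm (φ s) = s := fun s => e.symm_apply_apply s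
  have hec : Continuous e.symm := e.symm.continuous
  refine ⟨e.symm, fun s => (φ' (e.symm s))⁻¹, fun s => ?_, ?_, hright, hleft⟩
  · exact (hd _).of_local_left_inverse hec.continuousAt (hα.trans_le (hpos _)).ne'
      (Eventually.of_forall hright)
  · exact (hφ'c.comp hec).inv₀ fun s => (hα.trans_le (hpos _)).ne'

/-- The equation is algebraic at each point, so regularity comes from composing `e` with the C¹
inverse. The inverse fixes 0, which carries the boundary values over. -/
lemma exists_isDirichlet_of_eq {q α β : ℝ} (hq : 2 ≤ q) (hα : 0 < α) (hβ : 0 ≤ β) {x e e' : ℝ → ℝ}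
    (he : IsDirichlet e e') (hx : ∀ᵐ r ∂unitVol, α * x r + β * oddPow q (x r) = e r) :
    ∃ y y' : ℝ → ℝ, IsDirichlet y y' ∧ x =ᵐ[unitVol] y ∧
      ∀ r, α * y r + β * oddPow q (y r) = e r := by
  obtain ⟨ψ, ψ', hd, hc, hr, hl⟩ := exists_inverse_add_oddPow hq hα hβ
  have h0 : ψ 0 = 0 := by
    have := hl 0
    simpa [oddPow] using this
  have hψc : Continuous ψ := continuous_iff_continuousAt.mpr fun s => (hd s).continuousAt
  refine ⟨fun r => ψ (e r), fun r => ψ' (e r) * e' r, ⟨fun r => ?_, ?_, ?_, ?_⟩, ?_, fun r => hr _⟩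
  · exact (hd _).comp r (he.hasDerivAt r)
  · exact (hc.comp he.continuous).mul he.continuous_deriv
  · simp only [he.zero, h0]
  · simp only [he.one, h0]
  · filter_upwards [hx] with r h
    rw [← h, hl]

/-! ### Sine polynomials -/

/-- The sine polynomial with coefficients `a`. -/
noncomputable def sinePoly (n : ℕ) (a : ℕ → ℝ) (r : ℝ) : ℝ := ∑ k ∈ Finset.range n, a k * etaFun k r

/-- The derivative of a sine polynomial. -/
noncomputable def sinePolyDeriv (n : ℕ) (a : ℕ → ℝ) (r : ℝ) : ℝ :=
  ∑ k ∈ Finset.range n, a k * (Real.pi * (k + 1) * cosFun (k + 1) r)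

lemma hasDerivAt_etaFun (k : ℕ) (r : ℝ) :
    HasDerivAt (etaFun k) (Real.pi * (k + 1) * cosFun (k + 1) r) r := by
  have h := ((hasDerivAt_id' r).const_mul (Real.pi * (k + 1))).sin.const_mul √2
  refine h.congr_deriv ?_
  simp only [cosFun, Nat.add_eq_zero_iff, one_ne_zero, and_false, if_false, Nat.cast_add,
    Nat.cast_one]
  ring

lemma hasDerivAt_cosFun (k : ℕ) (r : ℝ) :
    HasDerivAt (cosFun (k + 1)) (-(Real.pi * (k + 1)) * etaFun k r) r := by
  have h := ((hasDerivAt_id' r).const_mul (Real.pi * ((k + 1 : ℕ) : ℝ))).cos.const_mul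
    (if k + 1 = 0 then (1 : ℝ) else √2)
  refine h.congr_deriv ?_
  simp only [etaFun, Nat.cast_add, Nat.cast_one, Nat.add_eq_zero_iff, one_ne_zero, and_false,
    if_false]
  ring

lemma etaFun_zero (k : ℕ) : etaFun k 0 = 0 := by simp [etaFun]

lemma etaFun_one (k : ℕ) : etaFun k 1 = 0 := by
  have := Real.sin_nat_mul_pi (k + 1)
  rw [mul_comm, Nat.cast_add, Nat.cast_one] at this
  simp [etaFun, this]

lemma continuous_sinePoly (n : ℕ) (a : ℕ → ℝ) : Continuous (sinePoly n a) :=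
  continuous_finsetSum _ fun k _ => continuous_const.mul (continuous_etaFun k)

lemma isDirichlet_sinePoly (n : ℕ) (a : ℕ → ℝ) :
    IsDirichlet (sinePoly n a) (sinePolyDeriv n a) := by
  refine ⟨fun r => ?_, ?_, ?_, ?_⟩
  · exact HasDerivAt.fun_sum fun k _ => (hasDerivAt_etaFun k r).const_mul (a k)
  · exact continuous_finsetSum _ fun k _ => continuous_const.mul
      (continuous_const.mul (continuous_cosFun _))
  · simp [sinePoly, etaFun_zero]
  · simp [sinePoly, etaFun_one]

lemma hasDerivAt_sinePolyDeriv (n : ℕ) (a : ℕ → ℝ) (r : ℝ) :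
    HasDerivAt (sinePolyDeriv n a) (sinePoly n (fun k => -(Real.pi * (k + 1)) ^ 2 * a k) r) r := by
  have h : HasDerivAt (sinePolyDeriv n a) (∑ k ∈ Finset.range n,
      a k * (Real.pi * (k + 1) * (-(Real.pi * (k + 1)) * etaFun k r))) r :=
    HasDerivAt.fun_sum fun k _ => ((hasDerivAt_cosFun k r).const_mul _).const_mul (a k)
  refine h.congr_deriv (Finset.sum_congr rfl fun k _ => ?_)
  ring

lemma integral_mul_sinePoly {f : ℝ → ℝ} (hf : MemLp f 2 unitVol) (n : ℕ) (a : ℕ → ℝ) :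
    ∫ r, f r * sinePoly n a r ∂unitVol =
      ∑ k ∈ Finset.range n, a k * ∫ r, f r * etaFun k r ∂unitVol := by
  simp only [sinePoly, Finset.mul_sum]
  rw [integral_finsetSum]
  · refine Finset.sum_congr rfl fun k _ => ?_
    simp only [mul_left_comm (f _)]
    rw [integral_const_mul]
  · intro k _
    have := (hf.integrable_mul (memLp_etaFun k)).const_mul (a k)
    simpa [mul_left_comm] using this

lemma coeFn_incl (n : ℕ) (ξ : E n) :
    incl n ξ =ᵐ[unitVol] fun r => ∑ i : Fin n, ξ i * etaFun i r := by
  rw [incl]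
  have h1 : ∀ i : Fin n, (ξ i • eta i : X) =ᵐ[unitVol] fun r => ξ i * etaFun i r := by
    intro i
    filter_upwards [Lp.coeFn_smul (ξ i) (eta i), coeFn_eta i] with r hr1 hr2
    rw [hr1, Pi.smul_apply, hr2, smul_eq_mul]
  have h2 : (⇑(∑ i : Fin n, ξ i • eta i : X) : ℝ → ℝ) =ᵐ[unitVol] ∑ i : Fin n, ⇑(ξ i • eta i : X) :=
    Lp.coeFn_finsetSum _ _
  filter_upwards [h2, ae_all_iff.mpr h1] with r hr hr1
  rw [hr, Finset.sum_apply]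
  exact Finset.sum_congr rfl fun i _ => hr1 i

lemma coeFn_incl_proj (n : ℕ) (x : X) :
    incl n (proj n x) =ᵐ[unitVol] sinePoly n fun k => inner ℝ x (eta k) := by
  filter_upwards [coeFn_incl n (proj n x)] with r hr
  rw [hr, sinePoly, Finset.sum_range]
  rfl

/-! ### Necessary conditions at a maximum point -/

/-- If d were positive, the second derivative test would make 0 a local minimum too. Then φ is
constant near 0, which forces d = 0. -/
lemma deriv_conditions_of_max {φ φ' : ℝ → ℝ} {d : ℝ} (h : ∀ t, HasDerivAt φ (φ' t) t)
    (h' : HasDerivAt φ' d 0) (hmax : ∀ t, φ t ≤ φ 0) : φ' 0 = 0 ∧ d ≤ 0 := by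
  have hloc : IsLocalMax φ 0 := Eventually.of_forall hmax
  have h0 : φ' 0 = 0 := hloc.hasDerivAt_eq_zero (h 0)
  refine ⟨h0, ?_⟩
  by_contra hd
  rw [not_le] at hd
  have hder : deriv φ = φ' := funext fun t => (h t).deriv
  have hmin : IsLocalMin φ 0 := by
    refine isLocalMin_of_deriv_deriv_pos ?_ ?_ (h 0).continuousAt
    · rw [hder, h'.deriv]; exact hd
    · rw [hder, h0]
  have hconst : φ =ᶠ[𝓝 0] fun _ => φ 0 := by
    filter_upwards [hmin] with t ht
    exact le_antisymm (hmax t) ht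
  have h1 : φ' =ᶠ[𝓝 0] fun _ => 0 := by
    have := hconst.deriv
    rw [hder] at this
    filter_upwards [this] with t ht
    rw [ht, deriv_const]
  have := h1.deriv_eq
  rw [h'.deriv, deriv_const] at this
  exact hd.ne' this

section Variation

variable {q κ c : ℝ} {N : ℕ} {g : E N → ℝ} {x₀ : X}

lemma coeFn_add_smul (x h : X) {f : ℝ → ℝ} (hf : h =ᵐ[unitVol] f) (t : ℝ) :
    (x + t • h : X) =ᵐ[unitVol] fun r => x r + f r * t := by
  filter_upwards [Lp.coeFn_add x (t • h), Lp.coeFn_smul t h, hf] with r h1 h2 h3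
  rw [h1, Pi.add_apply, h2, Pi.smul_apply, h3, smul_eq_mul, mul_comm]

/-- First and second order conditions at a maximum of `u - c V`, along bounded directions. -/
lemma variation_conditions (hq : 2 ≤ q) (hg : ContDiff ℝ 2 g) (hx₀ : x₀ ∈ Xp q)
    (heq : g (proj N x₀) = c * (V q κ x₀).toReal)
    (hle : ∀ x ∈ Xp q, g (proj N x) ≤ c * (V q κ x).toReal)
    {h : ℝ → ℝ} (hh : AEStronglyMeasurable h unitVol) {K : ℝ} (hK : ∀ r, |h r| ≤ K) {hX : X}
    (hhX : hX =ᵐ[unitVol] h) :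
    fderiv ℝ g (proj N x₀) (proj N hX) = c * dlyap q κ x₀ h ∧
      fderiv ℝ (fun ξ => fderiv ℝ g ξ (proj N hX)) (proj N x₀) (proj N hX) ≤
        c * ddlyap q κ x₀ h h := by
  set v : E N := proj N hX with hv
  have hLq := memLp_of_mem_Xp hq hx₀
  -- The line x₀ + t h as an instance of the parametric setting, with parameter t and evaluation
  -- h(r) t. As `h` is bounded, the whole line stays in X_q.
  set ℓ : ℝ → ℝ →L[ℝ] ℝ := fun r => h r • ContinuousLinearMap.id ℝ ℝ with hℓ
  have hℓa : ∀ r t, ℓ r t = h r * t := fun r t => by simp [hℓ]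
  have hℓm : AEStronglyMeasurable ℓ unitVol := hh.smul_const _
  have hℓK : ∀ r, ‖ℓ r‖ ≤ K := fun r => by
    rw [hℓ, norm_smul, ContinuousLinearMap.norm_id, mul_one]; exact hK r
  have hproj : ∀ t : ℝ, proj N (x₀ + t • hX) = proj N x₀ + t • v := by
    intro t
    simp only [← projL_apply, map_add, map_smul, hv]
  have hcurve : ∀ t : ℝ, HasDerivAt (fun t : ℝ => proj N x₀ + t • v) v t := fun t => by
    simpa using ((hasDerivAt_id' t).smul_const v).const_add (proj N x₀)
  have hV : ∀ t : ℝ, (V q κ (x₀ + t • hX)).toReal = lyap q κ fun r => x₀ r + ℓ r t := by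
    intro t
    have hae := coeFn_add_smul x₀ hX hhX t
    refine toReal_V hq κ ?_ ?_
    · simpa only [hℓa] using hae
    · simp only [hℓa]
      refine MemLp.add (f := x₀) (g := fun r => h r * t) hLq ?_
      refine MemLp.of_bound (hh.mul_const t) (K * |t|) (Eventually.of_forall fun r => ?_)
      rw [norm_mul, Real.norm_eq_abs, Real.norm_eq_abs]
      have := hK r
      gcongr
  have hmem : ∀ t : ℝ, x₀ + t • hX ∈ Xp q := by
    intro t
    refine mem_Xp_of_memLp hq (coeFn_add_smul x₀ hX hhX t) ?_
    refine MemLp.add (f := x₀) (g := fun r => h r * t) hLq ?_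
    refine MemLp.of_bound (hh.mul_const t) (K * |t|) (Eventually.of_forall fun r => ?_)
    rw [norm_mul, Real.norm_eq_abs, Real.norm_eq_abs]
    have := hK r
    gcongr
  have hℓ1 : (fun r => ℓ r 1) = h := by funext r; simp [hℓa]
  have hφ : ∀ t, HasDerivAt (fun t : ℝ => g (proj N x₀ + t • v) -
      c * lyap q κ fun r => x₀ r + ℓ r t)
      (fderiv ℝ g (proj N x₀ + t • v) v - c * dlyap q κ (fun r => x₀ r + ℓ r t) h) t := by
    intro t
    have h1 := ((hg.differentiable (by norm_num)) (proj N x₀ + t • v)).hasFDerivAt.comp_hasDerivAt t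
      (hcurve t)
    obtain ⟨T, hT, hTa⟩ := hasFDerivAt_lyap hq κ hLq hℓm hℓK t
    have h2 := hT.hasDerivAt
    rw [hTa, hℓ1] at h2
    exact h1.sub (h2.const_mul c)
  have hφ' : HasDerivAt (fun t : ℝ => fderiv ℝ g (proj N x₀ + t • v) v -
      c * dlyap q κ (fun r => x₀ r + ℓ r t) h)
      (fderiv ℝ (fun ξ => fderiv ℝ g ξ v) (proj N x₀ + (0 : ℝ) • v) v -
        c * ddlyap q κ (fun r => x₀ r + ℓ r 0) h h) 0 := by
    have h1 := (((contDiff_fderiv_apply hg v).differentiable (by norm_num))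
      (proj N x₀ + (0 : ℝ) • v)).hasFDerivAt.comp_hasDerivAt 0 (hcurve 0)
    obtain ⟨T, hT, hTa⟩ := hasFDerivAt_dlyap hq κ hLq hℓm hℓK 1 (0 : ℝ)
    have h2 := hT.hasDerivAt
    rw [hTa] at h2
    simp only [hℓ1] at h2
    exact h1.sub (h2.const_mul c)
  have key := deriv_conditions_of_max hφ hφ' (fun t => by
    have h1 := hle _ (hmem t)
    rw [hproj, hV] at h1
    have h2 := hV 0
    rw [zero_smul, add_zero] at h2
    rw [zero_smul, add_zero, heq, ← h2, sub_self]
    exact sub_nonpos.mpr h1)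
  have e0 : (fun r => x₀ r + ℓ r 0) = x₀ := by funext r; simp
  rw [e0, zero_smul, add_zero] at key
  exact ⟨sub_eq_zero.mp key.1, sub_nonpos.mp key.2⟩

/-- The gradient coefficients of a cylinder function. -/
noncomputable def gradCoeff (g : E N → ℝ) (ξ : E N) (k : ℕ) : ℝ := fderiv ℝ g ξ (proj N (eta k))

lemma fderiv_proj_eq_sum (g : E N → ℝ) (ξ : E N) (h : X) :
    fderiv ℝ g ξ (proj N h) =
      ∑ k ∈ Finset.range N, gradCoeff g ξ k * inner ℝ h (eta k) := by
  have e : proj N h = ∑ i : Fin N, (inner ℝ h (eta i)) • EuclideanSpace.single i (1 : ℝ) := by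
    ext j
    simp [proj_apply, Pi.single_apply]
  rw [e, map_sum, Finset.sum_range]
  refine Finset.sum_congr rfl fun i _ => ?_
  rw [map_smul, smul_eq_mul, mul_comm, gradCoeff, proj_eta_of_lt i.2]

lemma ddlyap_congr {f₁ f₂ : ℝ → ℝ} (h : f₁ =ᵐ[unitVol] f₂) (q κ : ℝ) (a b : ℝ → ℝ) :
    ddlyap q κ f₁ a b = ddlyap q κ f₂ a b := by
  have e1 : ∫ r, f₁ r ^ 2 ∂unitVol = ∫ r, f₂ r ^ 2 ∂unitVol :=
    integral_congr_ae (h.mono fun r hr => by simp only [hr])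
  have e2 : ∫ r, |f₁ r| ^ q ∂unitVol = ∫ r, |f₂ r| ^ q ∂unitVol :=
    integral_congr_ae (h.mono fun r hr => by simp only [hr])
  have e3 : ∀ a : ℝ → ℝ, ∫ r, f₁ r * a r ∂unitVol = ∫ r, f₂ r * a r ∂unitVol := fun a =>
    integral_congr_ae (h.mono fun r hr => by simp only [hr])
  have e4 : ∀ a : ℝ → ℝ, ∫ r, oddPow q (f₁ r) * a r ∂unitVol =
      ∫ r, oddPow q (f₂ r) * a r ∂unitVol := fun a =>
    integral_congr_ae (h.mono fun r hr => by simp only [hr])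
  have e5 : ∫ r, |f₁ r| ^ (q - 2) * (a r * b r) ∂unitVol =
      ∫ r, |f₂ r| ^ (q - 2) * (a r * b r) ∂unitVol :=
    integral_congr_ae (h.mono fun r hr => by simp only [hr])
  rw [ddlyap, ddlyap, e1, e2, e3, e3, e4, e4, e5]

/-- The coefficient of the identity in the gradient of the Lyapunov function. -/
noncomputable def gradLin (q κ : ℝ) (f : ℝ → ℝ) : ℝ :=
  Real.exp (κ * ∫ r, f r ^ 2 ∂unitVol) * (2 * κ * (1 + lqCoeff q * ∫ r, |f r| ^ q ∂unitVol))

/-- The coefficient of the odd power in the gradient of the Lyapunov function. -/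
noncomputable def gradPow (q κ : ℝ) (f : ℝ → ℝ) : ℝ :=
  Real.exp (κ * ∫ r, f r ^ 2 ∂unitVol) * (lqCoeff q * q)

lemma gradLin_pos (hκ : 0 < κ) (f : ℝ → ℝ) : 0 < gradLin q κ f := by
  have h1 : 0 ≤ ∫ r, |f r| ^ q ∂unitVol := integral_nonneg fun r => by positivity
  have := lqCoeff_nonneg q
  rw [gradLin]
  positivity

lemma gradPow_nonneg (hq : 2 ≤ q) (f : ℝ → ℝ) : 0 ≤ gradPow q κ f := by
  have := lqCoeff_nonneg q
  rw [gradPow]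
  positivity

lemma dlyap_eq (f a : ℝ → ℝ) : dlyap q κ f a = gradLin q κ f * ∫ r, f r * a r ∂unitVol +
    gradPow q κ f * ∫ r, oddPow q (f r) * a r ∂unitVol := by
  rw [dlyap, gradLin, gradPow]
  ring

lemma integrable_oddPow (hq : 2 ≤ q) {f : ℝ → ℝ} (hf : MemLp f (ENNReal.ofReal q) unitVol) :
    Integrable (fun r => oddPow q (f r)) unitVol := by
  refine (integrable_one_add_rpow hq hf 0 le_rfl).mono'
    ((continuous_oddPow hq).comp_aestronglyMeasurable hf.1) (Eventually.of_forall fun r => ?_)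
  rw [Real.norm_eq_abs, abs_oddPow (by linarith), add_zero]
  exact abs_rpow_le_one_add (by linarith) (by linarith) _

/-- A maximum point of `u / V` is continuously differentiable, and the gradient of `V` there is a
sine polynomial. -/
lemma exists_regular_representative (hq : 2 ≤ q) (hκ : 0 < κ) (hc : 0 < c) (hg : ContDiff ℝ 2 g)
    (hx₀ : x₀ ∈ Xp q) (heq : g (proj N x₀) = c * (V q κ x₀).toReal)
    (hle : ∀ x ∈ Xp q, g (proj N x) ≤ c * (V q κ x).toReal) :
    ∃ y y' : ℝ → ℝ, IsDirichlet y y' ∧ x₀ =ᵐ[unitVol] y ∧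
      ∀ r, gradLin q κ y * y r + gradPow q κ y * oddPow q (y r) =
        sinePoly N (fun k => gradCoeff g (proj N x₀) k / c) r := by
  have hLq := memLp_of_mem_Xp hq hx₀
  set e : ℝ → ℝ := sinePoly N (fun k => gradCoeff g (proj N x₀) k / c) with he
  have hec : Continuous e := continuous_sinePoly _ _
  have hodd := integrable_oddPow hq hLq
  -- G is the difference of DV(x₀) and Du(x₀)/c as functions on (0,1). The first order condition
  -- makes it orthogonal to all test functions.
  set G : ℝ → ℝ := fun r => gradLin q κ x₀ * x₀ r + gradPow q κ x₀ * oddPow q (x₀ r) - e r with hG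
  have hGint : Integrable G unitVol :=
    (((integrable_coeFn_X x₀).const_mul _).add (hodd.const_mul _)).sub
      (integrable_unitVol_of_continuous hec)
  have hzero : G =ᵐ[unitVol] 0 := by
    refine ae_eq_zero_of_integral_contDiff_smul_eq_zero hGint.locallyIntegrable
      fun φ hφ hφc => ?_
    obtain ⟨K, hK⟩ := hφ.continuous.bounded_above_of_compact_support hφc
    have hφ2 := memLp_of_continuous hφ.continuous 2
    have h1 := (variation_conditions hq hg hx₀ heq hle hφ.continuous.aestronglyMeasurable hK
      hφ2.coeFn_toLp).1
    have hbdd : ∀ {f : ℝ → ℝ}, Integrable f unitVol → Integrable (fun r => f r * φ r) unitVol :=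
      fun hf => hf.mul_bdd (c := K) hφ.continuous.aestronglyMeasurable (Eventually.of_forall hK)
    have h2 : ∫ r, e r * φ r ∂unitVol = dlyap q κ x₀ φ := by
      have h3 : ∫ r, e r * φ r ∂unitVol = ∫ r, φ r * e r ∂unitVol := by simp only [mul_comm]
      rw [h3, he, integral_mul_sinePoly hφ2]
      rw [fderiv_proj_eq_sum] at h1
      rw [← mul_right_inj' hc.ne', ← h1, Finset.mul_sum]
      refine Finset.sum_congr rfl fun k _ => ?_
      have : ∫ r, φ r * etaFun k r ∂unitVol = inner ℝ (hφ2.toLp φ) (eta k) := by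
        rw [eta, inner_toLp_toLp]
      rw [this]
      field_simp
    have h4 : ∀ r, φ r • G r = gradLin q κ x₀ * (x₀ r * φ r) +
        gradPow q κ x₀ * (oddPow q (x₀ r) * φ r) - e r * φ r := by
      intro r
      simp only [hG, smul_eq_mul]
      ring
    simp only [h4]
    rw [integral_sub, integral_add, integral_const_mul, integral_const_mul, h2, dlyap_eq, sub_self]
    · exact (hbdd (integrable_coeFn_X x₀)).const_mul _
    · exact (hbdd hodd).const_mul _
    · exact ((hbdd (integrable_coeFn_X x₀)).const_mul _).add ((hbdd hodd).const_mul _)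
    · exact hbdd (integrable_unitVol_of_continuous hec)
  -- The factors `gradLin` and `gradPow` depend on x₀ only through integrals, so they are constants
  -- in the pointwise equation and do not change when x₀ is replaced by its representative.
  obtain ⟨y, y', hy, hxy, hye⟩ := exists_isDirichlet_of_eq hq (gradLin_pos hκ x₀)
    (gradPow_nonneg hq x₀) (isDirichlet_sinePoly N fun k => gradCoeff g (proj N x₀) k / c) (x := x₀)
    (hzero.mono fun r hr => by
      simp only [hG, Pi.zero_apply] at hr
      exact sub_eq_zero.mp hr)
  have e1 : ∫ r, x₀ r ^ 2 ∂unitVol = ∫ r, y r ^ 2 ∂unitVol :=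
    integral_congr_ae (hxy.mono fun r hr => by simp only [hr])
  have e2 : ∫ r, |x₀ r| ^ q ∂unitVol = ∫ r, |y r| ^ q ∂unitVol :=
    integral_congr_ae (hxy.mono fun r hr => by simp only [hr])
  have e3 : gradLin q κ x₀ = gradLin q κ y := by rw [gradLin, gradLin, e1, e2]
  have e4 : gradPow q κ x₀ = gradPow q κ y := by rw [gradPow, gradPow, e1]
  rw [e3, e4] at hye
  exact ⟨y, y', hy, hxy, hye⟩

end Variation

/-! ### The finite dimensional generators on the Lyapunov function -/

lemma coeFn_incl_eq_sum_apply (n : ℕ) : ∃ ℓ : ℝ → E n →L[ℝ] ℝ, Continuous ℓ ∧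
    (∃ K, ∀ r, ‖ℓ r‖ ≤ K) ∧ ∀ r ξ, ℓ r ξ = ∑ i : Fin n, ξ i * etaFun i r := by
  refine ⟨fun r => ∑ i : Fin n, etaFun i r • EuclideanSpace.proj (𝕜 := ℝ) i, ?_, ?_, ?_⟩
  · exact continuous_finsetSum _ fun i _ => (continuous_etaFun i).smul continuous_const
  · refine ⟨∑ i : Fin n, √2 * ‖(EuclideanSpace.proj i : E n →L[ℝ] ℝ)‖, fun r => ?_⟩
    refine (norm_sum_le _ _).trans (Finset.sum_le_sum fun i _ => ?_)
    rw [norm_smul]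
    gcongr
    rw [etaFun, norm_mul, Real.norm_of_nonneg (Real.sqrt_nonneg _)]
    exact mul_le_of_le_one_right (Real.sqrt_nonneg _) (Real.abs_sin_le_one _)
  · intro r ξ
    simp [mul_comm]

/-- The derivatives of `V` on E_n come from the parametric formulas with base function 0; the
coordinate directions become the functions η_k. -/
lemma kolmFin_V {q : ℝ} (hq : 2 ≤ q) (κ : ℝ) (A : X →L[ℝ] X) (n : ℕ) (G : E n → E n) (ξ : E n)
    {s : ℝ → ℝ} (hs : ∀ r, s r = ∑ i : Fin n, ξ i * etaFun i r) :
    kolmFin A n G (fun ζ => (V q κ (incl n ζ)).toReal) ξ =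
      1 / 2 * ∑ i : Fin n, ∑ j : Fin n, inner ℝ (eta i) (A (eta j)) *
        ddlyap q κ s (etaFun j) (etaFun i) +
      ∑ k : Fin n, (lapCoeff (incl n ξ) k + G ξ k) * dlyap q κ s (etaFun k) := by
  obtain ⟨ℓ, hℓc, ⟨K, hℓK⟩, hℓ⟩ := coeFn_incl_eq_sum_apply n
  have hℓm : AEStronglyMeasurable ℓ unitVol := hℓc.aestronglyMeasurable
  have h0 : MemLp (fun _ : ℝ => (0 : ℝ)) (ENNReal.ofReal q) unitVol := MemLp.zero'
  have hsingle : ∀ i : Fin n, (fun r => ℓ r (EuclideanSpace.single i 1)) = etaFun i := by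
    intro i
    funext r
    rw [hℓ]
    simp
  have hs' : (fun r => 0 + ℓ r ξ) = s := by
    funext r
    rw [hs, hℓ, zero_add]
  have hV : (fun ζ => (V q κ (incl n ζ)).toReal) = fun ζ => lyap q κ fun r => 0 + ℓ r ζ := by
    funext ζ
    refine toReal_V hq κ ?_ ?_
    · simpa only [zero_add, hℓ] using coeFn_incl n ζ
    · refine memLp_of_continuous ?_ _
      exact continuous_const.add (hℓc.clm_apply continuous_const)
  have h1 : ∀ k : Fin n, pd (EuclideanSpace.single k 1) (fun ζ => lyap q κ fun r => 0 + ℓ r ζ) =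
      fun ζ => dlyap q κ (fun r => 0 + ℓ r ζ) (etaFun k) := by
    intro k
    funext ζ
    obtain ⟨T, hT, hTa⟩ := hasFDerivAt_lyap hq κ h0 hℓm hℓK ζ
    rw [pd, hT.fderiv, hTa, hsingle]
  have h2 : ∀ i j : Fin n, pd (EuclideanSpace.single i 1)
      (fun ζ => dlyap q κ (fun r => 0 + ℓ r ζ) (etaFun j)) ξ =
      ddlyap q κ s (etaFun j) (etaFun i) := by
    intro i j
    obtain ⟨T, hT, hTa⟩ := hasFDerivAt_dlyap hq κ h0 hℓm hℓK (EuclideanSpace.single j 1) ξ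
    simp only [hsingle] at hT hTa
    rw [pd, hT.fderiv, hTa, hsingle, hs']
  rw [kolmFin, hV]
  simp only [h1, h2, hs']

/-! ### Uniform convergence and integral functionals -/

lemma exists_bound_Icc {f : ℝ → ℝ} (hf : Continuous f) :
    ∃ C, 0 ≤ C ∧ ∀ r ∈ Icc (0 : ℝ) 1, |f r| ≤ C := by
  obtain ⟨C, hC⟩ := (isCompact_Icc (a := (0 : ℝ)) (b := 1)).exists_bound_of_continuousOn
    hf.continuousOn
  exact ⟨C, (norm_nonneg _).trans (hC 0 (by simp)), hC⟩

lemma TendstoUniformlyOn_comp_continuous {f : ℕ → ℝ → ℝ} {y ρ : ℝ → ℝ} (hy : Continuous y)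
    (hf : TendstoUniformlyOn f y atTop (Icc 0 1)) (hρ : Continuous ρ) :
    TendstoUniformlyOn (fun n r => ρ (f n r)) (fun r => ρ (y r)) atTop (Icc 0 1) := by
  obtain ⟨C, hC0, hC⟩ := exists_bound_Icc hy
  -- Near the limit all values lie within distance 1 of the range of y, a compact set on which ρ is
  -- uniformly continuous.
  have huc : UniformContinuousOn ρ (Icc (-(C + 1)) (C + 1)) :=
    isCompact_Icc.uniformContinuousOn_of_continuous hρ.continuousOn
  rw [Metric.uniformContinuousOn_iff] at huc
  rw [Metric.tendstoUniformlyOn_iff] at hf ⊢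
  intro ε hε
  obtain ⟨δ, hδ, h⟩ := huc ε hε
  filter_upwards [hf (min δ 1) (lt_min hδ one_pos)] with n hn r hr
  have h1 := hn r hr
  have h2 := hC r hr
  rw [abs_le] at h2
  have h3 := h1.trans_le (min_le_right _ _)
  rw [Real.dist_eq, abs_lt] at h3
  refine h _ ⟨by linarith, by linarith⟩ _ ⟨by linarith, by linarith⟩
    (h1.trans_le (min_le_left _ _))

instance : IsProbabilityMeasure unitVol := ⟨by simp⟩

lemma abs_integral_unitVol_le {f : ℝ → ℝ} {C : ℝ} (h : ∀ r ∈ Icc (0 : ℝ) 1, |f r| ≤ C) :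
    |∫ r, f r ∂unitVol| ≤ C := by
  have := norm_integral_le_of_norm_le_const (μ := unitVol) (f := f) (C := C) (by
    filter_upwards [ae_restrict_mem measurableSet_Ioo] with r hr
    exact h r (Ioo_subset_Icc_self hr))
  simpa using this

lemma tendsto_integral_of_uniform {f : ℕ → ℝ → ℝ} {y : ℝ → ℝ} (hfc : ∀ n, Continuous (f n))
    (hy : Continuous y) (hf : TendstoUniformlyOn f y atTop (Icc 0 1)) :
    Tendsto (fun n => ∫ r, f n r ∂unitVol) atTop (𝓝 (∫ r, y r ∂unitVol)) := by
  rw [Metric.tendsto_atTop']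
  rw [Metric.tendstoUniformlyOn_iff] at hf
  intro ε hε
  obtain ⟨n₀, hn₀⟩ := eventually_atTop.mp (hf (ε / 2) (half_pos hε))
  refine ⟨n₀, fun n hn => ?_⟩
  rw [Real.dist_eq, ← integral_sub (integrable_unitVol_of_continuous (hfc n))
    (integrable_unitVol_of_continuous hy)]
  refine lt_of_le_of_lt (abs_integral_unitVol_le (C := ε / 2) fun r hr => ?_) (by linarith)
  have := hn₀ n hn.le r hr
  rw [dist_comm, Real.dist_eq] at this
  exact this.le

/-! ### Continuous functions as vectors and multiplication forms. -/

/-- The element of `X` represented by a continuous function. -/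
noncomputable def vec (f : ℝ → ℝ) (hf : Continuous f) : X := (memLp_of_continuous hf 2).toLp f

lemma coeFn_vec {f : ℝ → ℝ} (hf : Continuous f) : vec f hf =ᵐ[unitVol] f :=
  (memLp_of_continuous hf 2).coeFn_toLp

lemma inner_vec_eta {f : ℝ → ℝ} (hf : Continuous f) (k : ℕ) :
    inner ℝ (vec f hf) (eta k) = ∫ r, f r * etaFun k r ∂unitVol := by
  rw [vec, eta, inner_toLp_toLp]

lemma norm_vec_sub_sq {f g : ℝ → ℝ} (hf : Continuous f) (hg : Continuous g) :
    ‖vec f hf - vec g hg‖ ^ 2 = ∫ r, (f r - g r) ^ 2 ∂unitVol := by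
  rw [norm_sq_eq_integral]
  refine integral_congr_ae ?_
  filter_upwards [Lp.coeFn_sub (vec f hf) (vec g hg), coeFn_vec hf, coeFn_vec hg] with r h1 h2 h3
  rw [h1, Pi.sub_apply, h2, h3]

lemma tendsto_vec_of_uniform {f : ℕ → ℝ → ℝ} {y : ℝ → ℝ} (hfc : ∀ n, Continuous (f n))
    (hy : Continuous y) (hf : TendstoUniformlyOn f y atTop (Icc 0 1)) :
    Tendsto (fun n => vec (f n) (hfc n)) atTop (𝓝 (vec y hy)) := by
  rw [Metric.tendsto_atTop']
  rw [Metric.tendstoUniformlyOn_iff] at hf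
  intro ε hε
  obtain ⟨n₀, hn₀⟩ := eventually_atTop.mp (hf (ε / 2) (half_pos hε))
  refine ⟨n₀, fun n hn => ?_⟩
  rw [dist_eq_norm]
  have h1 : ‖vec (f n) (hfc n) - vec y hy‖ ^ 2 ≤ (ε / 2) ^ 2 := by
    rw [norm_vec_sub_sq]
    refine (le_abs_self _).trans (abs_integral_unitVol_le fun r hr => ?_)
    have := hn₀ n hn.le r hr
    rw [dist_comm, Real.dist_eq] at this
    rw [abs_pow]
    gcongr
  have h2 := abs_le_of_sq_le_sq h1 (by positivity)
  rw [abs_of_nonneg (norm_nonneg _)] at h2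
  linarith

lemma integrable_mul_mul {f : ℝ → ℝ} (hf : Continuous f) (h k : X) :
    Integrable (fun r => f r * (h r * k r)) unitVol := by
  obtain ⟨C, -, hC⟩ := exists_bound_Icc hf
  refine (MemLp.integrable_mul (Lp.memLp h) (Lp.memLp k)).bdd_mul (c := C)
    hf.aestronglyMeasurable ?_
  filter_upwards [ae_restrict_mem measurableSet_Ioo] with r hr
  exact hC r (Ioo_subset_Icc_self hr)

lemma abs_integral_mul_mul_le {f : ℝ → ℝ} (hf : Continuous f) {C : ℝ}
    (hC : ∀ r ∈ Icc (0 : ℝ) 1, |f r| ≤ C) (h k : X) :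
    |∫ r, f r * (h r * k r) ∂unitVol| ≤ C * ‖h‖ * ‖k‖ := by
  have hC0 : 0 ≤ C := (abs_nonneg _).trans (hC 0 (by simp))
  have h1 : |∫ r, f r * (h r * k r) ∂unitVol| ≤ C * inner ℝ |h| |k| := by
    rw [inner_X_eq, ← integral_const_mul]
    refine (abs_integral_le_integral_abs).trans (integral_mono_ae (integrable_mul_mul hf h k).abs
      ((MemLp.integrable_mul (Lp.memLp _) (Lp.memLp _)).const_mul C) ?_)
    filter_upwards [ae_restrict_mem measurableSet_Ioo, Lp.coeFn_abs h, Lp.coeFn_abs k]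
      with r hr h2 h3
    rw [h2, h3, abs_mul, abs_mul]
    exact mul_le_mul_of_nonneg_right (hC r (Ioo_subset_Icc_self hr)) (by positivity)
  refine h1.trans ?_
  rw [mul_assoc]
  refine mul_le_mul_of_nonneg_left ?_ hC0
  have := real_inner_le_norm |h| |k|
  rwa [norm_abs_eq_norm, norm_abs_eq_norm] at this

/-! ### Convergence of bounded bilinear forms -/

section Forms

variable {H : Type*} [NormedAddCommGroup H] [InnerProductSpace ℝ H]

/-- Convergence of the bounded bilinear forms `B n` to `B₀` in operator norm. -/
def FormTendsto (B : ℕ → H →ₗ[ℝ] H →ₗ[ℝ] ℝ) (B₀ : H →ₗ[ℝ] H →ₗ[ℝ] ℝ) : Prop :=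
  (∃ K, 0 ≤ K ∧ ∀ h k, |B₀ h k| ≤ K * ‖h‖ * ‖k‖) ∧
    ∃ ε : ℕ → ℝ, (∀ n, 0 ≤ ε n) ∧ Tendsto ε atTop (𝓝 0) ∧
      ∀ n h k, |B n h k - B₀ h k| ≤ ε n * ‖h‖ * ‖k‖

variable {B C : ℕ → H →ₗ[ℝ] H →ₗ[ℝ] ℝ} {B₀ C₀ : H →ₗ[ℝ] H →ₗ[ℝ] ℝ}

lemma FormTendsto.add (hB : FormTendsto B B₀) (hC : FormTendsto C C₀) :
    FormTendsto (fun n => B n + C n) (B₀ + C₀) := by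
  obtain ⟨⟨K, hK, hBK⟩, ε, hε, hε0, hBε⟩ := hB
  obtain ⟨⟨L, hL, hCL⟩, δ, hδ, hδ0, hCδ⟩ := hC
  refine ⟨⟨K + L, by positivity, fun h k => ?_⟩, fun n => ε n + δ n,
    fun n => add_nonneg (hε n) (hδ n), by simpa using hε0.add hδ0, fun n h k => ?_⟩
  · refine (abs_add_le _ _).trans ?_
    linarith [hBK h k, hCL h k]
  · have : (B n + C n) h k - (B₀ + C₀) h k = (B n h k - B₀ h k) + (C n h k - C₀ h k) := by
      simp only [LinearMap.add_apply]
      ring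
    rw [this]
    refine (abs_add_le _ _).trans ?_
    linarith [hBε n h k, hCδ n h k]

/-- The variation of the scalar leaves a term (c n - c₀) B₀, which is why boundedness of the limit
form is part of `FormTendsto`. -/
lemma FormTendsto.smul {c : ℕ → ℝ} {c₀ : ℝ} (hc : Tendsto c atTop (𝓝 c₀)) (hB : FormTendsto B B₀) :
    FormTendsto (fun n => c n • B n) (c₀ • B₀) := by
  obtain ⟨⟨K, hK, hBK⟩, ε, hε, hε0, hBε⟩ := hB
  refine ⟨⟨|c₀| * K, by positivity, fun h k => ?_⟩, fun n => |c n| * ε n + |c n - c₀| * K,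
    fun n => add_nonneg (mul_nonneg (abs_nonneg _) (hε n)) (by positivity), ?_, fun n h k => ?_⟩
  · simp only [LinearMap.smul_apply, smul_eq_mul, abs_mul, mul_assoc]
    have := hBK h k
    rw [mul_assoc] at this
    gcongr
  · have h1 := (hc.abs.mul hε0).add ((hc.sub_const c₀).abs.mul_const K)
    simpa using h1
  · have : (c n • B n) h k - (c₀ • B₀) h k = c n * (B n h k - B₀ h k) + (c n - c₀) * B₀ h k := by
      simp only [LinearMap.smul_apply, smul_eq_mul]
      ring
    rw [this]
    refine (abs_add_le _ _).trans ?_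
    rw [abs_mul, abs_mul]
    have h1 := mul_le_mul_of_nonneg_left (hBε n h k) (abs_nonneg (c n))
    have h2 := mul_le_mul_of_nonneg_left (hBK h k) (abs_nonneg (c n - c₀))
    linarith

lemma FormTendsto.tendsto_apply (hB : FormTendsto B B₀) {a b : ℕ → H} {a₀ b₀ : H}
    (ha : Tendsto a atTop (𝓝 a₀)) (hb : Tendsto b atTop (𝓝 b₀)) :
    Tendsto (fun n => B n (a n) (b n)) atTop (𝓝 (B₀ a₀ b₀)) := by
  obtain ⟨⟨K, hK, hBK⟩, ε, hε, hε0, hBε⟩ := hB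
  rw [tendsto_iff_norm_sub_tendsto_zero]
  have h1 := ((hε0.mul ha.norm).mul hb.norm).add
    ((((tendsto_iff_norm_sub_tendsto_zero.mp ha).const_mul K).mul hb.norm).add
      ((tendsto_iff_norm_sub_tendsto_zero.mp hb).const_mul (K * ‖a₀‖)))
  simp only [zero_mul, mul_zero, add_zero] at h1
  refine squeeze_zero (fun n => norm_nonneg _) (fun n => ?_) h1
  have : B n (a n) (b n) - B₀ a₀ b₀ = (B n (a n) (b n) - B₀ (a n) (b n)) +
      (B₀ (a n - a₀) (b n) + B₀ a₀ (b n - b₀)) := by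
    simp only [map_sub, LinearMap.sub_apply]
    ring
  rw [this]
  exact (norm_add_le _ _).trans (add_le_add (hBε n _ _)
    ((norm_add_le _ _).trans (add_le_add (hBK _ _) (hBK _ _))))

/-- The bilinear form `(h, k) ↦ (a, h) (b, k)`. -/
noncomputable def rankOneForm (a b : H) : H →ₗ[ℝ] H →ₗ[ℝ] ℝ :=
  (innerₗ H a).smulRight (innerₗ H b)

lemma rankOneForm_apply (a b h k : H) : rankOneForm a b h k = inner ℝ a h * inner ℝ b k := rfl

lemma FormTendsto.innerForm : FormTendsto (fun _ => innerₗ H) (innerₗ H) :=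
  ⟨⟨1, zero_le_one, fun h k => by simpa using abs_real_inner_le_norm h k⟩, fun _ => 0,
    fun _ => le_rfl, tendsto_const_nhds, fun n h k => by simp⟩

lemma abs_rankOneForm_le (a b h k : H) : |rankOneForm a b h k| ≤ ‖a‖ * ‖b‖ * ‖h‖ * ‖k‖ := by
  rw [rankOneForm_apply, abs_mul]
  calc |inner ℝ a h| * |inner ℝ b k| ≤ (‖a‖ * ‖h‖) * (‖b‖ * ‖k‖) := by
        gcongr <;> exact abs_real_inner_le_norm _ _
    _ = _ := by ring

lemma FormTendsto.rankOneForm {a b : ℕ → H} {a₀ b₀ : H} (ha : Tendsto a atTop (𝓝 a₀))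
    (hb : Tendsto b atTop (𝓝 b₀)) :
    FormTendsto (fun n => rankOneForm (a n) (b n)) (rankOneForm a₀ b₀) := by
  refine ⟨⟨‖a₀‖ * ‖b₀‖, by positivity, abs_rankOneForm_le a₀ b₀⟩,
    fun n => ‖a n - a₀‖ * ‖b n‖ + ‖a₀‖ * ‖b n - b₀‖, fun n => by positivity, ?_, fun n h k => ?_⟩
  · have h1 := ((tendsto_iff_norm_sub_tendsto_zero.mp ha).mul hb.norm).add
      ((tendsto_iff_norm_sub_tendsto_zero.mp hb).const_mul ‖a₀‖)
    simpa using h1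
  · have : Kolmogorov.rankOneForm (a n) (b n) h k - Kolmogorov.rankOneForm a₀ b₀ h k =
        Kolmogorov.rankOneForm (a n - a₀) (b n) h k +
          Kolmogorov.rankOneForm a₀ (b n - b₀) h k := by
      simp only [rankOneForm_apply, inner_sub_left]
      ring
    rw [this]
    refine (abs_add_le _ _).trans ?_
    linarith [abs_rankOneForm_le (a n - a₀) (b n) h k, abs_rankOneForm_le a₀ (b n - b₀) h k]

end Forms

/-- The bilinear form `(h, k) ↦ ∫ f h k`. -/
noncomputable def mulForm (f : ℝ → ℝ) (hf : Continuous f) : X →ₗ[ℝ] X →ₗ[ℝ] ℝ :=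
  LinearMap.mk₂ ℝ (fun h k : X => ∫ r, f r * (h r * k r) ∂unitVol)
    (fun h₁ h₂ k => by
      rw [← integral_add (integrable_mul_mul hf h₁ k) (integrable_mul_mul hf h₂ k)]
      refine integral_congr_ae ?_
      filter_upwards [Lp.coeFn_add h₁ h₂] with r hr
      rw [hr, Pi.add_apply]
      ring)
    (fun c h k => by
      rw [smul_eq_mul, ← integral_const_mul]
      refine integral_congr_ae ?_
      filter_upwards [Lp.coeFn_smul c h] with r hr
      rw [hr, Pi.smul_apply, smul_eq_mul]
      ring)
    (fun h k₁ k₂ => by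
      rw [← integral_add (integrable_mul_mul hf h k₁) (integrable_mul_mul hf h k₂)]
      refine integral_congr_ae ?_
      filter_upwards [Lp.coeFn_add k₁ k₂] with r hr
      rw [hr, Pi.add_apply]
      ring)
    (fun c h k => by
      rw [smul_eq_mul, ← integral_const_mul]
      refine integral_congr_ae ?_
      filter_upwards [Lp.coeFn_smul c k] with r hr
      rw [hr, Pi.smul_apply, smul_eq_mul]
      ring)

lemma mulForm_apply {f : ℝ → ℝ} (hf : Continuous f) (h k : X) :
    mulForm f hf h k = ∫ r, f r * (h r * k r) ∂unitVol := rfl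

lemma mulForm_vec {f a b : ℝ → ℝ} (hf : Continuous f) (ha : Continuous a) (hb : Continuous b) :
    mulForm f hf (vec a ha) (vec b hb) = ∫ r, f r * (a r * b r) ∂unitVol := by
  rw [mulForm_apply]
  refine integral_congr_ae ?_
  filter_upwards [coeFn_vec ha, coeFn_vec hb] with r h1 h2
  rw [h1, h2]

/-- A multiplication form is bounded by the supremum of its weight on [0,1], so uniform convergence
of the weights suffices. -/
lemma FormTendsto.mulForm {f : ℕ → ℝ → ℝ} {y : ℝ → ℝ} (hfc : ∀ n, Continuous (f n))
    (hy : Continuous y) (hf : TendstoUniformlyOn f y atTop (Icc 0 1)) :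
    FormTendsto (fun n => mulForm (f n) (hfc n)) (mulForm y hy) := by
  obtain ⟨C, hC0, hC⟩ := exists_bound_Icc hy
  -- These bounds only make the supremum of |f n - y| below a genuine one.
  choose D hD0 hD using fun n => exists_bound_Icc ((hfc n).sub hy)
  refine ⟨⟨C, hC0, fun h k => abs_integral_mul_mul_le hy hC h k⟩,
    fun n => sSup ((fun r => |f n r - y r|) '' Icc 0 1),
    fun n => Real.sSup_nonneg (by rintro _ ⟨r, -, rfl⟩; exact abs_nonneg _), ?_, fun n h k => ?_⟩
  · rw [Metric.tendsto_atTop']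
    rw [Metric.tendstoUniformlyOn_iff] at hf
    intro ε hε
    obtain ⟨n₀, hn₀⟩ := eventually_atTop.mp (hf (ε / 2) (half_pos hε))
    refine ⟨n₀, fun n hn => ?_⟩
    rw [Real.dist_eq, sub_zero, abs_of_nonneg
      (Real.sSup_nonneg (by rintro _ ⟨r, -, rfl⟩; exact abs_nonneg _))]
    refine lt_of_le_of_lt (csSup_le ⟨_, 0, by simp, rfl⟩ ?_) (half_lt_self hε)
    rintro _ ⟨r, hr, rfl⟩
    have := hn₀ n hn.le r hr
    rw [dist_comm, Real.dist_eq] at this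
    exact this.le
  · have e : Kolmogorov.mulForm (f n) (hfc n) h k - Kolmogorov.mulForm y hy h k =
        ∫ r, (f n r - y r) * (h r * k r) ∂unitVol := by
      rw [mulForm_apply, mulForm_apply,
        ← integral_sub (integrable_mul_mul (hfc n) h k) (integrable_mul_mul hy h k)]
      simp only [sub_mul]
    rw [e]
    refine abs_integral_mul_mul_le ((hfc n).sub hy) (fun r hr => ?_) h k
    exact le_csSup ⟨D n, by rintro _ ⟨t, ht, rfl⟩; exact hD n t ht⟩ ⟨r, hr, rfl⟩

/-! ### Convergence of the sine series of a continuously differentiable function -/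

section SineSeries

variable {y y' : ℝ → ℝ}

lemma vec_sinePolyDeriv (n : ℕ) (a : ℕ → ℝ) :
    vec (sinePolyDeriv n a) (isDirichlet_sinePoly n a).continuous_deriv =
      ∑ k ∈ Finset.range n, (Real.pi * (k + 1) * a k) • cosVec (k + 1) := by
  refine Lp.ext ?_
  have h1 : ∀ k : ℕ, ((Real.pi * (k + 1) * a k) • cosVec (k + 1) : X) =ᵐ[unitVol]
      fun r => Real.pi * (k + 1) * a k * cosFun (k + 1) r := by
    intro k
    filter_upwards [Lp.coeFn_smul (Real.pi * (k + 1) * a k) (cosVec (k + 1)),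
      (memLp_of_continuous (continuous_cosFun (k + 1)) 2).coeFn_toLp] with r hr1 hr2
    rw [hr1, Pi.smul_apply, smul_eq_mul]
    congr 1
  filter_upwards [coeFn_vec (isDirichlet_sinePoly n a).continuous_deriv, ae_all_iff.mpr h1,
    Lp.coeFn_finsetSum (Finset.range n)
      fun k : ℕ => ((Real.pi * (k + 1) * a k) • cosVec (k + 1) : X)] with r h2 h3 h4
  rw [h2, h4, Finset.sum_apply, sinePolyDeriv]
  refine Finset.sum_congr rfl fun k _ => ?_
  rw [h3]
  ring

/-- The derivatives of the sine partial sums are the cosine partial sums of y'. The constant mode is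
absent since ∫ y' = y(1) - y(0) = 0, and the cosine expansion of y' converges in L². -/
lemma tendsto_vec_sinePolyDeriv (hy : IsDirichlet y y') {x : X} (hx : x =ᵐ[unitVol] y) :
    Tendsto (fun n => vec (sinePolyDeriv n fun k => inner ℝ x (eta k))
      (isDirichlet_sinePoly n _).continuous_deriv) atTop (𝓝 (vec y' hy.continuous_deriv)) := by
  have hx1 := mem_H01_of_isDirichlet hy hx
  have hwd := (hasWeakDeriv_of_hasDerivAt hy.hasDerivAt hy.continuous_deriv).congr hx
  have h0 : inner ℝ (vec y' hy.continuous_deriv) (cosVec 0) = 0 := by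
    rw [vec, cosVec, inner_toLp_toLp]
    have : ∀ r, y' r * cosFun 0 r = y' r := fun r => by simp [cosFun]
    simp only [this]
    rw [integral_unitVol_eq, intervalIntegral.integral_eq_sub_of_hasDerivAt
      (fun r _ => hy.hasDerivAt r) (hy.continuous_deriv.intervalIntegrable _ _), hy.zero, hy.one,
      sub_zero]
  have h1 : ∀ k, inner ℝ (vec y' hy.continuous_deriv) (cosVec (k + 1)) =
      Real.pi * (k + 1) * inner ℝ x (eta k) := fun k =>
    (inner_eta_mul_eq hx1 hwd (memLp_of_continuous hy.continuous_deriv 2) k).symm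
  have hs := (hasSum_cosVec (vec y' hy.continuous_deriv)).tendsto_sum_nat
  -- The cosine partial sum of length n + 1 matches the sine sum of length n, as its zeroth term
  -- vanishes.
  refine (hs.comp (tendsto_add_atTop_nat 1)).congr fun n => ?_
  rw [Function.comp, Finset.sum_range_succ', h0, zero_smul, add_zero, vec_sinePolyDeriv]
  simp only [h1]

lemma integral_abs_le_norm_vec {f : ℝ → ℝ} (hf : Continuous f) :
    ∫ r, |f r| ∂unitVol ≤ ‖vec f hf‖ := by
  have h1 : ∫ r, |f r| ∂unitVol = inner ℝ (vec _ hf.abs) (vec (fun _ => 1) continuous_const) := by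
    rw [vec, vec, inner_toLp_toLp]
    simp
  have h2 : ∀ {g : ℝ → ℝ} (hg : Continuous g), ‖vec g hg‖ ^ 2 = ∫ r, g r ^ 2 ∂unitVol := by
    intro g hg
    rw [norm_sq_eq_integral]
    exact integral_congr_ae ((coeFn_vec hg).mono fun r hr => by simp only [hr])
  have h3 : ‖vec (fun _ => (1 : ℝ)) continuous_const‖ = 1 := by
    have := h2 (continuous_const (y := (1 : ℝ)))
    simp only [one_pow, integral_const, probReal_univ, smul_eq_mul, mul_one] at this
    exact (pow_eq_one_iff_of_nonneg (norm_nonneg _) two_ne_zero).mp this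
  have h4 : ‖vec _ hf.abs‖ = ‖vec f hf‖ := by
    have e := h2 hf.abs
    simp only [sq_abs] at e
    rw [← h2 hf] at e
    exact (sq_eq_sq₀ (norm_nonneg _) (norm_nonneg _)).mp e
  rw [h1]
  refine (real_inner_le_norm _ _).trans ?_
  rw [h3, h4, mul_one]

/-- Both functions vanish at 0, so their difference is at most the L¹ norm, hence the L² norm, of
the difference of the derivatives. -/
lemma tendstoUniformlyOn_sinePoly (hy : IsDirichlet y y') {x : X} (hx : x =ᵐ[unitVol] y) :
    TendstoUniformlyOn (fun n => sinePoly n fun k => inner ℝ x (eta k)) y atTop (Icc 0 1) := by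
  have hd := tendsto_vec_sinePolyDeriv hy hx
  rw [Metric.tendsto_atTop'] at hd
  rw [Metric.tendstoUniformlyOn_iff]
  intro ε hε
  obtain ⟨n₀, hn₀⟩ := hd ε hε
  filter_upwards [eventually_gt_atTop n₀] with n hn r hr
  have h1 := hn₀ n hn
  set a : ℕ → ℝ := fun k => inner ℝ x (eta k)
  have hs := isDirichlet_sinePoly n a
  have hc : Continuous fun r => sinePolyDeriv n a r - y' r :=
    hs.continuous_deriv.sub hy.continuous_deriv
  have h2 : vec _ hs.continuous_deriv - vec y' hy.continuous_deriv =
      vec (fun r => sinePolyDeriv n a r - y' r) hc := by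
    refine Lp.ext ?_
    filter_upwards [Lp.coeFn_sub (vec _ hs.continuous_deriv) (vec y' hy.continuous_deriv),
      coeFn_vec hs.continuous_deriv, coeFn_vec hy.continuous_deriv, coeFn_vec hc] with r h1 h2 h3 h4
    rw [h1, Pi.sub_apply, h2, h3, h4]
  rw [dist_eq_norm, h2] at h1
  refine lt_of_le_of_lt ?_ h1
  rw [dist_comm, Real.dist_eq]
  have h3 : sinePoly n a r - y r = ∫ t in (0 : ℝ)..r, (sinePolyDeriv n a t - y' t) := by
    rw [intervalIntegral.integral_eq_sub_of_hasDerivAt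
      (fun t _ => (hs.hasDerivAt t).sub (hy.hasDerivAt t)) (hc.intervalIntegrable _ _)]
    simp [hs.zero, hy.zero]
  rw [h3]
  refine (intervalIntegral.abs_integral_le_integral_abs hr.1).trans ?_
  refine le_trans ?_ (integral_abs_le_norm_vec hc)
  rw [integral_unitVol_eq]
  exact intervalIntegral.integral_mono_interval le_rfl hr.1 hr.2
    (Eventually.of_forall fun t => abs_nonneg _) (hc.abs.intervalIntegrable _ _)

end SineSeries

/-! ### The Hessian of the Lyapunov function as a bounded bilinear form -/

lemma continuous_abs_rpow {q : ℝ} (hq : 0 ≤ q) : Continuous fun s : ℝ => |s| ^ q :=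
  continuous_abs.rpow_const fun _ => Or.inr hq

section Hess

variable {q : ℝ}

lemma continuous_weight (hq : 2 ≤ q) {f : ℝ → ℝ} (hf : Continuous f) :
    Continuous fun r => |f r| ^ (q - 2) :=
  (continuous_abs_rpow (by linarith)).comp hf

lemma continuous_oddPow_comp (hq : 2 ≤ q) {f : ℝ → ℝ} (hf : Continuous f) :
    Continuous fun r => oddPow q (f r) :=
  (continuous_oddPow hq).comp hf

/-- The Hessian of the Lyapunov function at a continuous function. -/
noncomputable def hessForm (hq : 2 ≤ q) (κ : ℝ) (f : ℝ → ℝ) (hf : Continuous f) :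
    X →ₗ[ℝ] X →ₗ[ℝ] ℝ :=
  (2 * κ * gradLin q κ f) • rankOneForm (vec f hf) (vec f hf) +
    (2 * κ * gradPow q κ f) • (rankOneForm (vec _ (continuous_oddPow_comp hq hf)) (vec f hf) +
      rankOneForm (vec f hf) (vec _ (continuous_oddPow_comp hq hf))) +
    gradLin q κ f • innerₗ X +
    (gradPow q κ f * (q - 1)) • mulForm _ (continuous_weight hq hf)

lemma inner_vec_vec {f g : ℝ → ℝ} (hf : Continuous f) (hg : Continuous g) :
    inner ℝ (vec f hf) (vec g hg) = ∫ r, f r * g r ∂unitVol := by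
  rw [vec, vec, inner_toLp_toLp]

lemma ddlyap_eq_hessForm (hq : 2 ≤ q) (κ : ℝ) {f a b : ℝ → ℝ} (hf : Continuous f)
    (ha : Continuous a) (hb : Continuous b) :
    ddlyap q κ f a b = hessForm hq κ f hf (vec a ha) (vec b hb) := by
  simp only [hessForm, LinearMap.add_apply, LinearMap.smul_apply, rankOneForm_apply,
    innerₗ_apply_apply, mulForm_vec, inner_vec_vec, smul_eq_mul, ddlyap, gradLin, gradPow]
  ring

variable {s : ℕ → ℝ → ℝ} {y : ℝ → ℝ}

lemma tendsto_expFactor (κ : ℝ) (hs : ∀ n, Continuous (s n)) (hy : Continuous y)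
    (h : TendstoUniformlyOn s y atTop (Icc 0 1)) :
    Tendsto (fun n => Real.exp (κ * ∫ r, s n r ^ 2 ∂unitVol)) atTop
      (𝓝 (Real.exp (κ * ∫ r, y r ^ 2 ∂unitVol))) := by
  refine (Real.continuous_exp.tendsto _).comp (Tendsto.const_mul κ ?_)
  exact tendsto_integral_of_uniform (fun n => (hs n).pow 2) (hy.pow 2)
    (TendstoUniformlyOn_comp_continuous hy h (continuous_pow 2))

lemma tendsto_lqFactor (hq : 2 ≤ q) (hs : ∀ n, Continuous (s n)) (hy : Continuous y)
    (h : TendstoUniformlyOn s y atTop (Icc 0 1)) :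
    Tendsto (fun n => 1 + lqCoeff q * ∫ r, |s n r| ^ q ∂unitVol) atTop
      (𝓝 (1 + lqCoeff q * ∫ r, |y r| ^ q ∂unitVol)) := by
  have hc := continuous_abs_rpow (q := q) (by linarith)
  exact ((tendsto_integral_of_uniform (fun n => hc.comp (hs n)) (hc.comp hy)
    (TendstoUniformlyOn_comp_continuous hy h hc)).const_mul _).const_add 1

lemma tendsto_lyap (hq : 2 ≤ q) (κ : ℝ) (hs : ∀ n, Continuous (s n)) (hy : Continuous y)
    (h : TendstoUniformlyOn s y atTop (Icc 0 1)) :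
    Tendsto (fun n => lyap q κ (s n)) atTop (𝓝 (lyap q κ y)) :=
  (tendsto_expFactor κ hs hy h).mul (tendsto_lqFactor hq hs hy h)

lemma tendsto_gradLin (hq : 2 ≤ q) (κ : ℝ) (hs : ∀ n, Continuous (s n)) (hy : Continuous y)
    (h : TendstoUniformlyOn s y atTop (Icc 0 1)) :
    Tendsto (fun n => gradLin q κ (s n)) atTop (𝓝 (gradLin q κ y)) :=
  (tendsto_expFactor κ hs hy h).mul ((tendsto_lqFactor hq hs hy h).const_mul _)

lemma tendsto_gradPow (κ : ℝ) (hs : ∀ n, Continuous (s n)) (hy : Continuous y)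
    (h : TendstoUniformlyOn s y atTop (Icc 0 1)) :
    Tendsto (fun n => gradPow q κ (s n)) atTop (𝓝 (gradPow q κ y)) :=
  (tendsto_expFactor κ hs hy h).mul_const _

/-- Convergence in operator norm, rather than entry by entry, is needed because the traces below run
over E_n with n → ∞. -/
lemma FormTendsto.hessForm (hq : 2 ≤ q) (κ : ℝ) (hs : ∀ n, Continuous (s n)) (hy : Continuous y)
    (h : TendstoUniformlyOn s y atTop (Icc 0 1)) :
    FormTendsto (fun n => hessForm hq κ (s n) (hs n)) (hessForm hq κ y hy) := by
  have hv := tendsto_vec_of_uniform hs hy h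
  have ho := tendsto_vec_of_uniform (fun n => continuous_oddPow_comp hq (hs n))
    (continuous_oddPow_comp hq hy) (TendstoUniformlyOn_comp_continuous hy h (continuous_oddPow hq))
  have hw := FormTendsto.mulForm (fun n => continuous_weight hq (hs n)) (continuous_weight hq hy)
    (TendstoUniformlyOn_comp_continuous hy h (continuous_abs_rpow (q := q - 2) (by linarith)))
  have hL := tendsto_gradLin hq κ hs hy h
  have hP := tendsto_gradPow (q := q) κ hs hy h
  exact (((FormTendsto.smul (hL.const_mul (2 * κ)) (.rankOneForm hv hv)).add
    (.smul (hP.const_mul (2 * κ)) ((FormTendsto.rankOneForm ho hv).add (.rankOneForm hv ho)))).add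
    (.smul hL .innerForm)).add (.smul (hP.mul_const (q - 1)) hw)

variable {s' : ℕ → ℝ → ℝ} {y' : ℝ → ℝ}

/-- The weight converges uniformly and the derivatives only in L², which is exactly convergence of a
multiplication form applied to convergent vectors. -/
lemma tendsto_weighted_energy {ρ : ℝ → ℝ} (hρ : Continuous ρ) (hs : ∀ n, Continuous (s n))
    (hy : Continuous y) (h : TendstoUniformlyOn s y atTop (Icc 0 1)) (hs' : ∀ n, Continuous (s' n))
    (hy' : Continuous y')
    (h' : Tendsto (fun n => vec (s' n) (hs' n)) atTop (𝓝 (vec y' hy'))) :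
    Tendsto (fun n => ∫ r, ρ (s n r) * (s' n r * s' n r) ∂unitVol) atTop
      (𝓝 (∫ r, ρ (y r) * (y' r * y' r) ∂unitVol)) := by
  have hw := FormTendsto.mulForm (fun n => hρ.comp (hs n)) (hρ.comp hy)
    (TendstoUniformlyOn_comp_continuous hy h hρ)
  have := hw.tendsto_apply h' h'
  simpa only [mulForm_vec, Function.comp] using this

lemma tendsto_energy (hs' : ∀ n, Continuous (s' n)) (hy' : Continuous y')
    (h' : Tendsto (fun n => vec (s' n) (hs' n)) atTop (𝓝 (vec y' hy'))) :
    Tendsto (fun n => ∫ r, s' n r ^ 2 ∂unitVol) atTop (𝓝 (∫ r, y' r ^ 2 ∂unitVol)) := by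
  have := Filter.Tendsto.inner (𝕜 := ℝ) h' h'
  simpa only [inner_vec_vec, ← sq] using this

lemma tendsto_coercive (hq : 2 ≤ q) (κ : ℝ) (hs : ∀ n, Continuous (s n))
    (hy : Continuous y) (h : TendstoUniformlyOn s y atTop (Icc 0 1)) (hs' : ∀ n, Continuous (s' n))
    (hy' : Continuous y')
    (h' : Tendsto (fun n => vec (s' n) (hs' n)) atTop (𝓝 (vec y' hy'))) :
    Tendsto (fun n => coercive q κ (s n) (s' n)) atTop (𝓝 (coercive q κ y y')) :=
  ((tendsto_lyap hq κ hs hy h).mul ((tendsto_energy hs' hy' h').const_add 1)).add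
    (((tendsto_expFactor κ hs hy h).mul ((tendsto_weighted_energy
      (continuous_abs_rpow (q := q - 2) (by linarith)) hs hy h hs' hy' h').const_mul _)).const_mul _)

end Hess

/-! ### The gradient of the Lyapunov function paired with the Laplacian and the drift -/

/-- The gradient of the Lyapunov function, as a function on `(0,1)`. -/
noncomputable def gradFun (q κ : ℝ) (f : ℝ → ℝ) (r : ℝ) : ℝ :=
  gradLin q κ f * f r + gradPow q κ f * oddPow q (f r)

/-- The derivative of the gradient of the Lyapunov function. -/
noncomputable def gradFunDeriv (q κ : ℝ) (f f' : ℝ → ℝ) (r : ℝ) : ℝ :=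
  gradLin q κ f * f' r + gradPow q κ f * ((q - 1) * |f r| ^ (q - 2) * f' r)

/-- The pairing of the derivatives of `f` and of the gradient of the Lyapunov function at `f`. -/
noncomputable def gradEnergy (q κ : ℝ) (f f' : ℝ → ℝ) : ℝ :=
  gradLin q κ f * ∫ r, f' r ^ 2 ∂unitVol +
    gradPow q κ f * (q - 1) * ∫ r, |f r| ^ (q - 2) * (f' r * f' r) ∂unitVol

section Grad

variable {q : ℝ} {κ : ℝ} {f f' : ℝ → ℝ}

lemma continuous_gradFun (hq : 2 ≤ q) (κ : ℝ) (hf : Continuous f) : Continuous (gradFun q κ f) :=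
  (continuous_const.mul hf).add (continuous_const.mul (continuous_oddPow_comp hq hf))

lemma isDirichlet_gradFun (hq : 2 ≤ q) (κ : ℝ) (hf : IsDirichlet f f') :
    IsDirichlet (gradFun q κ f) (gradFunDeriv q κ f f') := by
  refine ⟨fun r => ?_, ?_, ?_, ?_⟩
  · exact ((hf.hasDerivAt r).const_mul _).add
      (((hasDerivAt_oddPow hq (f r)).comp r (hf.hasDerivAt r)).const_mul _)
  · exact (continuous_const.mul hf.continuous_deriv).add (continuous_const.mul
      ((continuous_const.mul (continuous_weight hq hf.continuous)).mul hf.continuous_deriv))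
  · simp [gradFun, hf.zero, oddPow]
  · simp [gradFun, hf.one, oddPow]

lemma dlyap_eq_integral_gradFun (hq : 2 ≤ q) (κ : ℝ) (hf : Continuous f) {a : ℝ → ℝ}
    (ha : Continuous a) : dlyap q κ f a = ∫ r, gradFun q κ f r * a r ∂unitVol := by
  rw [dlyap_eq, ← integral_const_mul, ← integral_const_mul, ← integral_add]
  · refine integral_congr_ae (Eventually.of_forall fun r => ?_)
    simp only [gradFun]
    ring
  · exact integrable_unitVol_of_continuous (continuous_const.mul (hf.mul ha))
  · exact integrable_unitVol_of_continuous
      (continuous_const.mul ((continuous_oddPow_comp hq hf).mul ha))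

lemma integral_gradFunDeriv_mul (hq : 2 ≤ q) (κ : ℝ) (hf : IsDirichlet f f') :
    ∫ r, gradFunDeriv q κ f f' r * f' r ∂unitVol = gradEnergy q κ f f' := by
  rw [gradEnergy, ← integral_const_mul, ← integral_const_mul, ← integral_add]
  · refine integral_congr_ae (Eventually.of_forall fun r => ?_)
    simp only [gradFunDeriv]
    ring
  · exact integrable_unitVol_of_continuous (continuous_const.mul (hf.continuous_deriv.pow 2))
  · exact integrable_unitVol_of_continuous (continuous_const.mul
      ((continuous_weight hq hf.continuous).mul (hf.continuous_deriv.mul hf.continuous_deriv)))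

/-- Pairing of the Laplacian with the gradient of the Lyapunov function at a sine polynomial. -/
lemma sum_lap_mul_dlyap (hq : 2 ≤ q) (κ : ℝ) (n : ℕ) (a : ℕ → ℝ) :
    ∑ k ∈ Finset.range n, -(Real.pi * (k + 1)) ^ 2 * a k * dlyap q κ (sinePoly n a) (etaFun k) =
      -gradEnergy q κ (sinePoly n a) (sinePolyDeriv n a) := by
  have hs := isDirichlet_sinePoly n a
  have hD := isDirichlet_gradFun hq κ hs
  rw [← integral_gradFunDeriv_mul hq κ hs, ← integral_mul_deriv_eq_neg hD
    (hasDerivAt_sinePolyDeriv n a) (continuous_sinePoly _ _),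
    integral_mul_sinePoly (memLp_of_continuous hD.continuous 2)]
  refine Finset.sum_congr rfl fun k _ => ?_
  rw [dlyap_eq_integral_gradFun hq κ hs.continuous (continuous_etaFun k)]

/-- Pairing of the Laplacian with the gradient of the Lyapunov function, when this gradient is a
sine polynomial. -/
lemma sum_lap_mul_coeff (hq : 2 ≤ q) (κ : ℝ) (hf : IsDirichlet f f') {N : ℕ} {b : ℕ → ℝ}
    (hb : ∀ r, gradFun q κ f r = sinePoly N b r) :
    ∑ k ∈ Finset.range N, -(Real.pi * (k + 1)) ^ 2 * b k * ∫ r, f r * etaFun k r ∂unitVol =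
      -gradEnergy q κ f f' := by
  have hD := isDirichlet_gradFun hq κ hf
  have hs := isDirichlet_sinePoly N b
  -- Here `f` is only C¹, so its Laplacian is avoided: both derivatives are put on the sine
  -- polynomial that equals the gradient, and one is moved back by parts.
  have hder : ∀ r, gradFunDeriv q κ f f' r = sinePolyDeriv N b r := fun r => by
    have h1 := hD.hasDerivAt r
    rw [funext hb] at h1
    exact h1.unique (hs.hasDerivAt r)
  rw [← integral_gradFunDeriv_mul hq κ hf, ← integral_mul_sinePoly
    (memLp_of_continuous hf.continuous 2) N, integral_mul_deriv_eq_neg hf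
    (hasDerivAt_sinePolyDeriv N b) (continuous_sinePoly _ _)]
  rw [neg_inj]
  refine integral_congr_ae (Eventually.of_forall fun r => ?_)
  simp only [hder]
  exact mul_comm _ _

lemma tendsto_vec_gradFun (hq : 2 ≤ q) (κ : ℝ) {s : ℕ → ℝ → ℝ} {y : ℝ → ℝ}
    (hs : ∀ n, Continuous (s n)) (hy : Continuous y) (h : TendstoUniformlyOn s y atTop (Icc 0 1)) :
    Tendsto (fun n => vec (gradFun q κ (s n)) (continuous_gradFun hq κ (hs n))) atTop
      (𝓝 (vec (gradFun q κ y) (continuous_gradFun hq κ hy))) := by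
  have e : ∀ {f : ℝ → ℝ} (hf : Continuous f), vec (gradFun q κ f) (continuous_gradFun hq κ hf) =
      gradLin q κ f • vec f hf + gradPow q κ f • vec _ (continuous_oddPow_comp hq hf) := by
    intro f hf
    refine Lp.ext ?_
    filter_upwards [coeFn_vec (continuous_gradFun hq κ hf), coeFn_vec hf,
      coeFn_vec (continuous_oddPow_comp hq hf), Lp.coeFn_add (gradLin q κ f • vec f hf)
        (gradPow q κ f • vec _ (continuous_oddPow_comp hq hf)),
      Lp.coeFn_smul (gradLin q κ f) (vec f hf),
      Lp.coeFn_smul (gradPow q κ f) (vec _ (continuous_oddPow_comp hq hf))]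
      with r h1 h2 h3 h4 h5 h6
    rw [h1, h4, Pi.add_apply, h5, h6, Pi.smul_apply, Pi.smul_apply, h2, h3]
    rfl
  rw [e hy]
  refine Filter.Tendsto.congr (fun n => (e (hs n)).symm) ?_
  have ho := tendsto_vec_of_uniform (fun n => continuous_oddPow_comp hq (hs n))
    (continuous_oddPow_comp hq hy) (TendstoUniformlyOn_comp_continuous hy h (continuous_oddPow hq))
  exact ((tendsto_gradLin hq κ hs hy h).smul (tendsto_vec_of_uniform hs hy h)).add
    ((tendsto_gradPow κ hs hy h).smul ho)

/-! ### Projections and the convergence of the drift pairing. -/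

lemma norm_proj_le (n : ℕ) (x : X) : ‖proj n x‖ ≤ ‖x‖ := by
  refine abs_le_of_sq_le_sq' ?_ (norm_nonneg x) |>.2
  rw [EuclideanSpace.norm_sq_eq]
  simp only [proj_apply, Real.norm_eq_abs, sq_abs]
  rw [← Finset.sum_range fun k => inner ℝ x (eta k) ^ 2]
  exact sum_le_hasSum _ (fun _ _ => sq_nonneg _) (hasSum_inner_eta_sq x)

lemma tendsto_inner_proj (x z : X) :
    Tendsto (fun n => inner ℝ (proj n x) (proj n z)) atTop (𝓝 (inner ℝ x z)) := by
  have h := (etaBasis.hasSum_inner_mul_inner x z).tendsto_sum_nat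
  refine h.congr fun n => ?_
  rw [PiLp.inner_apply, Finset.sum_range]
  refine Finset.sum_congr rfl fun i _ => ?_
  rw [etaBasis_apply, proj_apply, proj_apply, real_inner_comm (eta i) z]
  simp [mul_comm]

/-- Convergence of the pairing of the approximating drifts with the gradients. -/
lemma tendsto_inner_drift {G : (n : ℕ) → E n} {x : X} {z : ℕ → X} {z₀ : X}
    (hG : Tendsto (fun n => ‖proj n x - G n‖) atTop (𝓝 0)) (hz : Tendsto z atTop (𝓝 z₀)) :
    Tendsto (fun n => inner ℝ (G n) (proj n (z n))) atTop (𝓝 (inner ℝ x z₀)) := by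
  -- The main term converges by Parseval. The two errors carry the convergence of the gradients and
  -- of the drifts, respectively.
  have hdecomp : ∀ n, inner ℝ (G n) (proj n (z n)) = inner ℝ (proj n x) (proj n z₀) +
      (inner ℝ (proj n x) (proj n (z n - z₀)) - inner ℝ (proj n x - G n) (proj n (z n))) := by
    intro n
    have : proj n (z n - z₀) = proj n (z n) - proj n z₀ := by
      simp only [← projL_apply, map_sub]
    rw [this, inner_sub_right, inner_sub_left]
    ring
  have h1 : Tendsto (fun n => inner ℝ (proj n x) (proj n (z n - z₀))) atTop (𝓝 0) := by
    have hz' : Tendsto (fun n => ‖x‖ * ‖z n - z₀‖) atTop (𝓝 (‖x‖ * 0)) :=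
      (tendsto_iff_norm_sub_tendsto_zero.mp hz).const_mul _
    rw [mul_zero] at hz'
    refine squeeze_zero_norm (fun n => ?_) hz'
    refine (norm_inner_le_norm _ _).trans ?_
    gcongr <;> exact norm_proj_le _ _
  have h2 : Tendsto (fun n => inner ℝ (proj n x - G n) (proj n (z n))) atTop (𝓝 0) := by
    have hz' := hG.mul hz.norm
    rw [zero_mul] at hz'
    refine squeeze_zero_norm (fun n => ?_) hz'
    refine (norm_inner_le_norm _ _).trans ?_
    gcongr
    exact norm_proj_le _ _
  have := (tendsto_inner_proj x z₀).add (h1.sub h2)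
  rw [sub_zero, add_zero] at this
  exact this.congr fun n => (hdecomp n).symm

end Grad

/-! ### Trace inequalities -/

/-- The matrix of `A` is a sum of rank one matrices v vᵀ, and each of them contributes the quadratic
form of C at v. No symmetry of C is needed. -/
lemma sum_covariance_mul_nonneg {A : X →L[ℝ] X} (hA : IsCovariance A) {n : ℕ}
    {C : Fin n → Fin n → ℝ} (hC : ∀ h : Fin n → ℝ, 0 ≤ ∑ i, ∑ j, h i * h j * C i j) :
    0 ≤ ∑ i : Fin n, ∑ j : Fin n, inner ℝ (eta i) (A (eta j)) * C i j := by
  set M : Matrix (Fin n) (Fin n) ℝ :=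
    Matrix.of fun i j : Fin n => inner ℝ (eta (i : ℕ)) (A (eta (j : ℕ))) with hM
  have hsymm : ∀ x z, inner ℝ (A x) z = inner ℝ x (A z) := fun x z => hA.1.1 x z
  have hpos : M.PosSemidef := by
    refine Matrix.PosSemidef.of_dotProduct_mulVec_nonneg ?_ fun h => ?_
    · refine Matrix.IsHermitian.ext fun i j => ?_
      rw [star_trivial, hM, Matrix.of_apply, Matrix.of_apply, ← hsymm, real_inner_comm]
    · have h1 : star h ⬝ᵥ M.mulVec h =
          inner ℝ (∑ i, h i • eta (i : ℕ)) (A (∑ i, h i • eta (i : ℕ))) := by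
        rw [map_sum, sum_inner]
        simp only [dotProduct, Matrix.mulVec, hM, star_trivial, inner_sum, map_smul,
          real_inner_smul_left, real_inner_smul_right, Matrix.of_apply, Finset.mul_sum,
          Pi.star_apply]
        refine Finset.sum_congr rfl fun i _ => Finset.sum_congr rfl fun j _ => ?_
        ring
      rw [h1, ← hsymm]
      exact hA.1.2 _
  obtain ⟨m, v, hv⟩ := Matrix.posSemidef_iff_eq_sum_vecMulVec.mp hpos
  have hMv : ∀ i j : Fin n, inner ℝ (eta (i : ℕ)) (A (eta (j : ℕ))) = ∑ k, v k i * v k j := by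
    intro i j
    have := congrFun (congrFun hv i) j
    rw [Matrix.sum_apply] at this
    simpa [hM, Matrix.vecMulVec_apply] using this
  have e : ∑ i : Fin n, ∑ j : Fin n, inner ℝ (eta i) (A (eta j)) * C i j =
      ∑ k, ∑ i, ∑ j, v k i * v k j * C i j := by
    simp only [hMv, Finset.sum_mul]
    rw [Finset.sum_comm (γ := Fin m)]
    exact Finset.sum_congr rfl fun i _ => Finset.sum_comm
  rw [e]
  exact Finset.sum_nonneg fun k _ => hC (v k)

lemma incl_eq_sum (n : ℕ) (h : Fin n → ℝ) : incl n (WithLp.toLp 2 h) = ∑ i, h i • eta (i : ℕ) := rfl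

lemma bilin_sum (B : X →ₗ[ℝ] X →ₗ[ℝ] ℝ) (n : ℕ) (h : Fin n → ℝ) :
    B (incl n (WithLp.toLp 2 h)) (incl n (WithLp.toLp 2 h)) =
      ∑ i : Fin n, ∑ j : Fin n, h i * h j * B (eta j) (eta i) := by
  rw [incl_eq_sum]
  simp only [map_sum, map_smul, LinearMap.sum_apply, LinearMap.smul_apply, smul_eq_mul,
    Finset.mul_sum]
  refine Finset.sum_congr rfl fun i _ => Finset.sum_congr rfl fun j _ => ?_
  ring

lemma inner_eta_map_nonneg {A : X →L[ℝ] X} (hA : IsCovariance A) (x : X) : 0 ≤ inner ℝ x (A x) := by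
  have h1 : inner ℝ (A x) x = inner ℝ x (A x) := hA.1.1 x x
  rw [← h1]
  exact hA.1.2 x

/-- The trace of a bounded form against the covariance is controlled by the bound of the form. -/
lemma neg_mul_trace_le {A : X →L[ℝ] X} (hA : IsCovariance A) {B : X →ₗ[ℝ] X →ₗ[ℝ] ℝ} {K : ℝ}
    (hK : 0 ≤ K) (hB : ∀ h k, |B h k| ≤ K * ‖h‖ * ‖k‖) (n : ℕ) :
    -(K * ∑' k : ℕ, inner ℝ (eta k) (A (eta k))) ≤
      ∑ i : Fin n, ∑ j : Fin n, inner ℝ (eta i) (A (eta j)) * B (eta j) (eta i) := by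
  -- The form B + K·id is nonnegative because |B(h,h)| ≤ K|h|², and the trace of `A` on E_n is at
  -- most its full trace.
  have h := sum_covariance_mul_nonneg hA (n := n)
    (C := fun i j => B (eta j) (eta i) + K * if i = j then 1 else 0) (fun h => by
      have h1 : ∑ i : Fin n, ∑ j : Fin n, h i * h j * (B (eta j) (eta i) +
          K * if i = j then 1 else 0) =
          B (incl n (WithLp.toLp 2 h)) (incl n (WithLp.toLp 2 h)) +
            K * ‖incl n (WithLp.toLp 2 h)‖ ^ 2 := by
        rw [bilin_sum, norm_incl_sq, EuclideanSpace.norm_sq_eq, Finset.mul_sum,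
          ← Finset.sum_add_distrib]
        refine Finset.sum_congr rfl fun i _ => ?_
        simp only [mul_add, Finset.sum_add_distrib]
        simp [sq]
        ring
      rw [h1]
      have h2 := hB (incl n (WithLp.toLp 2 h)) (incl n (WithLp.toLp 2 h))
      have := neg_abs_le (B (incl n (WithLp.toLp 2 h)) (incl n (WithLp.toLp 2 h)))
      nlinarith)
  have h3 : ∑ i : Fin n, inner ℝ (eta i) (A (eta i)) ≤ ∑' k : ℕ, inner ℝ (eta k) (A (eta k)) := by
    rw [← Finset.sum_range fun k => inner ℝ (eta k) (A (eta k))]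
    exact hA.2.sum_le_tsum _ fun k _ => inner_eta_map_nonneg hA _
  have h4 : ∑ i : Fin n, ∑ j : Fin n, inner ℝ (eta i) (A (eta j)) * (B (eta j) (eta i) +
      K * if i = j then 1 else 0) =
      ∑ i : Fin n, ∑ j : Fin n, inner ℝ (eta i) (A (eta j)) * B (eta j) (eta i) +
        K * ∑ i : Fin n, inner ℝ (eta i) (A (eta i)) := by
    rw [Finset.mul_sum, ← Finset.sum_add_distrib]
    refine Finset.sum_congr rfl fun i _ => ?_
    simp only [mul_add, Finset.sum_add_distrib]
    simp [mul_comm]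
  rw [h4] at h
  have := mul_le_mul_of_nonneg_left h3 (hK)
  linarith

/-! ### The generator at a maximizer -/

lemma abs_etaFun_le (k : ℕ) (r : ℝ) : |etaFun k r| ≤ √2 := by
  rw [etaFun, abs_mul, abs_of_nonneg (Real.sqrt_nonneg _)]
  exact mul_le_of_le_one_right (Real.sqrt_nonneg _) (Real.abs_sin_le_one _)

lemma eq_vec {x : X} {f : ℝ → ℝ} (hf : Continuous f) (h : x =ᵐ[unitVol] f) : x = vec f hf :=
  Lp.ext (h.trans (coeFn_vec hf).symm)

lemma inner_vec_right (x : X) {f : ℝ → ℝ} (hf : Continuous f) :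
    inner ℝ x (vec f hf) = ∫ r, x r * f r ∂unitVol := by
  rw [vec, inner_toLp_right]

section Cylinder

variable {N : ℕ} {g : E N → ℝ}

/-- The Hessian of the cylinder function `g ∘ P_N`. -/
noncomputable def cylHess (g : E N → ℝ) (x : X) : X →ₗ[ℝ] X →ₗ[ℝ] ℝ :=
  LinearMap.mk₂ ℝ (fun h k => fderiv ℝ (fderiv ℝ g) (proj N x) (projL N k) (projL N h))
    (by simp) (by simp) (by simp) (by simp)

lemma cylHess_apply (hg : ContDiff ℝ 2 g) (x h k : X) :
    cylHess g x h k =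
      fderiv ℝ (fun ξ => fderiv ℝ g ξ (proj N h)) (proj N x) (proj N k) := by
  have h1 : HasFDerivAt (fderiv ℝ g) (fderiv ℝ (fderiv ℝ g) (proj N x)) (proj N x) :=
    ((hg.fderiv_right (m := 1) (by norm_num)).differentiable (by norm_num) _).hasFDerivAt
  have h2 := h1.clm_apply (hasFDerivAt_const (proj N h) (proj N x))
  rw [h2.fderiv]
  simp [cylHess, projL_apply]

lemma traceTerm_eq_sum_cylHess (A : X →L[ℝ] X) (hg : ContDiff ℝ 2 g) {n : ℕ} (hn : N ≤ n) (x : X) :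
    traceTerm A (g ∘ proj N) x = ∑ i : Fin n, ∑ j : Fin n, inner ℝ (eta i) (A (eta j)) *
      cylHess g x (eta j) (eta i) := by
  simp only [traceTerm_cylinder A hg hn, pd_pd_cylinder hg, cylHess_apply hg]

end Cylinder

section Maximizer

variable {q κ c : ℝ} {N : ℕ} {g : E N → ℝ} {x₀ : X} {A : X →L[ℝ] X}

/-- Sine polynomials are bounded directions, so cD²V - D²u is nonnegative on every E_n. For n ≥ N
the trace of D²u over E_n is already complete. -/
lemma traceTerm_le_of_max (hA : IsCovariance A) (hq : 2 ≤ q) (hg : ContDiff ℝ 2 g)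
    (hx₀ : x₀ ∈ Xp q) (heq : g (proj N x₀) = c * (V q κ x₀).toReal)
    (hle : ∀ x ∈ Xp q, g (proj N x) ≤ c * (V q κ x).toReal) {y : ℝ → ℝ} (hy : Continuous y)
    (hxy : x₀ =ᵐ[unitVol] y) {n : ℕ} (hn : N ≤ n) :
    traceTerm A (g ∘ proj N) x₀ ≤ c * ∑ i : Fin n, ∑ j : Fin n, inner ℝ (eta i) (A (eta j)) *
      hessForm hq κ y hy (eta j) (eta i) := by
  have h0 := sum_covariance_mul_nonneg hA (n := n)
    (C := fun i j => (c • hessForm hq κ y hy - cylHess g x₀) (eta j) (eta i)) fun h => by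
      rw [← bilin_sum]
      set f : ℝ → ℝ := fun r => ∑ i : Fin n, h i * etaFun i r with hf
      have hfc : Continuous f :=
        continuous_finsetSum _ fun i _ => continuous_const.mul (continuous_etaFun i)
      have hXf : incl n (WithLp.toLp 2 h) =ᵐ[unitVol] f := coeFn_incl n (WithLp.toLp 2 h)
      have h1 := (variation_conditions hq hg hx₀ heq hle hfc.aestronglyMeasurable
        (K := ∑ i, |h i| * √2) (fun r => (Finset.abs_sum_le_sum_abs _ _).trans
          (Finset.sum_le_sum fun i _ => by
            rw [abs_mul]
            gcongr
            exact abs_etaFun_le _ _)) hXf).2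
      rw [ddlyap_congr hxy, ddlyap_eq_hessForm hq κ hy hfc hfc, ← eq_vec hfc hXf,
        ← cylHess_apply hg] at h1
      rw [LinearMap.sub_apply, LinearMap.sub_apply, LinearMap.smul_apply, LinearMap.smul_apply,
        smul_eq_mul]
      linarith
  rw [traceTerm_eq_sum_cylHess A hg hn]
  simp only [LinearMap.sub_apply, LinearMap.smul_apply, smul_eq_mul, mul_sub,
    Finset.sum_sub_distrib] at h0
  refine (sub_nonneg.mp h0).trans_eq ?_
  simp only [Finset.mul_sum, mul_left_comm c]

/-- By the first order condition the partial derivatives of `u` are c times the sine coefficients of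
DV, so the first order part of Lu is c times the pairing of Laplacian and drift with DV. -/
lemma kolm_eq_of_max {F : H01 → X} (hq : 2 ≤ q) (hc : 0 < c) (hg : ContDiff ℝ 2 g)
    {y y' : ℝ → ℝ} (hy : IsDirichlet y y') (hxy : x₀ =ᵐ[unitVol] y) (hx : x₀ ∈ H01)
    (hb : ∀ r, gradFun q κ y r = sinePoly N (fun k => gradCoeff g (proj N x₀) k / c) r) :
    kolm A F (g ∘ proj N) ⟨x₀, hx⟩ = 1 / 2 * traceTerm A (g ∘ proj N) x₀ +
      c * (-gradEnergy q κ y y' +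
        inner ℝ (F ⟨x₀, hx⟩) (vec (gradFun q κ y) (continuous_gradFun hq κ hy.continuous))) := by
  have h1 := sum_lap_mul_coeff hq κ hy hb
  have h2 : inner ℝ (F ⟨x₀, hx⟩) (vec (gradFun q κ y) (continuous_gradFun hq κ hy.continuous)) =
      ∑ k ∈ Finset.range N, gradCoeff g (proj N x₀) k / c * inner ℝ (F ⟨x₀, hx⟩) (eta k) := by
    rw [inner_vec_right]
    simp only [hb]
    rw [integral_mul_sinePoly (Lp.memLp _)]
    simp only [eta, inner_toLp_right]
  rw [kolm_cylinder A F hg, h2, ← h1, ← Finset.sum_add_distrib, Finset.mul_sum]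
  congr 1
  refine Finset.sum_congr rfl fun k _ => ?_
  rw [← inner_vec_eta hy.continuous, ← eq_vec hy.continuous hxy,
    pd_cylinder (hg.differentiable (by norm_num)), lapCoeff]
  simp only [Function.comp, gradCoeff]
  field_simp

/-- The Lyapunov inequality of the approximating generator along the projections of a regular
function, written in terms of the representatives. -/
lemma approx_inequality (hq : 2 ≤ q) {n : ℕ} {G : E n → E n} {l m : ℝ} (x : X)
    (h : kolmFin A n G (fun ζ => (V q κ (incl n ζ)).toReal) (proj n x) ≤
      l * (V q κ (incl n (proj n x))).toReal - m * (Θ q κ (incl n (proj n x))).toReal) :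
    1 / 2 * ∑ i : Fin n, ∑ j : Fin n, inner ℝ (eta i) (A (eta j)) *
        hessForm hq κ (sinePoly n fun k => inner ℝ x (eta k)) (continuous_sinePoly _ _)
          (eta j) (eta i) +
      (-gradEnergy q κ (sinePoly n fun k => inner ℝ x (eta k))
          (sinePolyDeriv n fun k => inner ℝ x (eta k)) +
        inner ℝ (G (proj n x)) (proj n (vec (gradFun q κ (sinePoly n fun k => inner ℝ x (eta k)))
          (continuous_gradFun hq κ (continuous_sinePoly _ _))))) ≤
      l * lyap q κ (sinePoly n fun k => inner ℝ x (eta k)) -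
        m * coercive q κ (sinePoly n fun k => inner ℝ x (eta k))
          (sinePolyDeriv n fun k => inner ℝ x (eta k)) := by
  set a : ℕ → ℝ := fun k => inner ℝ x (eta k) with ha
  have hs := isDirichlet_sinePoly n a
  have hcs := coeFn_incl_proj n x
  rw [kolmFin_V hq κ A n G (proj n x) (s := sinePoly n a) (fun r => by
    simp only [sinePoly, proj_apply, ha]
    rw [Finset.sum_range]), toReal_V hq κ hcs (memLp_of_continuous hs.continuous _),
    Theta_eq_ofReal hq κ hs hcs, ENNReal.toReal_ofReal (coercive_nonneg _ _ _ _)] at h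
  have e1 : ∀ k : ℕ, vec (etaFun k) (continuous_etaFun k) = eta k := fun k => rfl
  have e2 : ∀ i j : ℕ, ddlyap q κ (sinePoly n a) (etaFun j) (etaFun i) =
      hessForm hq κ (sinePoly n a) hs.continuous (eta j) (eta i) := fun i j => by
    rw [ddlyap_eq_hessForm hq κ hs.continuous (continuous_etaFun j) (continuous_etaFun i), e1, e1]
  have e3 : ∑ k : Fin n, (lapCoeff (incl n (proj n x)) k + G (proj n x) k) *
      dlyap q κ (sinePoly n a) (etaFun k) = -gradEnergy q κ (sinePoly n a) (sinePolyDeriv n a) +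
        inner ℝ (G (proj n x)) (proj n (vec (gradFun q κ (sinePoly n a))
          (continuous_gradFun hq κ hs.continuous))) := by
    rw [← sum_lap_mul_dlyap hq κ n a, Finset.sum_range, PiLp.inner_apply, ← Finset.sum_add_distrib]
    refine Finset.sum_congr rfl fun k _ => ?_
    rw [proj_apply, inner_vec_eta, ← dlyap_eq_integral_gradFun hq κ hs.continuous
      (continuous_etaFun k), lapCoeff, inner_incl_eta, proj_apply, add_mul]
    simp [mul_comm, ha]
  simp only [e2, e3] at h
  exact h

lemma tendsto_gradEnergy (hq : 2 ≤ q) (κ : ℝ) {s s' : ℕ → ℝ → ℝ} {y y' : ℝ → ℝ}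
    (hs : ∀ n, Continuous (s n)) (hy : Continuous y) (h : TendstoUniformlyOn s y atTop (Icc 0 1))
    (hs' : ∀ n, Continuous (s' n)) (hy' : Continuous y')
    (h' : Tendsto (fun n => vec (s' n) (hs' n)) atTop (𝓝 (vec y' hy'))) :
    Tendsto (fun n => gradEnergy q κ (s n) (s' n)) atTop (𝓝 (gradEnergy q κ y y')) :=
  ((tendsto_gradLin hq κ hs hy h).mul (tendsto_energy hs' hy' h')).add
    (((tendsto_gradPow κ hs hy h).mul_const (q - 1)).mul (tendsto_weighted_energy
      (continuous_abs_rpow (q := q - 2) (by linarith)) hs hy h hs' hy' h'))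

/-- The generator of a cylinder function at a maximum point of its quotient by the Lyapunov
function. -/
lemma kolm_le_of_max (hA : IsCovariance A) (hq : 2 ≤ q) (hκ : 0 < κ) (hc : 0 < c)
    (hg : ContDiff ℝ 2 g) (hx₀ : x₀ ∈ Xp q) (heq : g (proj N x₀) = c * (V q κ x₀).toReal)
    (hle : ∀ x ∈ Xp q, g (proj N x) ≤ c * (V q κ x).toReal) {F : H01 → X}
    {G : (n : ℕ) → E n → E n} (hFG : CondF2c F G) {l m : ℝ}
    (hL : ∀ n : ℕ, 1 ≤ n → ∀ ξ : E n,
      kolmFin A n (G n) (fun ζ => (V q κ (incl n ζ)).toReal) ξ ≤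
        l * (V q κ (incl n ξ)).toReal - m * (Θ q κ (incl n ξ)).toReal) :
    ∃ hx : x₀ ∈ H01, Θ q κ x₀ ≠ ⊤ ∧ kolm A F (g ∘ proj N) ⟨x₀, hx⟩ ≤
      c * (l * (V q κ x₀).toReal - m * (Θ q κ x₀).toReal) := by
  obtain ⟨y, y', hy, hxy, hye⟩ := exists_regular_representative hq hκ hc hg hx₀ heq hle
  have hx := mem_H01_of_isDirichlet hy hxy
  refine ⟨hx, ?_, ?_⟩
  · rw [Theta_eq_ofReal hq κ hy hxy]
    exact ENNReal.ofReal_ne_top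
  rw [Theta_eq_ofReal hq κ hy hxy, ENNReal.toReal_ofReal (coercive_nonneg _ _ _ _),
    toReal_V hq κ hxy (memLp_of_continuous hy.continuous _), kolm_eq_of_max hq hc hg hy hxy hx hye]
  have hs : ∀ n, IsDirichlet (sinePoly n fun k => inner ℝ x₀ (eta k)) _ := fun n =>
    isDirichlet_sinePoly n _
  have hu := tendstoUniformlyOn_sinePoly hy hxy
  have hd := tendsto_vec_sinePolyDeriv hy hxy
  obtain ⟨-, ε, hε, hε0, hB⟩ := FormTendsto.hessForm hq κ (fun n => (hs n).continuous)
    hy.continuous hu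
  have t1 := tendsto_gradEnergy hq κ (fun n => (hs n).continuous) hy.continuous hu
    (fun n => (hs n).continuous_deriv) hy.continuous_deriv hd
  have t2 := tendsto_inner_drift (hFG ⟨x₀, hx⟩)
    (tendsto_vec_gradFun hq κ (fun n => (hs n).continuous) hy.continuous hu)
  have t3 := tendsto_lyap hq κ (fun n => (hs n).continuous) hy.continuous hu
  have t4 := tendsto_coercive hq κ (fun n => (hs n).continuous) hy.continuous hu
    (fun n => (hs n).continuous_deriv) hy.continuous_deriv hd
  set T : ℝ := ∑' k : ℕ, inner ℝ (eta k) (A (eta k))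
  -- The Hessian at P_n x₀ differs from that at x₀ by at most ε_n in operator norm, so the trace
  -- error is at most ε_n Tr A. Only this one-sided bound is needed, not convergence of the traces.
  have t5 : Tendsto (fun n => 1 / 2 * (traceTerm A (g ∘ proj N) x₀ - c * (ε n * T))) atTop
      (𝓝 (1 / 2 * traceTerm A (g ∘ proj N) x₀)) := by
    have := (((hε0.mul_const T).const_mul c).const_sub
      (traceTerm A (g ∘ proj N) x₀)).const_mul (1 / 2)
    simpa using this
  refine le_of_tendsto_of_tendsto (t5.add ((t1.neg.add t2).const_mul c))
    (((t3.const_mul l).sub (t4.const_mul m)).const_mul c) ?_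
  filter_upwards [eventually_ge_atTop N, eventually_ge_atTop 1] with n hn hn1
  have i1 := approx_inequality hq x₀ (hL n hn1 (proj n x₀))
  have i2 := traceTerm_le_of_max hA hq hg hx₀ heq hle hy.continuous hxy hn
  have i3 := neg_mul_trace_le hA (B := hessForm hq κ _ (hs n).continuous -
    hessForm hq κ y hy.continuous) (hε n) (fun h k => hB n h k) n
  simp only [LinearMap.sub_apply, mul_sub, Finset.sum_sub_distrib] at i3
  have i4 := mul_le_mul_of_nonneg_left i3 hc.le
  have i5 := mul_le_mul_of_nonneg_left i1 hc.le
  simp only [mul_add, mul_sub, mul_neg] at i4 i5 ⊢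
  linarith

end Maximizer

/-! ### The weighted resolvent estimate -/

lemma pd_neg {B : Type*} [NormedAddCommGroup B] [NormedSpace ℝ B] (h : B) (u : B → ℝ) :
    pd h (fun x => -u x) = fun x => -pd h u x := by
  funext x
  simp [pd, fderiv_fun_neg]

lemma kolm_neg (A : X →L[ℝ] X) (F : H01 → X) (u : X → ℝ) (x : H01) :
    kolm A F (fun x => -u x) x = -kolm A F u x := by
  simp only [kolm, traceTerm, pd_neg, mul_neg, tsum_neg]
  ring

/-- The one-sided estimate for the positive part of `u`; if that part vanishes there is nothing to
prove, otherwise the inequality is tested at the maximizer. -/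
lemma iSup_ofReal_div_le {A : X →L[ℝ] X} (hA : IsCovariance A) {F : H01 → X}
    {G : (n : ℕ) → E n → E n} (hFG : CondF2c F G) {q κ κ₁ l l' m : ℝ} (hq : 2 ≤ q)
    (hκ₁ : κ₁ ∈ Ico 0 κ) (hm : 0 < m) (hl : l ≤ l')
    (hL : ∀ n : ℕ, 1 ≤ n → ∀ ξ : E n,
      kolmFin A n (G n) (fun ζ => (V q κ (incl n ζ)).toReal) ξ ≤
        l * (V q κ (incl n ξ)).toReal - m * (Θ q κ (incl n ξ)).toReal)
    {N : ℕ} {g : E N → ℝ} (hg : ContDiff ℝ 2 g) {C : ℝ}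
    (hC : ∀ x, |g (proj N x)| ≤ C * expW κ₁ x) :
    ⨆ x : Xp q, ENNReal.ofReal (g (proj N x)) / V q κ x ≤ (ENNReal.ofReal m)⁻¹ *
      wnorm (Θ q κ) (fun x : H01 => l' * (g ∘ proj N) x - kolm A F (g ∘ proj N) x) := by
  have hκ : 0 < κ := hκ₁.1.trans_lt hκ₁.2
  by_cases hM0 : ⨆ x : Xp q, ENNReal.ofReal (g (proj N x)) / V q κ x = 0
  · rw [hM0]
    exact zero_le
  obtain ⟨c, hc, hMc, x₀, hx₀, heq, hle⟩ := exists_maximizer hq hκ₁ hg.continuous hC rfl hM0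
  obtain ⟨hx, hΘ, hK⟩ := kolm_le_of_max hA hq hκ hc hg hx₀ heq hle hFG hL
  rw [hMc, mul_comm, ← div_eq_mul_inv,
    ENNReal.le_div_iff_mul_le (Or.inl (by simpa using hm)) (Or.inl ENNReal.ofReal_ne_top),
    ← ENNReal.ofReal_mul hc.le]
  refine le_trans ?_ (le_iSup (fun x : H01 =>
    ‖l' * (g ∘ proj N) x - kolm A F (g ∘ proj N) x‖ₑ / Θ q κ x) ⟨x₀, hx⟩)
  have hΘ0 : Θ q κ x₀ ≠ 0 :=
    (one_pos.trans_le ((one_le_V hκ.le q x₀).trans (V_le_Theta q κ hx))).ne'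
  rw [ENNReal.le_div_iff_mul_le (Or.inl hΘ0) (Or.inl hΘ)]
  refine le_trans ?_ (Real.ofReal_le_enorm _)
  rw [← ENNReal.ofReal_toReal hΘ, ← ENNReal.ofReal_mul (by positivity)]
  refine ENNReal.ofReal_le_ofReal ?_
  -- Since u = cV ≥ 0 at the maximizer, the constant of (F2a) may be replaced by any larger one.
  have h1 : c * (l * (V q κ x₀).toReal) ≤ l' * (c * (V q κ x₀).toReal) := by
    rw [mul_left_comm]
    exact mul_le_mul_of_nonneg_right hl (by positivity)
  simp only [Function.comp, heq]
  simp only [mul_sub] at hK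
  linarith

/-- The operator L is linear, so the one-sided bound applied to -u has the same right-hand side and
covers the points where `u` is negative. -/
lemma wnorm_le_resolvent {A : X →L[ℝ] X} (hA : IsCovariance A) {F : H01 → X}
    {G : (n : ℕ) → E n → E n} (hFG : CondF2c F G) {q κ κ₁ l l' m : ℝ} (hq : 2 ≤ q)
    (hκ₁ : κ₁ ∈ Ico 0 κ) (hm : 0 < m) (hl : l ≤ l')
    (hL : ∀ n : ℕ, 1 ≤ n → ∀ ξ : E n,
      kolmFin A n (G n) (fun ζ => (V q κ (incl n ζ)).toReal) ξ ≤
        l * (V q κ (incl n ξ)).toReal - m * (Θ q κ (incl n ξ)).toReal)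
    {u : X → ℝ} (hu : u ∈ testFun A 2 κ₁) :
    wnorm (V q κ) (fun x : Xp q => u x) ≤ (ENNReal.ofReal m)⁻¹ *
      wnorm (Θ q κ) (fun x : H01 => l' * u x - kolm A F u x) := by
  obtain ⟨⟨N, g, hg, rfl⟩, hfin⟩ := hu
  obtain ⟨C, -, hC⟩ := exists_bound_of_wnorm_lt_top
    ((le_self_add.trans le_self_add).trans_lt hfin)
  have h1 := iSup_ofReal_div_le hA hFG hq hκ₁ hm hl hL hg hC
  have h2 := iSup_ofReal_div_le hA hFG hq hκ₁ hm hl hL hg.neg (C := C) fun x => by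
    rw [abs_neg]
    exact hC x
  have h3 : wnorm (Θ q κ) (fun x : H01 =>
        l' * ((fun ξ => -g ξ) ∘ proj N) x - kolm A F ((fun ξ => -g ξ) ∘ proj N) x) =
      wnorm (Θ q κ) (fun x : H01 => l' * (g ∘ proj N) x - kolm A F (g ∘ proj N) x) := by
    refine iSup_congr fun x => ?_
    have e : kolm A F ((fun ξ => -g ξ) ∘ proj N) x = -kolm A F (g ∘ proj N) x :=
      kolm_neg A F (g ∘ proj N) x
    beta_reduce
    rw [e, ← enorm_neg]
    congr 2
    simp only [Function.comp]
    ring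
  rw [h3] at h2
  refine iSup_le fun x => ?_
  change ‖g (proj N x)‖ₑ / V q κ x ≤ _
  rcases le_total 0 (g (proj N x)) with h | h
  · rw [Real.enorm_of_nonneg h]
    exact (le_iSup (fun x : Xp q => ENNReal.ofReal (g (proj N x)) / V q κ x) x).trans h1
  · rw [← enorm_neg, Real.enorm_of_nonneg (neg_nonneg.mpr h)]
    exact (le_iSup (fun x : Xp q => ENNReal.ofReal (-g (proj N x)) / V q κ x) x).trans h2

end Kolmogorov

theorem proposition6p1
    (A : X →L[ℝ] X) (hA : IsCovariance A)
    (F : H01 → X) (FN : (N : ℕ) → E N → E N) (hFN : IsApprox FN)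
    (κ₀ : ℝ) (Qreg : Set ℝ) (m lam : ℝ → ℝ → ℝ)
    (hF2a : CondF2a A FN κ₀ Qreg m lam) (hF2c : CondF2c F FN)
    (q : ℝ) (hq : q ∈ Qreg) (κ : ℝ) (hκ : κ ∈ Ioo 0 κ₀) (κ₁ : ℝ) (hκ₁ : κ₁ ∈ Ico 0 κ)
    (hF : ∀ k : ℕ, MemWC (Θ q κ) fun x : H01 => expW κ₁ x * inner ℝ (F x) (eta k)) :
    ∀ u ∈ testFun A 2 κ₁, ∀ l : ℝ, lam q κ ≤ l →
      MemWC (V q κ) (fun x : Xp q => u x) ∧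
      MemWC (Θ q κ) (fun x : H01 => l * u x - kolm A F u x) ∧
      wnorm (V q κ) (fun x : Xp q => u x) ≤
        (ENNReal.ofReal (m q κ))⁻¹ * wnorm (Θ q κ) (fun x : H01 => l * u x - kolm A F u x) := by
  intro u hu l hl
  obtain ⟨-, -, hQ, -, hL⟩ := hF2a
  obtain ⟨hm, hLN⟩ := hL κ hκ q hq
  exact ⟨memWC_testFun hκ₁ hu, memWC_resolvent hκ₁ hF hu l,
    wnorm_le_resolvent hA hF2c (hQ hq) hκ₁ hm hl hLN hu⟩
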